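/- **Setting.** In the external-memory model, records are stored in external memory in blocks of $B$ consecutive slots, internal memory holds $M \ge 3B$ records, and a slot can be read or modified only while its block is in internal memory; copying a block from external into internal memory is a block transfer. Internal memory keeps $\lfloor M/B\rfloor-1$ blocks under least-recently-used replacement; the rest is left for the program's registers. Keys have independent hashes $h(u)$ uniform in $[0,1)$. In a table with slots $0,\dots,n-1$, the home slot of a hash $r$ is $\lfloor n r\rfloor$. **Graveyard hashing** with parameter $x\ge 1$ and minimum capacity $L\ge B$ is the following ordered linear-probing table with tombstones and wrap-around. Keys and tombstones of a run are kept in the (cyclic) order of their hashes. A query for $u$ examines slots from the home slot of $u$ onwards until it finds $u$, an item with larger hash, or a free slot. A deletion performs a query and replaces the key, if found, by a tombstone with the same hash. An insertion examines slots from the home slot of $u$ onwards up to the position where $u$ belongs (before all items whose hash is at least $h(u)$), puts $u$ there, and shifts the following keys to the right by one until it reaches a tombstone or a free slot, which it uses up. At a rebuild with $m$ keys, the number of slots is set to $n=\max(L,\,m+\lceil m/x\rceil)$, all tombstones are removed, and, with $f=n-m$, new tombstones with home slots $\lfloor 2kn/f\rfloor-1$, $1\le k\le \lfloor f/2\rfloor$,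 are added. The next rebuild is made after $\max(1,\lfloor f/4\rfloor)$ further insertions and deletions. (So if the load factor at the rebuild is $1-1/y$, about $n/(2y)$ tombstones at distance $2y$ are created and the rebuild window has about $n/(4y)$ updates.) Rebuilds are carried out by a fixed constant number of sequential scans of the old and of the new array. The table is initially a newly built empty table, whose construction is not charged. **Statement.** Let $x\ge 1$ and $B$ vary along any family (filter) with $x=o(B)$. Then there is a quantity $e=o(1)$, depending only on the family, such that, for all sufficiently advanced members, all $M\ge 3B$, all $L\ge B$, every set of keys and every finite sequence of $T$ insertions, deletions and queries that is fixed independently of the hashes and inserts only absent keys: 1. almost surely, after the sequence (hence, applying this to its prefixes, after each operation) the load factor is at most $1-\frac1{4x}$, and it is at least $1-\frac4x$ if at least $L$ keys are present; that is, it is maintained to be $1-1/\Theta(x)$; 2. the expected total number of block transfers of the $T$ operations, including all rebuilds, is at most $(1+e)\,T$. That is, graveyard hashing incurs amortized expected $1+o(1)$ block transfers per operation. -/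

import Mathlib

open Filter Topology MeasureTheory ProbabilityTheory Asymptotics
open scoped ENNReal

namespace Graveyard

noncomputable section

/-- The parameters: `B` records fit into a block and `M` records fit in internal memory;
`x` is the load-factor parameter of the table, and `L` is its minimum capacity. -/
structure Config where
  B : ℕ
  M : ℕ
  L : ℕ
  x : ℝ

/-! ### The external-memory model

External memory consists of two arrays of slots, each cut into blocks of `B` consecutive slots.
Internal memory holds `M` records: it has room for `M / B - 1` blocks (with least-recently-used
replacement), and the space of one further block is left for the constantly many registers of the
program.  A slot can be read or modified only while its block is in internal memory; copying a
block from external into internal memory is a block transfer. -/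

/-- A slot is free, contains a key, or contains a tombstone; a tombstone has a hash of its own. -/
inductive Slot (U : Type*) where
  | free : Slot U
  | key (u : U) : Slot U
  | tomb (r : ℝ) : Slot U

/-- The state of the memory: the contents of the two arrays, the blocks that are currently in
internal memory (most recently used first), and the number of block transfers so far.
A block is named by its array and its index in that array. -/
structure Mem (U : Type*) where
  arr : Bool → ℕ → Slot U
  resident : List (Bool × ℕ)
  transfers : ℕ

/-- Access slot `i` of array `b`: its block is brought into internal memory if it is not there,
it becomes the most recently used one, and the least recently used block is evicted if the
internal memory overflows. -/
def Mem.touch {U : Type*} (c : Config) (s : Mem U) (b : Bool) (i : ℕ) : Mem U where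
  arr := s.arr
  resident := ((b, i / c.B) :: s.resident.erase (b, i / c.B)).take (c.M / c.B - 1)
  transfers := s.transfers + if (b, i / c.B) ∈ s.resident then 0 else 1

/-- Read slot `i` of array `b`. -/
def Mem.read {U : Type*} (c : Config) (s : Mem U) (b : Bool) (i : ℕ) : Slot U × Mem U :=
  (s.arr b i, s.touch c b i)

/-- Write `v` into slot `i` of array `b`. -/
def Mem.write {U : Type*} (c : Config) (s : Mem U) (b : Bool) (i : ℕ) (v : Slot U) : Mem U :=
  { s.touch c b i with arr := Function.update s.arr b (Function.update (s.arr b) i v) }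

/-! ### Ordered linear probing with tombstones

A key `u` has a random hash `h u ∈ [0, 1)`.  In a table with `n` slots `0, …, n - 1` its hash is
the slot `⌊n * h u⌋`, and keys and tombstones with the same slot as hash are ordered by `h`.
The end of the table wraps around to its beginning. -/

/-- The registers of the table: the array that it occupies, its number of slots, the number
of keys that it contains, and the number of insertions and deletions left until it is rebuilt. -/
structure Table where
  side : Bool
  cap : ℕ
  keys : ℕ
  left : ℕ

/-- The slot to which a hash `r ∈ [0, 1)` belongs in a table with `n` slots. -/
def home (n : ℕ) (r : ℝ) : ℕ := ⌊(n : ℝ) * r⌋₊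

/-- The hash of the key or tombstone in a slot. -/
def Slot.hash? {U : Type*} (h : U → ℝ) : Slot U → Option ℝ
  | .free => none
  | .key u => some (h u)
  | .tomb r => some r

/-- The cyclic distance from the home slot of the hash `r` to slot `p`. -/
def disp (n p : ℕ) (r : ℝ) : ℕ := (p + n - home n r) % n

/-- The slot examined at distance `i` from the home slot of `r₀` contains an item with hash `r`;
`r` is larger than `r₀` in the cyclic order of the run. -/
def HashGT (n i : ℕ) (r r₀ : ℝ) : Prop :=
  disp n ((home n r₀ + i) % n) r < i ∨ disp n ((home n r₀ + i) % n) r = i ∧ r₀ < r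

/-- As `HashGT`, but `r` is at least `r₀`. -/
def HashGE (n i : ℕ) (r r₀ : ℝ) : Prop :=
  disp n ((home n r₀ + i) % n) r < i ∨ disp n ((home n r₀ + i) % n) r = i ∧ r₀ ≤ r

open Classical in
/-- Search for the key `u`, starting at distance `i` from its home slot: examine one slot after
the other until `u`, or an item with a larger hash, or a free slot is found.  The result is
the slot in which `u` is. -/
def find {U : Type*} (c : Config) (h : U → ℝ) (t : Table) (u : U) :
    (fuel : ℕ) → (i : ℕ) → Mem U → Option ℕ × Mem U
  | 0, _, s => (none, s)
  | fuel + 1, i, s =>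
    let p := (home t.cap (h u) + i) % t.cap
    let (v, s) := s.read c t.side p
    match v with
    | .free => (none, s)
    | .key w =>
      if w = u then (some p, s)
      else if HashGT t.cap i (h w) (h u) then (none, s)
      else find c h t u fuel (i + 1) s
    | .tomb r =>
      if HashGT t.cap i r (h u) then (none, s)
      else find c h t u fuel (i + 1) s

/-- Put `v` into slot `p` and shift the keys in the slots `p, p + 1, …` to the right by one, until
a tombstone or a free slot is found, which is used up. -/
def shift {U : Type*} (c : Config) (t : Table) :
    (fuel : ℕ) → (p : ℕ) → (v : Slot U) → Mem U → Mem U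
  | 0, _, _, s => s
  | fuel + 1, p, v, s =>
    let (old, s) := s.read c t.side p
    let s := s.write c t.side p v
    match old with
    | .key w => shift c t fuel ((p + 1) % t.cap) (.key w) s
    | _ => s

open Classical in
/-- Insert the key `u`: starting at distance `i` from its home slot, examine one slot after
the other until the position where `u` belongs (before the items whose hash is at least its own,
or in a free slot), put `u` there and shift. -/
def place {U : Type*} (c : Config) (h : U → ℝ) (t : Table) (u : U) :
    (fuel : ℕ) → (i : ℕ) → Mem U → Mem U
  | 0, _, s => s
  | fuel + 1, i, s =>
    let p := (home t.cap (h u) + i) % t.cap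
    let (v, s) := s.read c t.side p
    match v.hash? h with
    | none => s.write c t.side p (.key u)
    | some r =>
      if HashGE t.cap i r (h u) then shift c t t.cap p (.key u) s
      else place c h t u fuel (i + 1) s

/-! ### Rebuilds

A rebuild moves the keys from the current array into the other one, removes all old
tombstones, and adds new ones.  The new number `n` of slots is such that the load factor is
about `1 - 1 / (x + 1)`, unless the minimum capacity makes it smaller.  If the load factor after the
rebuild is `1 - 1 / y`, then `n / y` is the number `f` of slots without keys, so that
`n / (2 * y)` tombstones are `f / 2` tombstones, `n / (4 * y)` operations are `f / 4` operations,
and the tombstone number `k` has its hash at slot `2 * k * y = 2 * k * n / f` (in the numbering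
of the slots as `1, …, n`; this is slot `2 * k * n / f - 1` when numbered from `0`). -/

/-- The number of slots of a table that is rebuilt with `m` keys. -/
def newCap (c : Config) (m : ℕ) : ℕ := max c.L (m + ⌈(m : ℝ) / c.x⌉₊)

/-- The hash of tombstone number `k` (`1 ≤ k ≤ f / 2`) in `[0, 1)`. -/
def tombHash (n f k : ℕ) : ℝ := 2 * k / f - 1 / n

/-- Append an item with hash `r` to the new table with `n` slots in array `b`, where `p` is the
first slot that may be used (counted on beyond the end of the table, before wrapping around).
The item is written only if `commit` is true; the result is the next slot that may be used. -/
def emit {U : Type*} (c : Config) (commit : Bool) (b : Bool) (n : ℕ) (r : ℝ) (v : Slot U)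
    (p : ℕ) (s : Mem U) : ℕ × Mem U :=
  let q := max p (home n r)
  (q + 1, if commit then s.write c b (q % n) v else s)

open Classical in
/-- Append the tombstones number `k, k + 1, …` whose hash is at most `r`. -/
def emitTombs {U : Type*} (c : Config) (commit : Bool) (b : Bool) (n f : ℕ) (r : ℝ) :
    (fuel : ℕ) → (p k : ℕ) → Mem U → (ℕ × ℕ) × Mem U
  | 0, p, k, s => ((p, k), s)
  | fuel + 1, p, k, s =>
    if k ≤ f / 2 ∧ tombHash n f k ≤ r then
      let (p, s) := emit c commit b n (tombHash n f k) (.tomb (tombHash n f k)) p s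
      emitTombs c commit b n f r fuel p (k + 1) s
    else ((p, k), s)

open Classical in
/-- One step of the scan of the old table.  The old table is traversed twice (`j < 2 * t.cap`):
first the keys that have not wrapped around the end are taken, then the others.  So the
keys come in the order of their hashes, and they are merged with the new tombstones. -/
def mergeStep {U : Type*} (c : Config) (h : U → ℝ) (t : Table) (commit : Bool) (n f : ℕ)
    (st : (ℕ × ℕ) × Mem U) (j : ℕ) : (ℕ × ℕ) × Mem U :=
  let ((p, k), s) := st
  let (v, s) := s.read c t.side (j % t.cap)
  match v with
  | .key u =>
    if (j < t.cap ∧ home t.cap (h u) ≤ j) ∨ (t.cap ≤ j ∧ j < t.cap + home t.cap (h u)) then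
      let ((p, k), s) := emitTombs c commit (!t.side) n f (h u) (f / 2) p k s
      let (p, s) := emit c commit (!t.side) n (h u) (.key u) p s
      ((p, k), s)
    else ((p, k), s)
  | _ => ((p, k), s)

/-- One pass over all keys and new tombstones, in the order of their hashes; slot `p` is the first
slot that may be used. -/
def mergePass {U : Type*} (c : Config) (h : U → ℝ) (t : Table) (commit : Bool) (n f p : ℕ)
    (s : Mem U) : ℕ × Mem U :=
  let ((p, k), s) := (List.range (2 * t.cap)).foldl (mergeStep c h t commit n f) ((p, 1), s)
  let ((p, _), s) := emitTombs c commit (!t.side) n f 1 (f / 2) p k s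
  (p, s)

/-- Make the slots `0, …, n - 1` of array `b` free. -/
def clear {U : Type*} (c : Config) (b : Bool) (n : ℕ) (s : Mem U) : Mem U :=
  (List.range n).foldl (fun s q => s.write c b q .free) s

/-- The rebuild.  A first pass, which writes nothing, computes how many items wrap around the end
of the new table; a second pass writes the new table, leaving this many slots at
its beginning to them. -/
def rebuild {U : Type*} (c : Config) (h : U → ℝ) (t : Table) (s : Mem U) : Table × Mem U :=
  let n := newCap c t.keys
  let f := n - t.keys
  let (p, s) := mergePass c h t false n f 0 s
  let s := clear c (!t.side) n s
  let (_, s) := mergePass c h t true n f (p - n) s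
  ({ side := !t.side, cap := n, keys := t.keys, left := max 1 (f / 4) }, s)

/-! ### Operations and workloads -/

/-- The operations of a hash table. -/
inductive Op (U : Type*) where
  | insert (u : U) : Op U
  | delete (u : U) : Op U
  | query (u : U) : Op U

/-- Count an insertion or deletion, and rebuild if it is the last one of its rebuild window. -/
def tick {U : Type*} (c : Config) (h : U → ℝ) (t : Table) (s : Mem U) : Table × Mem U :=
  if t.left ≤ 1 then rebuild c h t s else ({ t with left := t.left - 1 }, s)

/-- The answer to the query whether the table contains `u`. -/
def query {U : Type*} (c : Config) (h : U → ℝ) (t : Table) (u : U) (s : Mem U) : Bool × Mem U :=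
  let (r, s) := find c h t u t.cap 0 s
  (r.isSome, s)

/-- Perform an operation. -/
def step {U : Type*} (c : Config) (h : U → ℝ) (ts : Table × Mem U) : Op U → Table × Mem U
  | .insert u =>
    let (t, s) := ts
    tick c h { t with keys := t.keys + 1 } (place c h t u t.cap 0 s)
  | .delete u =>
    let (t, s) := ts
    match find c h t u t.cap 0 s with
    | (some p, s) => tick c h { t with keys := t.keys - 1 } (s.write c t.side p (.tomb (h u)))
    | (none, s) => tick c h t s
  | .query u =>
    let (t, s) := ts
    (t, (query c h t u s).2)

/-- The newly built empty table.  The internal memory is empty, and the count of block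
transfers starts. -/
def start {U : Type*} (c : Config) (h : U → ℝ) : Table × Mem U :=
  let (t, s) := rebuild c h { side := false, cap := 0, keys := 0, left := 0 }
    { arr := fun _ _ => .free, resident := [], transfers := 0 }
  (t, { s with resident := [], transfers := 0 })

/-- The table and the memory after a sequence of operations. -/
def run {U : Type*} (c : Config) (h : U → ℝ) (ops : List (Op U)) : Table × Mem U :=
  ops.foldl (step c h) (start c h)

/-- The total number of block transfers that are incurred by a sequence of operations,
rebuilds included. -/
def blockTransfers {U : Type*} (c : Config) (h : U → ℝ) (ops : List (Op U)) : ℕ :=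
  (run c h ops).2.transfers

/-- The set of keys after an operation. -/
def Op.keys {U : Type*} [DecidableEq U] (S : Finset U) : Op U → Finset U
  | .insert u => S ∪ {u}
  | .delete u => S.erase u
  | .query _ => S

/-- The set of keys that are present after a sequence of operations on an empty table. -/
def keysAfter {U : Type*} [DecidableEq U] (ops : List (Op U)) : Finset U := ops.foldl Op.keys ∅

/-- A workload is a sequence of operations in which only keys that are absent get inserted. -/
def IsWorkload {U : Type*} [DecidableEq U] (ops : List (Op U)) : Prop :=
  ∀ (l₁ l₂ : List (Op U)) (u : U), ops = l₁ ++ Op.insert u :: l₂ → u ∉ keysAfter l₁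

/-- The fraction of the slots that are taken by keys, after a sequence of operations. -/
def loadFactor {U : Type*} [DecidableEq U] (c : Config) (h : U → ℝ) (ops : List (Op U)) : ℝ :=
  ((keysAfter ops).card : ℝ) / (run c h ops).1.cap

/-- A uniform and fully independent random hash function. -/
structure IsUniformHash {U Ω : Type*} [MeasurableSpace Ω] (h : U → Ω → ℝ) (μ : Measure Ω) :
    Prop where
  measurable : ∀ u, Measurable (h u)
  uniform : ∀ u, μ.map (h u) = (volume : Measure ℝ).restrict (Set.Ico 0 1)
  indep : iIndepFun h μ

end

end Graveyard

/-! Almost surely the relevant hashes lie in `[0, 1)`, are distinct and avoid all tombstone hashes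
(`GoodHash`), and then the run is analysed deterministically. Consecutive slots share a block, so an
operation that walks from its home slot to distance `D` costs at most one transfer plus the number
of block boundaries on the way. A boundary at a fixed distance is met with probability `O(1/B)`. It
therefore suffices that the expected walk length is `O(x)`. Rebuilds cost `O(n/B)` per `Ω(n/x)`
updates, hence also `O(x/B)` per update (`rebuildShare`). Both contributions vanish when `x = o(B)`.

Let `n` be the number of slots, `f` the number of slots without keys at the last rebuild, and `ρ =
f/(2n)`, the density of the new tombstones. If a walk from the home of `u` reaches distance `d`,
look at the slot `c` halfway. For a query or deletion, an item displaced by almost `d` has been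
pushed past `c`, so some window ending at `c` overflows by about `d/2`
(`OrderedHash.exists_window`). Since tombstones are evenly spread, this overflow is an excess of
keys over density `1 - ρ`, while the actual density of keys is at most `1 - 3ρ/2`. For an insertion,
a surviving tombstone with home between that of `u` and `c` would have been used up unless it was
pushed beyond the end of the walk, again an overflow. If there is no such tombstone, all those
created between the nearest surviving one and `c` have been used up. The field `balance` of `Core`
turns this into as many inserted keys with homes in that window, an excess over density `3ρ/4`
although the density of inserted keys is at most `ρ/2` (`Core.place_crossEvent`).

The largest excess over windows ending at a slot obeys the recursion of a queue. Comparing second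
moments at neighbouring slots, which agree by rotation invariance, bounds its mean by `O(1/ρ)` for
the first kind of excess and by `O(1)` for the second (`sum_maxExcess_le`). Reaching distance `d`
needs an excess of about `d/2`, respectively `ρd/8`, so summing over `d` gives `O(1/ρ) = O(x)` in
both cases (`sum_boundaryCount_add_le`). The key `u` is left out of the counts, so its home is
independent of the excess and meets block boundaries uniformly.

The sets of keys behind these events depend only on the sequence of operations (`Window`), so
expectations can be added over the operations. -/

namespace Graveyard

/-! ### Displacements -/

/-- The displacement from the exact position `n * r` of a hash `r` to slot `i`. -/
noncomputable def realDisp (n i : ℕ) (r : ℝ) : ℝ := (disp n i r : ℝ) - Int.fract ((n : ℝ) * r)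

lemma home_lt {n : ℕ} {r : ℝ} (h0 : 0 ≤ r) (h1 : r < 1) (hn : 0 < n) : home n r < n := by
  unfold home
  rw [Nat.floor_lt (by positivity)]
  have : (0 : ℝ) < n := by exact_mod_cast hn
  nlinarith

lemma home_add_fract {n : ℕ} {r : ℝ} (h0 : 0 ≤ r) :
    (home n r : ℝ) + Int.fract ((n : ℝ) * r) = n * r := by
  have h : (0 : ℝ) ≤ n * r := by positivity
  unfold home
  rw [natCast_floor_eq_intCast_floor h]
  exact Int.floor_add_fract _

lemma disp_lt {n : ℕ} (hn : 0 < n) (i : ℕ) (r : ℝ) : disp n i r < n := Nat.mod_lt _ hn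

lemma disp_congr {n i j : ℕ} {r : ℝ} (hr : home n r < n) (h : i % n = j % n) :
    disp n i r = disp n j r := by
  unfold disp
  rw [Nat.add_sub_assoc hr.le, Nat.add_sub_assoc hr.le, Nat.add_mod, h, ← Nat.add_mod]

lemma disp_mod {n i : ℕ} {r : ℝ} (hr : home n r < n) : disp n (i % n) r = disp n i r :=
  disp_congr hr (Nat.mod_mod _ _)

lemma disp_home_add {n i : ℕ} {r : ℝ} (hi : i < n) : disp n (home n r + i) r = i := by
  unfold disp
  rw [show home n r + i + n - home n r = i + n by omega, Nat.add_mod_right, Nat.mod_eq_of_lt hi]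

lemma disp_add {n i j : ℕ} {r : ℝ} (hr : home n r < n) (h : disp n i r + j < n) :
    disp n (i + j) r = disp n i r + j := by
  have h1 : disp n (i + j) r = ((i + n - home n r) % n + j) % n := by
    unfold disp
    rw [Nat.mod_add_mod]
    congr 1
    omega
  rw [h1]
  exact Nat.mod_eq_of_lt h

lemma disp_sub {n i j : ℕ} {r : ℝ} (hr : home n r < n) (hj : j ≤ disp n i r) (hji : j ≤ i) :
    disp n (i - j) r = disp n i r - j := by
  have hlt := disp_lt (by omega : 0 < n) i r
  unfold disp at *
  have h1 := Nat.div_add_mod (i + n - home n r) n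
  set q := (i + n - home n r) / n
  set d := (i + n - home n r) % n
  have h2 : i - j + n - home n r = (d - j) + n * q := by omega
  rw [h2, Nat.add_mul_mod_self_left, Nat.mod_eq_of_lt (by omega)]

lemma mod_eq_home_add {n i : ℕ} {r : ℝ} (hr : home n r < n) :
    i % n = (home n r + disp n i r) % n := by
  unfold disp
  rw [Nat.add_mod_mod, show home n r + (i + n - home n r) = i + n by omega, Nat.add_mod_right]

lemma home_eq_of_disp_eq {n i : ℕ} {r r' : ℝ} (hr : home n r < n) (hr' : home n r' < n)
    (h : disp n i r = disp n i r') : home n r = home n r' := by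
  have h1 := mod_eq_home_add (i := i) hr
  have h2 := mod_eq_home_add (i := i) hr'
  rw [h1, h] at h2
  have h3 : home n r ≡ home n r' [MOD n] := Nat.ModEq.add_right_cancel' _ h2
  rwa [Nat.ModEq, Nat.mod_eq_of_lt hr, Nat.mod_eq_of_lt hr'] at h3

lemma realDisp_congr {n i j : ℕ} {r : ℝ} (hr : home n r < n) (h : i % n = j % n) :
    realDisp n i r = realDisp n j r := by
  unfold realDisp
  rw [disp_congr hr h]

lemma realDisp_add {n i j : ℕ} {r : ℝ} (hr : home n r < n) (h : disp n i r + j < n) :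
    realDisp n (i + j) r = realDisp n i r + j := by
  unfold realDisp
  rw [disp_add hr h]
  push_cast
  ring

lemma realDisp_sub {n i j : ℕ} {r : ℝ} (hr : home n r < n) (hj : j ≤ disp n i r) (hji : j ≤ i) :
    realDisp n (i - j) r = realDisp n i r - j := by
  unfold realDisp
  rw [disp_sub hr hj hji, Nat.cast_sub hj]
  ring

lemma realDisp_le (n i : ℕ) (r : ℝ) : realDisp n i r ≤ disp n i r := by
  have := Int.fract_nonneg ((n : ℝ) * r)
  unfold realDisp
  linarith

lemma lt_realDisp (n i : ℕ) (r : ℝ) : (disp n i r : ℝ) - 1 < realDisp n i r := by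
  have := Int.fract_lt_one ((n : ℝ) * r)
  unfold realDisp
  linarith

lemma neg_one_lt_realDisp (n i : ℕ) (r : ℝ) : -1 < realDisp n i r := by
  have := lt_realDisp n i r
  have h : (0 : ℝ) ≤ disp n i r := by positivity
  linarith

lemma realDisp_nonpos_iff {n i : ℕ} {r : ℝ} : realDisp n i r ≤ 0 ↔ disp n i r = 0 := by
  constructor
  · intro h
    have h1 := lt_realDisp n i r
    have h2 : (disp n i r : ℝ) < 1 := by linarith
    have h3 : disp n i r < 1 := by exact_mod_cast h2
    omega
  · intro h
    have := realDisp_le n i r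
    rw [h] at this
    simpa using this

/-- The two notions differ by a fractional part in `[0, 1)`, so `realDisp` refines `disp` and only
breaks ties between equal home slots. -/
lemma disp_le_of_realDisp_le {n i i' : ℕ} {r r' : ℝ} (h : realDisp n i r ≤ realDisp n i' r') :
    disp n i r ≤ disp n i' r' := by
  have h1 := lt_realDisp n i r
  have h2 := realDisp_le n i' r'
  have h3 : (disp n i r : ℝ) < disp n i' r' + 1 := by linarith
  have h4 : disp n i r < disp n i' r' + 1 := by exact_mod_cast h3
  omega

lemma realDisp_lt_of_disp_lt {n i i' : ℕ} {r r' : ℝ} (h : disp n i r < disp n i' r') :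
    realDisp n i r < realDisp n i' r' := by
  have h1 := realDisp_le n i r
  have h2 := lt_realDisp n i' r'
  have h3 : (disp n i r : ℝ) + 1 ≤ disp n i' r' := by exact_mod_cast h
  linarith

lemma realDisp_lt_iff_of_disp_eq {n i : ℕ} {r r' : ℝ} (h0 : 0 ≤ r) (h0' : 0 ≤ r')
    (hr : home n r < n) (hr' : home n r' < n)
    (h : disp n i r = disp n i r') : realDisp n i r < realDisp n i r' ↔ r' < r := by
  have hh := home_eq_of_disp_eq hr hr' h
  have h1 := home_add_fract (n := n) h0
  have h2 := home_add_fract (n := n) h0'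
  have hn : (0 : ℝ) < n := by exact_mod_cast (by omega : 0 < n)
  unfold realDisp
  rw [h]
  rw [hh] at h1
  rw [← mul_lt_mul_iff_right₀ (b := r') (c := r) hn]
  constructor <;> intro h <;> linarith

lemma eq_of_realDisp_eq {n i : ℕ} {r r' : ℝ} (h0 : 0 ≤ r) (h0' : 0 ≤ r')
    (hr : home n r < n) (hr' : home n r' < n)
    (h : realDisp n i r = realDisp n i r') : r = r' := by
  have hd : disp n i r = disp n i r' :=
    le_antisymm (disp_le_of_realDisp_le h.le) (disp_le_of_realDisp_le h.ge)
  have h1 := realDisp_lt_iff_of_disp_eq h0 h0' hr hr' hd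
  have h2 := realDisp_lt_iff_of_disp_eq h0' h0 hr' hr hd.symm
  rcases lt_trichotomy r r' with h3 | h3 | h3
  · exact absurd (h2.2 h3) (by simp [h])
  · exact h3
  · exact absurd (h1.2 h3) (by simp [h])

/-- The lexicographic comparison of home slot and hash becomes a comparison of single real numbers.
A larger hash in the cyclic order means a smaller `realDisp`. All later order arguments are linear
inequalities in this quantity. -/
lemma hashGT_iff {n i : ℕ} {r r₀ : ℝ} (hi : i < n) (h0 : 0 ≤ r) (h1 : r < 1) (h0' : 0 ≤ r₀)
    (h1' : r₀ < 1) :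
    HashGT n i r r₀ ↔ realDisp n (home n r₀ + i) r < realDisp n (home n r₀ + i) r₀ := by
  have hn : 0 < n := by omega
  have hr := home_lt h0 h1 hn
  have hr' := home_lt h0' h1' hn
  have hd : disp n (home n r₀ + i) r₀ = i := disp_home_add hi
  unfold HashGT
  rw [disp_mod hr]
  rcases lt_trichotomy (disp n (home n r₀ + i) r) i with h | h | h
  · exact iff_of_true (Or.inl h) (realDisp_lt_of_disp_lt (by omega))
  · rw [realDisp_lt_iff_of_disp_eq h0 h0' hr hr' (by omega)]
    simp [h]
  · exact iff_of_false (by omega) (not_lt.2 (realDisp_lt_of_disp_lt (by omega)).le)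

lemma hashGE_iff {n i : ℕ} {r r₀ : ℝ} (hi : i < n) (h0 : 0 ≤ r) (h1 : r < 1) (h0' : 0 ≤ r₀)
    (h1' : r₀ < 1) :
    HashGE n i r r₀ ↔ realDisp n (home n r₀ + i) r ≤ realDisp n (home n r₀ + i) r₀ := by
  have hn : 0 < n := by omega
  have hr := home_lt h0 h1 hn
  have hr' := home_lt h0' h1' hn
  have hd : disp n (home n r₀ + i) r₀ = i := disp_home_add hi
  unfold HashGE
  rw [disp_mod hr]
  rcases lt_trichotomy (disp n (home n r₀ + i) r) i with h | h | h
  · exact iff_of_true (Or.inl h) (realDisp_lt_of_disp_lt (by omega)).le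
  · have key := not_congr (realDisp_lt_iff_of_disp_eq (n := n) (i := home n r₀ + i) h0' h0 hr' hr
      (by omega))
    rw [not_lt, not_lt] at key
    rw [key]
    simp [h]
  · exact iff_of_false (by omega) (not_le.2 (realDisp_lt_of_disp_lt (by omega)))

/-! ### Ordered tables -/

/-- The hashes `F i` of the items in the slots `i % n` are those of an ordered linear probing
table. -/
structure OrderedHash (n : ℕ) (F : ℕ → Option ℝ) : Prop where
  pos : 0 < n
  periodic : ∀ i, F (i % n) = F i
  nonneg : ∀ i r, F i = some r → 0 ≤ r
  lt_one : ∀ i r, F i = some r → r < 1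
  -- Either the item is in its home slot, or the slot before is occupied by an item of strictly
  -- smaller hash; the summand `1` moves that item's displacement to slot `i + 1`.
  succ : ∀ i r', F (i + 1) = some r' → realDisp n (i + 1) r' ≤ 0 ∨
    ∃ r, F i = some r ∧ realDisp n (i + 1) r' < realDisp n i r + 1

namespace OrderedHash

variable {n : ℕ} {F : ℕ → Option ℝ}

lemma congr (hF : OrderedHash n F) {i j : ℕ} (h : i % n = j % n) : F i = F j := by
  rw [← hF.periodic i, h, hF.periodic]

lemma home_lt (hF : OrderedHash n F) {i : ℕ} {r : ℝ} (h : F i = some r) : home n r < n :=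
  Graveyard.home_lt (hF.nonneg i r h) (hF.lt_one i r h) hF.pos

/-- Walk back from `s` using `succ`. Until the home slot of `r'` is reached, the displacement bound
excludes the alternative of an item in its home slot, so every slot is occupied and the hashes
decrease strictly. -/
lemma chain (hF : OrderedHash n F) {s : ℕ} {r' : ℝ} (h : F s = some r') :
    ∀ j, j ≤ disp n s r' → j ≤ s → ∃ r, F (s - j) = some r ∧
      realDisp n s r' ≤ realDisp n (s - j) r + j ∧
      (0 < j → realDisp n s r' < realDisp n (s - j) r + j) := by
  intro j
  induction j with
  | zero => intro _ _; exact ⟨r', h, by simp, by simp⟩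
  | succ j ih =>
    intro hj hjs
    obtain ⟨r, hr, hle, -⟩ := ih (by omega) (by omega)
    have h1 := lt_realDisp n s r'
    have h2 : ((j + 1 : ℕ) : ℝ) ≤ disp n s r' := by exact_mod_cast hj
    have h3 : s - j = s - (j + 1) + 1 := by omega
    rw [h3] at hr hle
    push_cast at h2
    rcases hF.succ _ _ hr with h4 | ⟨r₂, hr₂, h4⟩
    · linarith
    · refine ⟨r₂, hr₂, ?_, fun _ => ?_⟩ <;> push_cast <;> linarith

/-- Walking back from the more displaced of two copies would lead to the other one, and the strict
inequality of `chain` would compare the hash with itself. -/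
lemma mod_eq_of_hash_eq (hF : OrderedHash n F) {s s' : ℕ} {r : ℝ} (h : F s = some r)
    (h' : F s' = some r) : s % n = s' % n := by
  wlog hle : disp n s r ≤ disp n s' r generalizing s s'
  · exact (this h' h (by omega)).symm
  have hr := hF.home_lt h
  have hn := hF.pos
  have hlt := disp_lt hn s' r
  -- Adding a full revolution keeps the natural subtraction from being truncated.
  obtain ⟨r₂, hr₂, -, h2⟩ := hF.chain (s := s' + n) (r' := r)
    (by rw [← h']; exact hF.congr (by simp)) (disp n s' r - disp n s r)
    (by rw [disp_congr hr (i := s' + n) (j := s') (by simp)]; omega) (by omega)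
  have hd : disp n (s' + n) r = disp n s' r := disp_congr hr (by simp)
  have hsub := disp_sub hr (i := s' + n) (j := disp n s' r - disp n s r)
    (by rw [hd]; omega) (by omega)
  have hmod : (s' + n - (disp n s' r - disp n s r)) % n = s % n := by
    rw [mod_eq_home_add hr, hsub, mod_eq_home_add (i := s) hr, hd]
    congr 2
    omega
  rw [hF.congr hmod, h] at hr₂
  have hr₂ : r = r₂ := by simpa using hr₂
  subst hr₂
  by_cases h0 : disp n s' r = disp n s r
  · rw [mod_eq_home_add hr, mod_eq_home_add (i := s') hr, h0]
  · have h3 := h2 (by omega)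
    rw [realDisp_sub hr (by rw [hd]; omega) (by omega)] at h3
    linarith

/-- A displacement of `n - 1` would make all `n` slots occupied by `chain`. Hence a shift by one
slot always raises the displacement by exactly one. -/
lemma disp_add_one_lt (hF : OrderedHash n F) {s e : ℕ} {r : ℝ} (h : F s = some r)
    (he : F e = none) : disp n s r + 1 < n := by
  by_contra hcon
  have hn := hF.pos
  have hr := hF.home_lt h
  have hlt := disp_lt hn s r
  have hd : disp n (s + n) r = disp n s r := disp_congr hr (by simp)
  set j := (s % n + n - e % n) % n with hj
  have hjn : j < n := Nat.mod_lt _ hn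
  obtain ⟨r₂, hr₂, -⟩ := hF.chain (s := s + n) (r' := r)
    (by rw [← h]; exact hF.congr (by simp)) j (by omega) (by omega)
  have : (s + n - j) % n = e % n := by
    have he' : e % n < n := Nat.mod_lt _ hn
    have h1 : (s + n - j + j) ≡ (e + j) [MOD n] := by
      rw [show s + n - j + j = s + n by omega]
      show (s + n) % n = (e + j) % n
      rw [hj, Nat.add_mod_mod, ← Nat.mod_add_mod e,
        show e % n + (s % n + n - e % n) = s % n + n by omega]
      simp
    exact Nat.ModEq.add_right_cancel' _ h1
  rw [hF.congr this, he] at hr₂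
  simp at hr₂

end OrderedHash

/-! ### Windows that overflow -/

/-- The set of hashes in the slots `0, …, n - 1`. -/
noncomputable def hashSet (n : ℕ) (F : ℕ → Option ℝ) : Finset ℝ :=
  ((Finset.range n).image F).eraseNone

lemma mem_hashSet {n : ℕ} {F : ℕ → Option ℝ} (hF : OrderedHash n F) {r : ℝ} :
    r ∈ hashSet n F ↔ ∃ i, F i = some r := by
  unfold hashSet
  simp only [Finset.mem_eraseNone, Finset.mem_image, Finset.mem_range]
  constructor
  · rintro ⟨i, -, h⟩; exact ⟨i, h⟩
  · rintro ⟨i, h⟩; exact ⟨i % n, Nat.mod_lt _ hF.pos, by rw [hF.periodic, h]⟩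

/-- If the item in slot `s` belongs to slot `c = s - e` or an earlier one, then a window that ends
with slot `c` contains the homes of at least `e` items more than it has slots. -/
lemma OrderedHash.exists_window {n : ℕ} {F : ℕ → Option ℝ} (hF : OrderedHash n F) {s e x : ℕ}
    {r : ℝ} (h : F s = some r) (hx : F x = none) (he : e ≤ disp n s r) (hs : n ≤ s) :
    ∃ j, 1 ≤ j ∧ j < n ∧ j + e ≤ ((hashSet n F).filter (fun r => disp n (s - e) r < j)).card := by
  classical
  have hn := hF.pos
  have hex : ∃ j, F (s - j) = none ∧ j < n := by
    refine ⟨(s % n + n - x % n) % n, ?_, Nat.mod_lt _ hn⟩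
    rw [← hx]
    apply hF.congr
    set j := (s % n + n - x % n) % n with hj
    have hjn : j < n := Nat.mod_lt _ hn
    have he' : x % n < n := Nat.mod_lt _ hn
    have h1 : (s - j + j) ≡ (x + j) [MOD n] := by
      rw [show s - j + j = s by omega]
      show s % n = (x + j) % n
      rw [hj, Nat.add_mod_mod, ← Nat.mod_add_mod x,
        show x % n + (s % n + n - x % n) = s % n + n by omega]
      simp
    exact Nat.ModEq.add_right_cancel' _ h1
  obtain ⟨hj0, hjn⟩ := Nat.find_spec hex
  have hmin : ∀ j, j < Nat.find hex → F (s - j) ≠ none := fun j hj h0 =>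
    Nat.find_min hex hj ⟨h0, by omega⟩
  -- The nearest free slot at or before `s` is at distance `j`, so the run containing `s` has
  -- exactly `j` occupied slots up to `s`.
  set j := Nat.find hex with hjdef
  have hocc : ∀ i, i < j → ∃ r, F (s - i) = some r := fun i hi =>
    Option.ne_none_iff_exists'.1 (hmin i hi)
  have key : ∀ i r', i < j → F (s - i) = some r' → i + disp n (s - i) r' < j := by
    intro i r' hi hr'
    by_contra hcon
    obtain ⟨r₂, hr₂, -⟩ := hF.chain hr' (j - i) (by omega) (by omega)
    rw [show s - i - (j - i) = s - j by omega, hj0] at hr₂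
    simp at hr₂
  have hj1 : disp n s r < j := by
    by_contra hcon
    obtain ⟨r₂, hr₂, -⟩ := hF.chain h j (by omega) (by omega)
    rw [hj0] at hr₂
    simp at hr₂
  -- All these `j` items have their homes in the `j - e` slots that end with `s - e`: none has its
  -- home before the run, and an item standing behind `s - e` has no later home than `r`, which is
  -- displaced by at least `e`.
  have key2 : ∀ i r', i < j → F (s - i) = some r' → disp n (s - e) r' < j - e := by
    intro i r' hi hr'
    have h1 := key i r' hi hr'
    have hh := hF.home_lt hr'
    by_cases hie : i ≤ e
    · obtain ⟨r₂, hr₂, h2, -⟩ := hF.chain h i (by omega) (by omega)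
      rw [hr'] at hr₂
      have : r' = r₂ := by simpa using hr₂
      subst this
      have h3 : disp n s r ≤ disp n (s - i) r' + i := by
        have h4 := lt_realDisp n s r
        have h5 := realDisp_le n (s - i) r'
        have h6 : (disp n s r : ℝ) < ((disp n (s - i) r' + i + 1 : ℕ) : ℝ) := by
          push_cast
          linarith
        have h7 : disp n s r < disp n (s - i) r' + i + 1 := by exact_mod_cast h6
        omega
      have h4 := disp_sub hh (i := s - i) (j := e - i) (by omega) (by omega)
      rw [show s - i - (e - i) = s - e by omega] at h4
      omega
    · have h4 := disp_add hh (i := s - i) (j := i - e) (by omega)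
      rw [show s - i + (i - e) = s - e by omega] at h4
      omega
  refine ⟨j - e, by omega, by omega, ?_⟩
  choose! g hg using hocc
  have hinj : Set.InjOn g (Finset.range j : Set ℕ) := by
    intro a ha b hb hab
    simp only [Finset.coe_range, Set.mem_Iio] at ha hb
    have h1 := hg a ha
    rw [hab] at h1
    have h2 : s - a ≡ s - b [MOD n] := hF.mod_eq_of_hash_eq h1 (hg b hb)
    have h3 : s - a + (a + b) ≡ s - b + (a + b) [MOD n] := Nat.ModEq.add_right _ h2
    rw [show s - a + (a + b) = s + b by omega, show s - b + (a + b) = s + a by omega] at h3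
    have h4 : b ≡ a [MOD n] := Nat.ModEq.add_left_cancel' _ h3
    rw [Nat.ModEq, Nat.mod_eq_of_lt (by omega), Nat.mod_eq_of_lt (by omega)] at h4
    exact h4.symm
  calc j - e + e = j := by omega
    _ = ((Finset.range j).image g).card := by rw [Finset.card_image_of_injOn hinj]; simp
    _ ≤ _ := by
      apply Finset.card_le_card
      intro r' hr'
      obtain ⟨i, hi, rfl⟩ := Finset.mem_image.1 hr'
      have hi := Finset.mem_range.1 hi
      rw [Finset.mem_filter, mem_hashSet hF]
      exact ⟨⟨_, hg i hi⟩, key2 i _ hi (hg i hi)⟩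

end Graveyard

namespace Graveyard

/-! ### Block transfers of a walk -/

/-- The number of block boundaries between the slots `lo, …, hi` of a cyclic array. -/
def crossings (n B lo hi : ℕ) : ℕ :=
  ((Finset.Ico lo hi).filter (fun i => (i + 1) % n % B = 0)).card

lemma crossings_self (n B a : ℕ) : crossings n B a a = 0 := by simp [crossings]

lemma crossings_add (n B : ℕ) {a b d : ℕ} (h1 : a ≤ b) (h2 : b ≤ d) :
    crossings n B a d = crossings n B a b + crossings n B b d := by
  unfold crossings
  rw [← Finset.Ico_union_Ico_eq_Ico h1 h2, Finset.filter_union, Finset.card_union_of_disjoint]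
  exact Finset.disjoint_filter_filter (Finset.Ico_disjoint_Ico_consecutive a b d)

lemma crossings_mono (n B : ℕ) {a a' b b' : ℕ} (h1 : a' ≤ a) (h2 : b ≤ b') :
    crossings n B a b ≤ crossings n B a' b' :=
  Finset.card_le_card (Finset.filter_subset_filter _ (Finset.Ico_subset_Ico h1 h2))

lemma crossings_succ (n B a : ℕ) :
    crossings n B a (a + 1) = if (a + 1) % n % B = 0 then 1 else 0 := by
  unfold crossings
  rw [show Finset.Ico a (a + 1) = {a} by ext; simp, Finset.filter_singleton]
  split_ifs <;> simp

lemma block_succ {n B a : ℕ} (hn : 0 < n) (h : (a + 1) % n % B ≠ 0) :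
    (a + 1) % n / B = a % n / B := by
  have h1 : (a + 1) % n ≠ 0 := fun h0 => h (by simp [h0])
  have h2 : (a + 1) % n = a % n + 1 := by
    have hlt : a % n < n := Nat.mod_lt _ hn
    rw [Nat.add_mod] at h1 ⊢
    rcases Nat.lt_or_ge 1 n with h3 | h3
    · rw [Nat.mod_eq_of_lt h3] at h1 ⊢
      rcases Nat.lt_or_ge (a % n + 1) n with h4 | h4
      · exact Nat.mod_eq_of_lt h4
      · have : a % n + 1 = n := by omega
        simp [this] at h1
    · have : n = 1 := by omega
      subst this
      omega
  rw [h2] at h ⊢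
  rw [Nat.succ_div, if_neg (by rwa [Nat.dvd_iff_mod_eq_zero]), add_zero]

lemma block_eq_of_crossings {n B a b : ℕ} (hn : 0 < n) (hab : a ≤ b) (h : crossings n B a b = 0) :
    b % n / B = a % n / B := by
  induction b, hab using Nat.le_induction with
  | base => rfl
  | succ b hab ih =>
    rw [crossings_add n B hab (Nat.le_succ b), crossings_succ] at h
    rw [block_succ hn, ih (by omega)]
    intro h0
    simp [h0] at h

/-- By periodicity the revolution may start at slot `0`. It meets the positive multiples of `B`
below `n` and the seam where slot `n - 1` is followed by slot `0`. -/
lemma crossings_period (n B a : ℕ) : crossings n B a (a + n) ≤ n / B + 1 := by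
  unfold crossings
  have hp : Function.Periodic (fun i => (i + 1) % n % B = 0) n := by
    intro i
    simp only [eq_iff_iff]
    rw [show i + n + 1 = i + 1 + n by ring, Nat.add_mod_right]
  rw [Nat.filter_Ico_card_eq_of_periodic _ _ _ hp, ← Nat.filter_Ico_card_eq_of_periodic 0 _ _ hp]
  rcases Nat.eq_zero_or_pos B with hB | hB
  · subst hB
    calc _ ≤ ({n - 1} : Finset ℕ).card := by
          apply Finset.card_le_card
          intro i hi
          simp only [Nat.mod_zero, Finset.mem_filter, Finset.mem_Ico, zero_add] at hi
          have : n ∣ i + 1 := Nat.dvd_of_mod_eq_zero hi.2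
          have := Nat.le_of_dvd (by omega) this
          simp
          omega
      _ ≤ _ := by simp
  -- The index `k = 0` stands for the seam.
  calc _ ≤ ((Finset.range (n / B + 1)).image (fun k => if k = 0 then n - 1 else k * B - 1)).card := by
        apply Finset.card_le_card
        intro i hi
        simp only [Finset.mem_filter, Finset.mem_Ico, zero_add] at hi
        obtain ⟨⟨-, hi⟩, h0⟩ := hi
        simp only [Finset.mem_image, Finset.mem_range]
        rcases Nat.lt_or_ge (i + 1) n with h1 | h1
        · rw [Nat.mod_eq_of_lt h1] at h0
          have h2 : (i + 1) / B * B = i + 1 := Nat.div_mul_cancel (Nat.dvd_of_mod_eq_zero h0)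
          refine ⟨(i + 1) / B, Nat.lt_succ_of_le (Nat.div_le_div_right h1.le), ?_⟩
          rw [if_neg]
          · omega
          · intro h3
            rw [h3] at h2
            omega
        · exact ⟨0, Nat.succ_pos _, by simp; omega⟩
    _ ≤ _ := Finset.card_image_le.trans (by simp)

variable {U : Type*}

/-- The number of block transfers that an access to slot `p` of array `b` costs. -/
def miss (c : Config) (s : Mem U) (b : Bool) (p : ℕ) : ℕ :=
  if (b, p / c.B) ∈ s.resident then 0 else 1

lemma miss_le_one (c : Config) (s : Mem U) (b : Bool) (p : ℕ) : miss c s b p ≤ 1 := by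
  unfold miss; split_ifs <;> simp

lemma touch_transfers (c : Config) (s : Mem U) (b : Bool) (p : ℕ) :
    (s.touch c b p).transfers = s.transfers + miss c s b p := rfl

lemma miss_congr (c : Config) (s : Mem U) (b : Bool) {p q : ℕ} (h : p / c.B = q / c.B) :
    miss c s b p = miss c s b q := by
  unfold miss; rw [h]

lemma miss_touch {c : Config} (hc : 1 ≤ c.M / c.B - 1) (s : Mem U) (b : Bool) (p : ℕ) :
    miss c (s.touch c b p) b p = 0 := by
  unfold miss Mem.touch
  obtain ⟨k, hk⟩ := Nat.exists_eq_add_of_le' hc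
  simp [hk]

lemma miss_write {c : Config} (s : Mem U) (b b' : Bool) (p q : ℕ) (v : Slot U) :
    miss c (s.write c b p v) b' q = miss c (s.touch c b p) b' q := rfl

/-- The block touched last is resident as soon as internal memory holds one block, so the next slot
can only cost a transfer if it starts another block. -/
lemma miss_touch_succ {c : Config} (hc : 1 ≤ c.M / c.B - 1) (s : Mem U) (b : Bool) {n : ℕ}
    (hn : 0 < n) (a : ℕ) :
    miss c (s.touch c b (a % n)) b ((a + 1) % n) ≤ crossings n c.B a (a + 1) := by
  rw [crossings_succ]
  split_ifs with h
  · exact miss_le_one _ _ _ _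
  · rw [miss_congr c _ b (block_succ hn h), miss_touch hc]

lemma write_arr (c : Config) (s : Mem U) (b : Bool) (p : ℕ) (v : Slot U) :
    (s.write c b p v).arr b = Function.update (s.arr b) p v := by
  simp [Mem.write]

lemma write_arr_ne (c : Config) (s : Mem U) {b b' : Bool} (h : b' ≠ b) (p : ℕ) (v : Slot U) :
    (s.write c b p v).arr b' = s.arr b' := by
  simp [Mem.write, h]

lemma write_transfers (c : Config) (s : Mem U) (b : Bool) (p : ℕ) (v : Slot U) :
    (s.write c b p v).transfers = s.transfers + miss c s b p := rfl

/-! ### Searching -/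

/-- The outcome of a search that walks from distance `i` to distance `D` of the home slot. -/
structure FindSpec (c : Config) (h : U → ℝ) (t : Table) (u : U) (i D : ℕ) (s : Mem U)
    (res : Option ℕ × Mem U) : Prop where
  le : i ≤ D
  le_cap : D ≤ t.cap
  pass : ∀ k, i ≤ k → k < D → ∃ r,
    (s.arr t.side ((home t.cap (h u) + k) % t.cap)).hash? h = some r ∧ ¬ HashGT t.cap k r (h u) ∧
    s.arr t.side ((home t.cap (h u) + k) % t.cap) ≠ .key u
  arr : res.2.arr = s.arr
  cost : res.2.transfers ≤ s.transfers + miss c s t.side ((home t.cap (h u) + i) % t.cap) +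
    crossings t.cap c.B (home t.cap (h u) + i) (home t.cap (h u) + D)
  result : (res.1 = some ((home t.cap (h u) + D) % t.cap) ∧ D < t.cap ∧
      s.arr t.side ((home t.cap (h u) + D) % t.cap) = .key u ∧
      miss c res.2 t.side ((home t.cap (h u) + D) % t.cap) = 0) ∨
    (res.1 = none ∧ (D = t.cap ∨
      s.arr t.side ((home t.cap (h u) + D) % t.cap) = .free ∨
      ∃ r, (s.arr t.side ((home t.cap (h u) + D) % t.cap)).hash? h = some r ∧
        HashGT t.cap D r (h u) ∧ s.arr t.side ((home t.cap (h u) + D) % t.cap) ≠ .key u))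

/-- Prepends one passed slot to a search; the possible miss at the next slot is paid by the crossing
between the two. -/
lemma FindSpec.step {c : Config} {h : U → ℝ} {t : Table} {u : U} {i D : ℕ} {s : Mem U}
    {res : Option ℕ × Mem U} (hc : 1 ≤ c.M / c.B - 1) (hn : 0 < t.cap) {r : ℝ}
    (hr : (s.arr t.side ((home t.cap (h u) + i) % t.cap)).hash? h = some r)
    (hgt : ¬ HashGT t.cap i r (h u))
    (hne : s.arr t.side ((home t.cap (h u) + i) % t.cap) ≠ .key u)
    (H : FindSpec c h t u (i + 1) D (s.touch c t.side ((home t.cap (h u) + i) % t.cap)) res) :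
    FindSpec c h t u i D s res where
  le := by have := H.le; omega
  le_cap := H.le_cap
  pass k hk hkD := by
    rcases Nat.eq_or_lt_of_le hk with h1 | h1
    · subst h1; exact ⟨r, hr, hgt, hne⟩
    · exact H.pass k h1 hkD
  arr := H.arr
  cost := by
    have h1 := H.cost
    have h2 := miss_touch_succ hc s t.side hn (home t.cap (h u) + i)
    have h3 := crossings_add t.cap c.B (a := home t.cap (h u) + i)
      (b := home t.cap (h u) + i + 1) (d := home t.cap (h u) + D) (by omega)
      (by have := H.le; omega)
    rw [touch_transfers, ← add_assoc (home t.cap (h u))] at h1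
    omega
  result := H.result

lemma find_spec {c : Config} (hc : 1 ≤ c.M / c.B - 1) (h : U → ℝ) (t : Table) (u : U)
    (hn : 0 < t.cap) : ∀ fuel i (s : Mem U), fuel + i = t.cap →
    ∃ D, FindSpec c h t u i D s (find c h t u fuel i s) := by
  intro fuel
  induction fuel with
  | zero =>
    intro i s hi
    refine ⟨i, le_rfl, by omega, fun k h1 h2 => by omega, rfl, ?_, Or.inr ⟨rfl, Or.inl (by omega)⟩⟩
    simp [find]
    omega
  | succ fuel ih =>
    intro i s hi
    have hend : ∀ res : Option ℕ × Mem U, res = (none, s.touch c t.side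
        ((home t.cap (h u) + i) % t.cap)) →
        (s.arr t.side ((home t.cap (h u) + i) % t.cap) = .free ∨
      ∃ r, (s.arr t.side ((home t.cap (h u) + i) % t.cap)).hash? h = some r ∧
        HashGT t.cap i r (h u) ∧ s.arr t.side ((home t.cap (h u) + i) % t.cap) ≠ .key u) →
        ∃ D, FindSpec c h t u i D s res := by
      rintro _ rfl hh
      exact ⟨i, le_rfl, by omega, fun k h1 h2 => by omega, rfl,
        by simp [touch_transfers, crossings_self], Or.inr ⟨rfl, Or.inr hh⟩⟩
    rw [find]
    simp only [Mem.read]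
    split
    · rename_i hv
      exact hend _ rfl (Or.inl hv)
    · rename_i w hv
      by_cases hw : w = u
      · rw [if_pos hw]
        subst hw
        exact ⟨i, le_rfl, by omega, fun k h1 h2 => by omega, rfl,
          by simp [touch_transfers, crossings_self],
          Or.inl ⟨rfl, by omega, hv, miss_touch hc _ _ _⟩⟩
      · rw [if_neg hw]
        split_ifs with hgt
        · exact hend _ rfl (Or.inr ⟨h w, by rw [hv]; rfl, hgt, by rw [hv]; simpa using hw⟩)
        · obtain ⟨D, hD⟩ := ih (i + 1) (s.touch c t.side ((home t.cap (h u) + i) % t.cap)) (by omega)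
          exact ⟨D, hD.step hc hn (r := h w) (by rw [hv]; rfl) hgt (by rw [hv]; simpa using hw)⟩
    · rename_i r hv
      split_ifs with hgt
      · exact hend _ rfl (Or.inr ⟨r, by rw [hv]; rfl, hgt, by rw [hv]; simp⟩)
      · obtain ⟨D, hD⟩ := ih (i + 1) (s.touch c t.side ((home t.cap (h u) + i) % t.cap)) (by omega)
        exact ⟨D, hD.step hc hn (r := r) (by rw [hv]; rfl) hgt (by rw [hv]; simp)⟩

/-! ### Insertions -/

/-- The slot contains a key. -/
def Slot.IsKey : Slot U → Prop
  | .key _ => True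
  | _ => False

lemma add_mod_inj {n b i j : ℕ} (hi : i < n) (hj : j < n) (h : (b + i) % n = (b + j) % n) :
    i = j := by
  have h1 : i ≡ j [MOD n] := Nat.ModEq.add_left_cancel' b h
  rwa [Nat.ModEq, Nat.mod_eq_of_lt hi, Nat.mod_eq_of_lt hj] at h1

/-- Here `E` is the distance to the first slot without a key, which ends the shift. The condition `E
< t.cap` ensures that the shift never comes back to the slot where it started. -/
lemma shift_spec {c : Config} (hc : 1 ≤ c.M / c.B - 1) (t : Table) (hn : 0 < t.cap) :
    ∀ E fuel b (v : Slot U) (s : Mem U), E < fuel → E < t.cap →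
    (∀ i, i < E → (s.arr t.side ((b + i) % t.cap)).IsKey) →
    ¬ (s.arr t.side ((b + E) % t.cap)).IsKey →
    (shift c t fuel (b % t.cap) v s).transfers ≤
      s.transfers + miss c s t.side (b % t.cap) + crossings t.cap c.B b (b + E) ∧
    ∀ i, i < t.cap → (shift c t fuel (b % t.cap) v s).arr t.side ((b + i) % t.cap) =
      if i = 0 then v else if i ≤ E then s.arr t.side ((b + (i - 1)) % t.cap)
      else s.arr t.side ((b + i) % t.cap) := by
  intro E
  induction E with
  | zero =>
    intro fuel b v s hf hE hk hnk
    obtain ⟨fuel, rfl⟩ := Nat.exists_eq_succ_of_ne_zero hf.ne'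
    have hres : shift c t (fuel + 1) (b % t.cap) v s =
        (s.touch c t.side (b % t.cap)).write c t.side (b % t.cap) v := by
      rw [shift]
      simp only [Mem.read]
      split
      · rename_i w hw
        simp [hw, Slot.IsKey] at hnk
      · rfl
    rw [Nat.succ_eq_add_one, hres]
    refine ⟨?_, fun i hi => ?_⟩
    · rw [write_transfers, miss_touch hc, touch_transfers]
      omega
    · rw [write_arr]
      rcases Nat.eq_zero_or_pos i with h0 | h0
      · subst h0; simp
      · rw [if_neg (by omega), if_neg (by omega), Function.update_of_ne]
        · rfl
        · intro h1
          have := add_mod_inj (b := b) (i := i) (j := 0) hi hn h1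
          omega
  | succ E ih =>
    intro fuel b v s hf hE hk hnk
    obtain ⟨fuel, rfl⟩ := Nat.exists_eq_succ_of_ne_zero (show fuel ≠ 0 by omega)
    have h0 := hk 0 (by omega)
    obtain ⟨w, hw⟩ : ∃ w, s.arr t.side (b % t.cap) = .key w := by
      rw [add_zero] at h0
      cases hv : s.arr t.side (b % t.cap) <;> simp [hv, Slot.IsKey] at h0 ⊢
    set s' := (s.touch c t.side (b % t.cap)).write c t.side (b % t.cap) v with hs'
    have hres : shift c t (fuel + 1) (b % t.cap) v s =
        shift c t fuel ((b + 1) % t.cap) (.key w) s' := by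
      rw [shift]
      simp only [Mem.read, hw, Nat.mod_add_mod, hs']
    have harr : ∀ i, i + 1 < t.cap → s'.arr t.side ((b + 1 + i) % t.cap) =
        s.arr t.side ((b + 1 + i) % t.cap) := by
      intro i hi
      rw [hs', write_arr, Function.update_of_ne]
      · rfl
      · intro h1
        have := add_mod_inj (b := b) (i := 1 + i) (j := 0) (by omega) hn
          (by rw [← add_assoc]; exact h1)
        omega
    obtain ⟨ih1, ih2⟩ := ih fuel (b + 1) (.key w) s' (by omega) (by omega)
      (fun i hi => by
        rw [harr i (by omega), add_assoc, add_comm 1]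
        exact hk _ (by omega))
      (by rw [harr E (by omega), add_assoc, add_comm 1]; exact hnk)
    rw [Nat.succ_eq_add_one, hres]
    refine ⟨?_, fun i hi => ?_⟩
    · have h1 : s'.transfers = s.transfers + miss c s t.side (b % t.cap) := by
        rw [hs', write_transfers, miss_touch hc, touch_transfers]
        omega
      have h2 : miss c s' t.side ((b + 1) % t.cap) ≤ crossings t.cap c.B b (b + 1) := by
        rw [hs', miss_write]
        exact miss_touch_succ hc _ _ hn _
      have h3 := crossings_add t.cap c.B (a := b) (b := b + 1) (d := b + (E + 1)) (by omega)
        (by omega)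
      rw [show b + 1 + E = b + (E + 1) by ring] at ih1
      omega
    · rcases Nat.eq_zero_or_pos i with h0 | h0
      · subst h0
        -- For the remaining shift, which starts at `b + 1`, slot `b` is the last one of the
        -- revolution and lies beyond the used slot, so the value just written there survives.
        have h1 := ih2 (t.cap - 1) (by omega)
        have h2 : (b + 1 + (t.cap - 1)) % t.cap = b % t.cap := by
          rw [show b + 1 + (t.cap - 1) = b + t.cap by omega, Nat.add_mod_right]
        rw [h2, if_neg (by omega), if_neg (by omega)] at h1
        rw [if_pos rfl, add_zero, h1, hs', write_arr, Function.update_self]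
      · have h1 := ih2 (i - 1) (by omega)
        rw [show b + 1 + (i - 1) = b + i by omega] at h1
        rw [h1, if_neg (by omega : ¬ i = 0)]
        by_cases hi1 : i = 1
        · subst hi1
          simp [hw]
        · rw [if_neg (by omega)]
          by_cases hiE : i ≤ E + 1
          · rw [if_pos (by omega), if_pos hiE, harr _ (by omega)]
            congr 2
            omega
          · rw [if_neg (by omega), if_neg hiE]
            have := harr (i - 1) (by omega)
            rwa [show b + 1 + (i - 1) = b + i by omega] at this

/-- The outcome of an insertion that finds the position of `u` at distance `P` from the home slot
and that uses up the slot at distance `D`. -/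
structure PlaceSpec (n : ℕ) (h : U → ℝ) (u : U) (P D : ℕ) (A A' : ℕ → Slot U) : Prop where
  le : P ≤ D
  lt : D < n
  pass : ∀ k, k < P → ∃ r, (A ((home n (h u) + k) % n)).hash? h = some r ∧ ¬ HashGE n k r (h u)
  position : ∀ r, (A ((home n (h u) + P) % n)).hash? h = some r → HashGE n P r (h u)
  keys : ∀ k, P ≤ k → k < D → (A ((home n (h u) + k) % n)).IsKey
  used : ¬ (A ((home n (h u) + D) % n)).IsKey
  result : ∀ i, i < n → A' ((home n (h u) + i) % n) =
    if i < P then A ((home n (h u) + i) % n) else if i = P then .key u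
    else if i ≤ D then A ((home n (h u) + (i - 1)) % n) else A ((home n (h u) + i) % n)

/-- The free slot at distance `e` guarantees that both the position of `u` and the slot that gets
used up are met before the walk closes a revolution. -/
lemma place_spec {c : Config} (hc : 1 ≤ c.M / c.B - 1) (h : U → ℝ) (t : Table) (u : U) {e : ℕ}
    (he : e < t.cap) : ∀ fuel i (s : Mem U), fuel + i = t.cap → i ≤ e →
    (s.arr t.side ((home t.cap (h u) + e) % t.cap)).hash? h = none →
    (∀ k, k < i → ∃ r, (s.arr t.side ((home t.cap (h u) + k) % t.cap)).hash? h = some r ∧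
      ¬ HashGE t.cap k r (h u)) →
    ∃ P D, i ≤ D ∧ PlaceSpec t.cap h u P D (s.arr t.side) ((place c h t u fuel i s).arr t.side) ∧
      (place c h t u fuel i s).transfers ≤ s.transfers +
        miss c s t.side ((home t.cap (h u) + i) % t.cap) +
        crossings t.cap c.B (home t.cap (h u) + i) (home t.cap (h u) + D) := by
  classical
  intro fuel
  induction fuel with
  | zero => intro i s hi hie; omega
  | succ fuel ih =>
    intro i s hi hie hfree hpass
    have hn : 0 < t.cap := by omega
    set a := home t.cap (h u) with ha
    set p := (a + i) % t.cap with hp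
    cases hv : (s.arr t.side p).hash? h with
    | none =>
      have hres : place c h t u (fuel + 1) i s = (s.touch c t.side p).write c t.side p (.key u) := by
        rw [place]
        simp only [Mem.read]
        rw [← ha, ← hp, hv]
      rw [hres]
      refine ⟨i, i, le_rfl, ⟨le_rfl, by omega, hpass, ?_, fun k h1 h2 => by omega, ?_, ?_⟩, ?_⟩
      · intro r hr
        rw [← ha, ← hp, hv] at hr
        simp at hr
      · rw [← ha, ← hp]
        cases hs : s.arr t.side p <;> simp [hs, Slot.hash?, Slot.IsKey] at hv ⊢
      · intro k hk
        rw [write_arr, ← ha]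
        by_cases hki : k = i
        · subst hki
          rw [← hp]
          simp
        · rw [Function.update_of_ne]
          · change s.arr t.side ((a + k) % t.cap) = _
            rw [if_neg hki]
            split_ifs
            · rfl
            · omega
            · rfl
          · intro h1
            exact hki (add_mod_inj hk (by omega) h1)
      · rw [write_transfers, miss_touch hc, touch_transfers]
        omega
    | some r =>
      have hei : i ≠ e := by
        rintro rfl
        rw [← hp, hv] at hfree
        simp at hfree
      by_cases hge : HashGE t.cap i r (h u)
      · have hres : place c h t u (fuel + 1) i s =
            shift c t t.cap p (.key u) (s.touch c t.side p) := by
          rw [place]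
          simp only [Mem.read]
          rw [← ha, ← hp, hv]
          simp only
          rw [if_pos hge]
        rw [hres]
        have hex : ∃ E, ¬ (s.arr t.side ((a + i + E) % t.cap)).IsKey := by
          refine ⟨e - i, ?_⟩
          rw [show a + i + (e - i) = a + e by omega]
          cases hs : s.arr t.side ((a + e) % t.cap) <;>
            simp [hs, Slot.hash?, Slot.IsKey] at hfree ⊢
        have hE1 := Nat.find_spec hex
        have hE2 : Nat.find hex ≤ e - i := by
          apply Nat.find_min'
          rw [show a + i + (e - i) = a + e by omega]
          cases hs : s.arr t.side ((a + e) % t.cap) <;>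
            simp [hs, Slot.hash?, Slot.IsKey] at hfree ⊢
        have hE3 : ∀ k, k < Nat.find hex → (s.arr t.side ((a + i + k) % t.cap)).IsKey :=
          fun k hk => not_not.1 (Nat.find_min hex hk)
        set E := Nat.find hex
        obtain ⟨h1, h2⟩ := shift_spec hc t hn E t.cap (a + i) (.key u) (s.touch c t.side p)
          (by omega) (by omega) hE3 hE1
        rw [← hp] at h1 h2
        refine ⟨i, i + E, by omega, ⟨by omega, by omega, hpass, ?_, ?_, ?_, ?_⟩, ?_⟩
        · intro r' hr'
          rw [← ha, ← hp, hv] at hr'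
          have : r = r' := by simpa using hr'
          rwa [← this]
        · intro k hk1 hk2
          have := hE3 (k - i) (by omega)
          rwa [show a + i + (k - i) = a + k by omega] at this
        · rw [← ha, ← add_assoc]
          exact hE1
        · intro k hk
          rw [← ha]
          by_cases hki : k < i
          · have h3 := h2 (k + t.cap - i) (by omega)
            have h4 : (a + i + (k + t.cap - i)) % t.cap = (a + k) % t.cap := by
              rw [show a + i + (k + t.cap - i) = a + k + t.cap by omega, Nat.add_mod_right]
            rw [h4, if_neg (by omega), if_neg (by omega)] at h3
            rw [h3, if_pos hki]
            rfl
          · have h3 := h2 (k - i) (by omega)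
            rw [show a + i + (k - i) = a + k by omega] at h3
            rw [h3, if_neg hki]
            by_cases hk0 : k = i
            · subst hk0; simp
            · rw [if_neg (by omega), if_neg hk0]
              by_cases hkE : k ≤ i + E
              · rw [if_pos (by omega), if_pos hkE,
                  show a + i + (k - i - 1) = a + (k - 1) by omega]
                rfl
              · rw [if_neg (by omega), if_neg hkE]
                rfl
        · rw [miss_touch hc, touch_transfers, add_assoc a i E] at h1
          exact h1
      · have hres : place c h t u (fuel + 1) i s =
            place c h t u fuel (i + 1) (s.touch c t.side p) := by
          rw [place]
          simp only [Mem.read]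
          rw [← ha, ← hp, hv]
          simp only
          rw [if_neg hge]
        rw [hres]
        obtain ⟨P, D, h1, h2, h3⟩ := ih (i + 1) (s.touch c t.side p) (by omega) (by omega) hfree
          (fun k hk => by
            rcases Nat.lt_or_ge k i with h1 | h1
            · exact hpass k h1
            · have : k = i := by omega
              subst this
              exact ⟨r, hv, hge⟩)
        refine ⟨P, D, by omega, h2, ?_⟩
        have h4 := miss_touch_succ hc s t.side hn (a + i)
        have h5 := crossings_add t.cap c.B (a := a + i) (b := a + i + 1) (d := a + D) (by omega)
          (by omega)
        rw [touch_transfers, ← add_assoc a] at h3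
        rw [← hp] at h4
        omega

end Graveyard

/-! ### Order and contents of the table after an insertion -/

namespace Graveyard

variable {U : Type*}

/-- The hash of the item in slot `i % n` of the array `A`. -/
noncomputable def slotHash (n : ℕ) (h : U → ℝ) (A : ℕ → Slot U) (i : ℕ) : Option ℝ :=
  (A (i % n)).hash? h

lemma exists_add_mod {n : ℕ} (hn : 0 < n) (a i : ℕ) : ∃ k, k < n ∧ i % n = (a + k) % n := by
  refine ⟨(i + n - a % n) % n, Nat.mod_lt _ hn, ?_⟩
  have := Nat.mod_lt a hn
  rw [Nat.add_mod_mod, ← Nat.mod_add_mod, show a % n + (i + n - a % n) = i + n by omega]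
  simp

lemma realDisp_home_add {n i : ℕ} {r : ℝ} (hi : i < n) :
    realDisp n (home n r + i) r = i - Int.fract ((n : ℝ) * r) := by
  unfold realDisp
  rw [disp_home_add hi]

section Insertion

variable {n : ℕ} {h : U → ℝ} {A A' : ℕ → Slot U} {u : U} {P D : ℕ}

lemma PlaceSpec.slotHash_eq (hP : PlaceSpec n h u P D A A') {i : ℕ} (hi : i < n) :
    slotHash n h A' (home n (h u) + i) =
      if i < P then slotHash n h A (home n (h u) + i) else if i = P then some (h u)
      else if i ≤ D then slotHash n h A (home n (h u) + (i - 1))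
      else slotHash n h A (home n (h u) + i) := by
  unfold slotHash
  rw [hP.result i hi]
  split_ifs <;> rfl

lemma PlaceSpec.pass' (hP : PlaceSpec n h u P D A A') (hF : OrderedHash n (slotHash n h A))
    (h0 : 0 ≤ h u) (h1 : h u < 1) {k : ℕ} (hk : k < P) :
    ∃ r, slotHash n h A (home n (h u) + k) = some r ∧
      realDisp n (home n (h u) + k) (h u) < realDisp n (home n (h u) + k) r := by
  obtain ⟨r, hr, hge⟩ := hP.pass k hk
  refine ⟨r, hr, ?_⟩
  rw [hashGE_iff (by have := hP.le; have := hP.lt; omega) (hF.nonneg _ _ hr) (hF.lt_one _ _ hr)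
    h0 h1] at hge
  exact not_le.1 hge

lemma PlaceSpec.position' (hP : PlaceSpec n h u P D A A') (hF : OrderedHash n (slotHash n h A))
    (h0 : 0 ≤ h u) (h1 : h u < 1) {r : ℝ} (hr : slotHash n h A (home n (h u) + P) = some r) :
    realDisp n (home n (h u) + P) r ≤ realDisp n (home n (h u) + P) (h u) := by
  have := hP.position r hr
  rwa [hashGE_iff (by have := hP.le; have := hP.lt; omega) (hF.nonneg _ _ hr) (hF.lt_one _ _ hr)
    h0 h1] at this

lemma PlaceSpec.keys' (hP : PlaceSpec n h u P D A A') {k : ℕ} (hPk : P ≤ k) (hkD : k < D) :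
    ∃ w, A ((home n (h u) + k) % n) = .key w ∧ slotHash n h A (home n (h u) + k) = some (h w) := by
  have := hP.keys k hPk hkD
  cases hs : A ((home n (h u) + k) % n) with
  | key w => exact ⟨w, rfl, by rw [slotHash, hs]; rfl⟩
  | _ => simp [hs, Slot.IsKey] at this

/-- The order is kept between the slots at distance `k` and `k + 1`, if the latter does not
wrap around to the home slot. -/
lemma PlaceSpec.succ_of_lt (hP : PlaceSpec n h u P D A A') (hF : OrderedHash n (slotHash n h A))
    {e : ℕ} (he : slotHash n h A e = none)
    (h0 : 0 ≤ h u) (h1 : h u < 1) (hinj : ∀ i w, A (i % n) = .key w → h w ≠ h u)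
    {k : ℕ} (hk : k + 1 < n) {r' : ℝ} (hr' : slotHash n h A' (home n (h u) + (k + 1)) = some r') :
    realDisp n (home n (h u) + (k + 1)) r' ≤ 0 ∨
      ∃ r, slotHash n h A' (home n (h u) + k) = some r ∧
        realDisp n (home n (h u) + (k + 1)) r' < realDisp n (home n (h u) + k) r + 1 := by
  have hPD := hP.le
  have hDn := hP.lt
  set a := home n (h u) with ha
  have hdu : ∀ i, i < n → realDisp n (a + i) (h u) = i - Int.fract ((n : ℝ) * h u) :=
    fun i hi => realDisp_home_add hi
  -- A free slot exists, so no item is displaced by `n - 1` and moving it one slot on does not wrap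
  -- its displacement around.
  have hmove : ∀ i r, slotHash n h A (a + i) = some r →
      realDisp n (a + (i + 1)) r = realDisp n (a + i) r + 1 := by
    intro i r hr
    rw [← add_assoc, realDisp_add (hF.home_lt hr) (hF.disp_add_one_lt hr he)]
    simp
  have hold := hF.succ (a + k) r'
  rw [add_assoc] at hold
  rw [hP.slotHash_eq hk] at hr'
  rw [hP.slotHash_eq (by omega : k < n)]
  by_cases c1 : k + 1 < P
  · rw [if_pos c1] at hr'
    rw [if_pos (by omega)]
    exact hold hr'
  rw [if_neg c1] at hr'
  by_cases c2 : k + 1 = P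
  · rw [if_pos c2] at hr'
    have : h u = r' := by simpa using hr'
    subst this
    rw [if_pos (by omega)]
    obtain ⟨r, hr, hlt⟩ := hP.pass' hF h0 h1 (by omega : k < P)
    refine Or.inr ⟨r, hr, ?_⟩
    rw [hdu _ (by omega)] at hlt ⊢
    push_cast
    linarith
  rw [if_neg c2] at hr'
  rw [if_neg (by omega)]
  by_cases c3 : k + 1 ≤ D
  · rw [if_pos c3] at hr'
    simp only [Nat.add_sub_cancel] at hr'
    by_cases c4 : k = P
    · subst c4
      rw [if_pos rfl]
      refine Or.inr ⟨_, rfl, ?_⟩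
      have hle := hP.position' hF h0 h1 hr'
      obtain ⟨w, hw1, hw2⟩ := hP.keys' le_rfl (by omega : k < D)
      rw [hr'] at hw2
      have : r' = h w := by simpa using hw2
      have hne : r' ≠ h u := by rw [this]; exact hinj _ _ hw1
      rcases hle.lt_or_eq with h2 | h2
      · rw [hmove k r' hr']
        linarith
      -- Equality would give the shifted item the hash of `u`; as it is a key, this is excluded.
      · exact absurd (eq_of_realDisp_eq (hF.nonneg _ _ hr') h0 (hF.home_lt hr')
          (home_lt h0 h1 hF.pos) h2) hne
    · rw [if_neg c4, if_pos (by omega)]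
      obtain ⟨w, hw1, hw2⟩ := hP.keys' (by omega : P ≤ k - 1) (by omega)
      refine Or.inr ⟨_, hw2, ?_⟩
      have hm1 := hmove (k - 1) (h w) hw2
      rw [show k - 1 + 1 = k by omega] at hm1
      rw [hmove k r' hr', hm1]
      have hs := hF.succ (a + (k - 1)) r'
      rw [add_assoc, show k - 1 + 1 = k by omega] at hs
      rcases hs hr' with h2 | ⟨r, hr, h2⟩
      · have := neg_one_lt_realDisp n (a + (k - 1)) (h w)
        linarith
      · rw [hw2] at hr
        have : h w = r := by simpa using hr
        rw [this]
        linarith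
  · rw [if_neg c3] at hr'
    -- The slot behind the used one keeps its item. Its new predecessor, `u` or the key shifted into
    -- slot `D`, does not come after the dropped item `t`, so the old inequality with `t` suffices.
    by_cases c5 : k = D
    · subst c5
      rcases hold hr' with h2 | ⟨t, ht, h2⟩
      · exact Or.inl h2
      · by_cases c4 : k = P
        · rw [if_pos c4]
          refine Or.inr ⟨_, rfl, ?_⟩
          subst c4
          have := hP.position' hF h0 h1 ht
          linarith
        · rw [if_neg c4, if_pos le_rfl]
          obtain ⟨w, hw1, hw2⟩ := hP.keys' (by omega : P ≤ k - 1) (by omega)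
          refine Or.inr ⟨_, hw2, ?_⟩
          have hm1 := hmove (k - 1) (h w) hw2
          rw [show k - 1 + 1 = k by omega] at hm1
          rw [hm1]
          have hs := hF.succ (a + (k - 1)) t
          rw [add_assoc, show k - 1 + 1 = k by omega] at hs
          rcases hs ht with h3 | ⟨r, hr, h3⟩
          · have := neg_one_lt_realDisp n (a + (k - 1)) (h w)
            linarith
          · rw [hw2] at hr
            have : h w = r := by simpa using hr
            rw [this]
            linarith
    · rw [if_neg (by omega), if_neg (by omega)]
      exact hold hr'

/-- The order is kept between the last slot before the home slot and the home slot. -/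
lemma PlaceSpec.succ_last (hP : PlaceSpec n h u P D A A') (hF : OrderedHash n (slotHash n h A))
    {e : ℕ} (he : slotHash n h A e = none)
    (h0 : 0 ≤ h u) (h1 : h u < 1) {k : ℕ} (hk : k + 1 = n) {r' : ℝ}
    (hr' : slotHash n h A' (home n (h u) + 0) = some r') :
    realDisp n (home n (h u) + 0) r' ≤ 0 ∨
      ∃ r, slotHash n h A' (home n (h u) + k) = some r ∧
        realDisp n (home n (h u) + 0) r' < realDisp n (home n (h u) + k) r + 1 := by
  have hPD := hP.le
  have hDn := hP.lt
  have hn := hF.pos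
  set a := home n (h u) with ha
  have hmove : ∀ i r, slotHash n h A (a + i) = some r →
      realDisp n (a + (i + 1)) r = realDisp n (a + i) r + 1 := by
    intro i r hr
    rw [← add_assoc, realDisp_add (hF.home_lt hr) (hF.disp_add_one_lt hr he)]
    simp
  have hmod : (a + 0) % n = (a + k + 1) % n := by
    rw [show a + k + 1 = a + n by omega]; simp
  rw [hP.slotHash_eq hn] at hr'
  rw [hP.slotHash_eq (by omega : k < n)]
  by_cases c0 : P = 0
  · rw [if_neg (by omega), if_pos c0.symm] at hr'
    have : h u = r' := by simpa using hr'
    subst this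
    left
    rw [realDisp_home_add hn]
    have := Int.fract_nonneg ((n : ℝ) * h u)
    simp [this]
  · rw [if_pos (by omega)] at hr'
    rw [if_neg (by omega)]
    have hold := hF.succ (a + k) r'
    rw [hF.congr hmod] at hr'
    have hh := hF.home_lt hr'
    rw [realDisp_congr hh hmod]
    rcases hold hr' with h2 | ⟨t, ht, h2⟩
    · exact Or.inl h2
    by_cases c5 : k = D
    · subst c5
      by_cases c4 : k = P
      · rw [if_pos c4]
        refine Or.inr ⟨_, rfl, ?_⟩
        subst c4
        have := hP.position' hF h0 h1 ht
        linarith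
      · rw [if_neg c4, if_pos le_rfl]
        obtain ⟨w, hw1, hw2⟩ := hP.keys' (by omega : P ≤ k - 1) (by omega)
        refine Or.inr ⟨_, hw2, ?_⟩
        have hm1 := hmove (k - 1) (h w) hw2
        rw [show k - 1 + 1 = k by omega] at hm1
        rw [hm1]
        have hs := hF.succ (a + (k - 1)) t
        rw [add_assoc, show k - 1 + 1 = k by omega] at hs
        rcases hs ht with h3 | ⟨r, hr, h3⟩
        · have := neg_one_lt_realDisp n (a + (k - 1)) (h w)
          linarith
        · rw [hw2] at hr
          have : h w = r := by simpa using hr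
          rw [this]
          linarith
    · rw [if_neg (by omega), if_neg (by omega)]
      exact Or.inr ⟨t, ht, h2⟩

lemma PlaceSpec.ordered (hP : PlaceSpec n h u P D A A') (hF : OrderedHash n (slotHash n h A))
    {e : ℕ} (he : slotHash n h A e = none)
    (h0 : 0 ≤ h u) (h1 : h u < 1) (hinj : ∀ i w, A (i % n) = .key w → h w ≠ h u) :
    OrderedHash n (slotHash n h A') := by
  have hn := hF.pos
  have hbd : ∀ i r, slotHash n h A' i = some r → 0 ≤ r ∧ r < 1 := by
    intro i r hr
    obtain ⟨k, hk, hik⟩ := exists_add_mod hn (home n (h u)) i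
    have h2 : slotHash n h A' i = slotHash n h A' (home n (h u) + k) := by
      unfold slotHash; rw [hik]
    rw [h2, hP.slotHash_eq hk] at hr
    split_ifs at hr
    · exact ⟨hF.nonneg _ _ hr, hF.lt_one _ _ hr⟩
    · have : h u = r := by simpa using hr
      subst this
      exact ⟨h0, h1⟩
    · exact ⟨hF.nonneg _ _ hr, hF.lt_one _ _ hr⟩
    · exact ⟨hF.nonneg _ _ hr, hF.lt_one _ _ hr⟩
  refine ⟨hn, fun i => by simp [slotHash], fun i r hr => (hbd i r hr).1,
    fun i r hr => (hbd i r hr).2, fun i r' hr' => ?_⟩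
  obtain ⟨k, hk, hik⟩ := exists_add_mod hn (home n (h u)) i
  have hr0 := hbd _ _ hr'
  have h2 : slotHash n h A' i = slotHash n h A' (home n (h u) + k) := by
    unfold slotHash; rw [hik]
  rw [h2]
  have key : realDisp n (i + 1) r' ≤ 0 ∨
      ∃ r, slotHash n h A' (home n (h u) + k) = some r ∧
        realDisp n (i + 1) r' < realDisp n (home n (h u) + k) r + 1 := by
    by_cases hk1 : k + 1 < n
    · have hm : (i + 1) % n = (home n (h u) + (k + 1)) % n := by
        rw [← Nat.mod_add_mod, hik, Nat.mod_add_mod, add_assoc]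
      have h3 : slotHash n h A' (i + 1) = slotHash n h A' (home n (h u) + (k + 1)) := by
        unfold slotHash; rw [hm]
      rw [realDisp_congr (home_lt hr0.1 hr0.2 hn) hm]
      exact hP.succ_of_lt hF he h0 h1 hinj hk1 (h3 ▸ hr')
    · have hm : (i + 1) % n = (home n (h u) + 0) % n := by
        rw [← Nat.mod_add_mod, hik, Nat.mod_add_mod, add_assoc, show k + 1 = n by omega]
        simp
      have h3 : slotHash n h A' (i + 1) = slotHash n h A' (home n (h u) + 0) := by
        unfold slotHash; rw [hm]
      rw [realDisp_congr (home_lt hr0.1 hr0.2 hn) hm]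
      exact hP.succ_last hF he h0 h1 (by omega) (h3 ▸ hr')
  rcases key with h4 | ⟨r, hr, h4⟩
  · exact Or.inl h4
  · refine Or.inr ⟨r, hr, ?_⟩
    have hr1 := hbd _ _ (h2.trans hr)
    rwa [realDisp_congr (home_lt hr1.1 hr1.2 hn) hik]

/-- The contents after an insertion: the item in slot `home + D` is dropped and `u` is added. -/
lemma PlaceSpec.slot_iff (hP : PlaceSpec n h u P D A A') (v : Slot U) :
    (∃ i, i < n ∧ A' ((home n (h u) + i) % n) = v) ↔
      v = .key u ∨ ∃ i, i < n ∧ i ≠ D ∧ A ((home n (h u) + i) % n) = v := by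
  have hPD := hP.le
  have hDn := hP.lt
  constructor
  · rintro ⟨i, hi, rfl⟩
    rw [hP.result i hi]
    split_ifs with c1 c2 c3
    · exact Or.inr ⟨i, hi, by omega, rfl⟩
    · exact Or.inl rfl
    · exact Or.inr ⟨i - 1, by omega, by omega, rfl⟩
    · exact Or.inr ⟨i, hi, by omega, rfl⟩
  · rintro (rfl | ⟨i, hi, hiD, rfl⟩)
    · refine ⟨P, by omega, ?_⟩
      rw [hP.result _ (by omega), if_neg (by omega), if_pos rfl]
    · by_cases c1 : i < P
      · exact ⟨i, hi, by rw [hP.result i hi, if_pos c1]⟩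
      by_cases c2 : i < D
      · refine ⟨i + 1, by omega, ?_⟩
        rw [hP.result _ (by omega), if_neg (by omega), if_neg (by omega), if_pos (by omega)]
        simp
      · refine ⟨i, hi, ?_⟩
        rw [hP.result i hi, if_neg c1, if_neg (by omega), if_neg (by omega)]

lemma exists_slot_iff (hn : 0 < n) (a : ℕ) (Q : Slot U → Prop) :
    (∃ i, Q (A (i % n))) ↔ ∃ i, i < n ∧ Q (A ((a + i) % n)) := by
  constructor
  · rintro ⟨i, hi⟩
    obtain ⟨k, hk, hik⟩ := exists_add_mod hn a i
    exact ⟨k, hk, hik ▸ hi⟩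
  · rintro ⟨i, -, hi⟩
    exact ⟨_, hi⟩

lemma PlaceSpec.key_iff (hP : PlaceSpec n h u P D A A') (hn : 0 < n) (v : U) :
    (∃ i, A' (i % n) = .key v) ↔ v = u ∨ ∃ i, A (i % n) = .key v := by
  rw [exists_slot_iff hn (home n (h u)) (fun x => x = Slot.key v),
    exists_slot_iff hn (home n (h u)) (fun x => x = Slot.key v), hP.slot_iff]
  constructor
  · rintro (h1 | ⟨i, hi, -, h1⟩)
    · exact Or.inl (by simpa using h1)
    · exact Or.inr ⟨i, hi, h1⟩
  · rintro (rfl | ⟨i, hi, h1⟩)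
    · exact Or.inl rfl
    · refine Or.inr ⟨i, hi, ?_, h1⟩
      rintro rfl
      have := hP.used
      rw [h1] at this
      simp [Slot.IsKey] at this

/-- Only the item in the used slot is lost. Since a hash occurs in one slot only, its hash
disappears with it, unless it is the hash of `u`. -/
lemma PlaceSpec.hash_iff (hP : PlaceSpec n h u P D A A') (hF : OrderedHash n (slotHash n h A))
    (r : ℝ) : (∃ i, slotHash n h A' i = some r) ↔
      r = h u ∨ ((∃ i, slotHash n h A i = some r) ∧
        slotHash n h A (home n (h u) + D) ≠ some r) := by
  have hn := hF.pos
  unfold slotHash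
  rw [exists_slot_iff hn (home n (h u)) (fun x => x.hash? h = some r),
    exists_slot_iff hn (home n (h u)) (fun x => x.hash? h = some r)]
  have hex : (∃ i, i < n ∧ (A' ((home n (h u) + i) % n)).hash? h = some r) ↔
      ∃ v : Slot U, v.hash? h = some r ∧ ∃ i, i < n ∧ A' ((home n (h u) + i) % n) = v := by
    constructor
    · rintro ⟨i, hi, h1⟩; exact ⟨_, h1, i, hi, rfl⟩
    · rintro ⟨v, h1, i, hi, rfl⟩; exact ⟨i, hi, h1⟩
  rw [hex]
  constructor
  · rintro ⟨v, hv, h1⟩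
    rcases (hP.slot_iff v).1 h1 with rfl | ⟨i, hi, hiD, rfl⟩
    · left
      simpa [Slot.hash?, eq_comm] using hv
    · refine Or.inr ⟨⟨i, hi, hv⟩, fun h2 => hiD ?_⟩
      exact add_mod_inj hi hP.lt (hF.mod_eq_of_hash_eq (s := home n (h u) + i)
        (s' := home n (h u) + D) hv h2)
  · rintro (rfl | ⟨⟨i, hi, h1⟩, h2⟩)
    · exact ⟨.key u, rfl, (hP.slot_iff _).2 (Or.inl rfl)⟩
    · refine ⟨_, h1, (hP.slot_iff _).2 (Or.inr ⟨i, hi, ?_, rfl⟩)⟩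
      rintro rfl
      exact h2 h1

/-- All slots that are examined before the last one are occupied; tombstones among them come before
`u`. -/
lemma PlaceSpec.examined (hP : PlaceSpec n h u P D A A') (hF : OrderedHash n (slotHash n h A))
    (h0 : 0 ≤ h u) (h1 : h u < 1) {k : ℕ} (hk : k < D) :
    ∃ r, slotHash n h A (home n (h u) + k) = some r ∧
      (A ((home n (h u) + k) % n) = .tomb r →
        realDisp n (home n (h u) + k) (h u) < realDisp n (home n (h u) + k) r) := by
  by_cases hkP : k < P
  · obtain ⟨r, hr, h2⟩ := hP.pass' hF h0 h1 hkP
    exact ⟨r, hr, fun _ => h2⟩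
  · obtain ⟨w, hw1, hw2⟩ := hP.keys' (by omega) hk
    exact ⟨_, hw2, fun h2 => by rw [hw1] at h2; simp at h2⟩

/-- A tombstone that is used up does not come before `u`. -/
lemma PlaceSpec.used' (hP : PlaceSpec n h u P D A A') (hF : OrderedHash n (slotHash n h A))
    (h0 : 0 ≤ h u) (h1 : h u < 1) {t : ℝ} (ht : slotHash n h A (home n (h u) + D) = some t) :
    realDisp n (home n (h u) + D) t ≤ realDisp n (home n (h u) + D) (h u) := by
  have hDn := hP.lt
  -- From the position of `u` onwards all items up to the used slot have at least the hash of `u`: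
  -- each successor has a larger hash than its predecessor or stands in its own home, which is
  -- behind that of `u`.
  have key : ∀ k, P ≤ k → k ≤ D → ∀ t, slotHash n h A (home n (h u) + k) = some t →
      realDisp n (home n (h u) + k) t ≤ realDisp n (home n (h u) + k) (h u) := by
    intro k hPk
    induction k, hPk using Nat.le_induction with
    | base => exact fun _ t ht => hP.position' hF h0 h1 ht
    | succ k hk ih =>
      intro hkD t ht
      have h2 := hF.succ (home n (h u) + k) t
      rw [add_assoc] at h2
      rcases h2 ht with h3 | ⟨r, hr, h3⟩
      · rw [realDisp_home_add (by omega)]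
        have := Int.fract_lt_one ((n : ℝ) * h u)
        have h4 : (0 : ℝ) ≤ k := by positivity
        push_cast
        linarith
      · have h4 := ih (by omega) r hr
        rw [realDisp_home_add (by omega)] at h4 ⊢
        push_cast
        linarith
  exact key D hP.le le_rfl t ht

end Insertion

/-! ### Correctness of searching -/

/-- By `chain` the slots between the home of `u` and its slot are occupied by items of smaller hash,
so neither a free slot nor a larger hash can stop the search before `u`. -/
lemma FindSpec.eq_some_iff {c : Config} {h : U → ℝ} {t : Table} {u : U} {D : ℕ} {s : Mem U}
    {res : Option ℕ × Mem U} (H : FindSpec c h t u 0 D s res)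
    (hF : OrderedHash t.cap (slotHash t.cap h (s.arr t.side)))
    (h0 : 0 ≤ h u) (h1 : h u < 1)
    (hkey : ∃ i, s.arr t.side (i % t.cap) = .key u) : res.1 ≠ none := by
  intro hnone
  have hn := hF.pos
  rcases H.result with ⟨h2, -⟩ | ⟨-, h2⟩
  · rw [hnone] at h2; simp at h2
  obtain ⟨i, hi⟩ := hkey
  have hhome := home_lt h0 h1 hn
  set d := disp t.cap i (h u) with hd
  have hdn : d < t.cap := disp_lt hn _ _
  have hmod := mod_eq_home_add (i := i) hhome
  rw [← hd] at hmod
  rw [hmod] at hi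
  have hs : slotHash t.cap h (s.arr t.side) (home t.cap (h u) + d) = some (h u) := by
    rw [slotHash, hi]; rfl
  have hd' : disp t.cap (home t.cap (h u) + d) (h u) = d := disp_home_add hdn
  have hDd : D ≤ d := by
    by_contra hcon
    obtain ⟨r, hr, -, hne⟩ := H.pass d (by omega) (by omega)
    exact hne hi
  obtain ⟨r, hr, hle, -⟩ := hF.chain hs (d - D) (by omega) (by omega)
  rw [show home t.cap (h u) + d - (d - D) = home t.cap (h u) + D by omega] at hr hle
  rcases h2 with h2 | h2 | ⟨r', hr', hgt, -⟩
  · omega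
  · rw [slotHash, h2] at hr
    simp [Slot.hash?] at hr
  · rw [slotHash, hr'] at hr
    have : r' = r := by simpa using hr
    subst this
    rw [hashGT_iff (by omega) (hF.nonneg _ _ hr') (hF.lt_one _ _ hr') h0 h1] at hgt
    rw [realDisp_home_add (by omega)] at hgt
    rw [realDisp_home_add hdn] at hle
    have h3 : ((d - D : ℕ) : ℝ) = d - D := by push_cast [hDd]; ring
    rw [h3] at hle
    linarith

/-- All slots that are passed in a search contain items that belong to the home slot of `u` or
to an earlier slot. -/
lemma FindSpec.le_disp {c : Config} {h : U → ℝ} {t : Table} {u : U} {D : ℕ} {s : Mem U}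
    {res : Option ℕ × Mem U} (H : FindSpec c h t u 0 D s res)
    (hF : OrderedHash t.cap (slotHash t.cap h (s.arr t.side)))
    (h0 : 0 ≤ h u) (h1 : h u < 1) {k : ℕ} (hk : k < D) :
    ∃ r, slotHash t.cap h (s.arr t.side) (home t.cap (h u) + k) = some r ∧
      k ≤ disp t.cap (home t.cap (h u) + k) r := by
  have hle := H.le_cap
  obtain ⟨r, hr, hgt, -⟩ := H.pass k (by omega) hk
  refine ⟨r, hr, ?_⟩
  rw [hashGT_iff (by omega) (hF.nonneg _ _ hr) (hF.lt_one _ _ hr) h0 h1, not_lt] at hgt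
  have := disp_le_of_realDisp_le hgt
  rwa [disp_home_add (by omega)] at this

end Graveyard

namespace Graveyard

variable {U : Type*}

/-! ### Writing a sorted list of items into an empty table -/

/-- The first slot that may be used after a list of items has been appended. -/
noncomputable def endPos (n : ℕ) (l : List (ℝ × Slot U)) (p : ℕ) : ℕ :=
  l.foldl (fun p e => max p (home n e.1) + 1) p

/-- The first slot that may be used and the array, after a list of items has been appended. -/
noncomputable def layout (n : ℕ) (l : List (ℝ × Slot U)) (st : ℕ × (ℕ → Slot U)) :
    ℕ × (ℕ → Slot U) :=
  l.foldl (fun st e => (max st.1 (home n e.1) + 1,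
    Function.update st.2 (max st.1 (home n e.1) % n) e.2)) st

lemma layout_append (n : ℕ) (l l' : List (ℝ × Slot U)) (st : ℕ × (ℕ → Slot U)) :
    layout n (l ++ l') st = layout n l' (layout n l st) := List.foldl_append

lemma endPos_append (n : ℕ) (l l' : List (ℝ × Slot U)) (p : ℕ) :
    endPos n (l ++ l') p = endPos n l' (endPos n l p) := List.foldl_append

lemma layout_fst (n : ℕ) (l : List (ℝ × Slot U)) (st : ℕ × (ℕ → Slot U)) :
    (layout n l st).1 = endPos n l st.1 := by
  induction l generalizing st with
  | nil => rfl
  | cons e l ih => exact ih _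

lemma add_length_le_endPos (n : ℕ) (l : List (ℝ × Slot U)) (p : ℕ) :
    p + l.length ≤ endPos n l p := by
  induction l generalizing p with
  | nil => simp [endPos]
  | cons e l ih =>
    have := ih (max p (home n e.1) + 1)
    change _ ≤ endPos n l (max p (home n e.1) + 1)
    simp only [List.length_cons]
    omega

lemma endPos_mono (n : ℕ) (l : List (ℝ × Slot U)) {p p' : ℕ} (h : p ≤ p') :
    endPos n l p ≤ endPos n l p' := by
  induction l generalizing p p' with
  | nil => exact h
  | cons e l ih => exact ih (show max p (home n e.1) + 1 ≤ max p' (home n e.1) + 1 by omega)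

/-- Once an item is written in its home slot the starting point is forgotten; if this never happens,
the items fill consecutive slots from `p`. -/
lemma endPos_le_max (n : ℕ) (l : List (ℝ × Slot U)) {p p' : ℕ} :
    endPos n l p ≤ max (endPos n l p') (p + l.length) := by
  induction l generalizing p p' with
  | nil => simp [endPos]
  | cons e l ih =>
    change endPos n l (max p (home n e.1) + 1) ≤ max (endPos n l (max p' (home n e.1) + 1)) _
    simp only [List.length_cons]
    rcases le_total p (home n e.1) with h1 | h1
    · have := endPos_mono n l (show max p (home n e.1) + 1 ≤ max p' (home n e.1) + 1 by omega)
      omega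
    · have := ih (p := max p (home n e.1) + 1) (p' := max p' (home n e.1) + 1)
      omega

lemma endPos_le (n : ℕ) (l : List (ℝ × Slot U)) {p y : ℕ} (hy : ∀ e ∈ l, home n e.1 ≤ y) :
    endPos n l p ≤ max p y + l.length := by
  induction l generalizing p with
  | nil => simp [endPos]
  | cons e l ih =>
    change endPos n l (max p (home n e.1) + 1) ≤ _
    have h1 := ih (p := max p (home n e.1) + 1) (fun e he => hy e (by simp [he]))
    have h2 := hy e (by simp)
    simp only [List.length_cons]
    rcases l with - | ⟨e', l⟩
    · simp [endPos] at h1 ⊢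
      omega
    · have h3 := ih (p := max p (home n e.1) + 1) (fun e he => hy e (by simp [he]))
      omega

/-- A list of items that can be written into a table with `n` slots. -/
structure Items (n : ℕ) (h : U → ℝ) (l : List (ℝ × Slot U)) : Prop where
  sorted : l.Pairwise (fun e e' => e.1 < e'.1)
  nonneg : ∀ e ∈ l, 0 ≤ e.1
  lt_one : ∀ e ∈ l, e.1 < 1
  hash : ∀ e ∈ l, e.2.hash? h = some e.1
  length_lt : l.length < n

lemma home_mono {n : ℕ} {r r' : ℝ} (h : r ≤ r') : home n r ≤ home n r' :=
  Nat.floor_mono (mul_le_mul_of_nonneg_left h (by positivity))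

variable {n : ℕ} {h : U → ℝ}

/-- The number `o` of wrapping items is computed by a pass from slot `0`, but the items are written
from slot `o`. The first bound says that the late start does not push the end beyond `n + o`. The
second says that no item is displaced by a full revolution: if `o` exceeds the home of `e`, then `o`
is smaller than the number of items after `e`. Both use that there are fewer than `n` items. -/
lemma Items.pos_lt {l₁ l₂ : List (ℝ × Slot U)} {e : ℝ × Slot U}
    (hl : Items n h (l₁ ++ e :: l₂)) {o : ℕ} (ho : o = endPos n (l₁ ++ e :: l₂) 0 - n) :
    max (endPos n l₁ o) (home n e.1) < n + o ∧
      max (endPos n l₁ o) (home n e.1) < n + home n e.1 := by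
  have hs := List.pairwise_append.1 hl.sorted
  have h1 : ∀ e' ∈ l₁, home n e'.1 ≤ home n e.1 := fun e' he' =>
    home_mono (hs.2.2 e' he' e (by simp)).le
  have hlen := hl.length_lt
  simp only [List.length_append, List.length_cons] at hlen
  have h2 : ∀ e' ∈ l₁ ++ e :: l₂, home n e'.1 ≤ n - 1 := fun e' he' => by
    have := home_lt (hl.nonneg e' he') (hl.lt_one e' he') (by omega : 0 < n)
    omega
  have h3 : ∀ p, endPos n (l₁ ++ e :: l₂) p = endPos n l₂ (max (endPos n l₁ p) (home n e.1) + 1) :=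
    fun p => endPos_append n l₁ (e :: l₂) p
  have h4 := endPos_le_max n (l₁ ++ e :: l₂) (p := o) (p' := 0)
  have h5 := add_length_le_endPos n l₂ (max (endPos n l₁ o) (home n e.1) + 1)
  have h6 := endPos_le n l₁ (p := o) h1
  have h7 := endPos_le n l₁ (p := 0) h1
  have h8 := endPos_le n l₂ (p := max (endPos n l₁ 0) (home n e.1) + 1) (y := n - 1)
    (fun e' he' => h2 e' (by simp [he']))
  have h9 := h2 e (by simp)
  rw [h3 o] at h4
  rw [h3 0] at h4 ho
  simp only [List.length_append, List.length_cons] at h4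
  constructor <;> omega

/-- The state of the array after a part of the items has been written, starting at slot `o`. -/
structure LayoutInv (n : ℕ) (h : U → ℝ) (o : ℕ) (l : List (ℝ × Slot U)) (p : ℕ)
    (A : ℕ → Slot U) : Prop where
  le : o ≤ p
  le_add : p ≤ n + o
  free : ∀ k, p ≤ k → k < n + o → A (k % n) = .free
  slot : ∀ k, o ≤ k → k < p → ∀ r, slotHash n h A k = some r → 0 ≤ r ∧ r < 1 ∧ home n r ≤ k ∧
    k < home n r + n ∧
    (home n r = k ∨ k = o ∨ (o < k ∧ ∃ r', slotHash n h A (k - 1) = some r' ∧ r' < r))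
  last : p = o ∨ (o < p ∧ ∃ r, slotHash n h A (p - 1) = some r ∧ ∃ e ∈ l, r = e.1)
  mem : ∀ v, v ≠ .free → ((∃ k, o ≤ k ∧ k < p ∧ A (k % n) = v) ↔ ∃ e ∈ l, e.2 = v)

lemma mod_ne_of_lt {o k q : ℕ} (hk : o ≤ k) (hkq : k < q) (hq : q < n + o) : k % n ≠ q % n := by
  intro h1
  have := add_mod_inj (n := n) (b := o) (i := k - o) (j := q - o) (by omega) (by omega)
    (by rwa [show o + (k - o) = k by omega, show o + (q - o) = q by omega])
  omega

/-- The new item is in its home slot, or directly behind the last item, whose hash is smaller, or it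
is the first item, written in slot `o`. -/
lemma LayoutInv.snoc {o p : ℕ} {l : List (ℝ × Slot U)} {A : ℕ → Slot U}
    (H : LayoutInv n h o l p A) {e : ℝ × Slot U} (h0 : 0 ≤ e.1) (h1 : e.1 < 1)
    (he : e.2.hash? h = some e.1) (hlt : ∀ e' ∈ l, e'.1 < e.1)
    (hq1 : max p (home n e.1) < n + o) (hq2 : max p (home n e.1) < n + home n e.1) :
    LayoutInv n h o (l ++ [e]) (max p (home n e.1) + 1)
      (Function.update A (max p (home n e.1) % n) e.2) := by
  have hle := H.le
  set q := max p (home n e.1) with hq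
  have hne : ∀ k, o ≤ k → k < q → Function.update A (q % n) e.2 (k % n) = A (k % n) :=
    fun k hk1 hk2 => Function.update_of_ne (mod_ne_of_lt hk1 hk2 hq1) _ _
  have hne' : ∀ k, o ≤ k → k < q → slotHash n h (Function.update A (q % n) e.2) k =
      slotHash n h A k := fun k hk1 hk2 => by rw [slotHash, hne k hk1 hk2, slotHash]
  have hself : slotHash n h (Function.update A (q % n) e.2) q = some e.1 := by
    rw [slotHash, Function.update_self, he]
  refine ⟨by omega, by omega, fun k hk1 hk2 => ?_, fun k hk1 hk2 r hr => ?_, Or.inr ⟨by omega, ?_⟩,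
    fun v hv => ?_⟩
  · rw [Function.update_of_ne (mod_ne_of_lt (n := n) (by omega) hk1 hk2).symm]
    exact H.free k (by omega) hk2
  · rcases Nat.lt_or_ge k q with h2 | h2
    · rw [hne' k hk1 h2] at hr
      rcases Nat.lt_or_ge k p with h3 | h3
      · obtain ⟨g0, g1, g2, g3, g4⟩ := H.slot k hk1 h3 r hr
        refine ⟨g0, g1, g2, g3, ?_⟩
        rcases g4 with g4 | g4 | ⟨g4, r', g5, g6⟩
        · exact Or.inl g4
        · exact Or.inr (Or.inl g4)
        · exact Or.inr (Or.inr ⟨g4, r', by rw [hne' _ (by omega) (by omega)]; exact g5, g6⟩)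
      · rw [slotHash, H.free k h3 (by omega)] at hr
        simp [Slot.hash?] at hr
    · have h3 : k = q := by omega
      subst h3
      rw [hself] at hr
      have : e.1 = r := by simpa using hr
      subst this
      refine ⟨h0, h1, by omega, by omega, ?_⟩
      by_cases h3 : home n e.1 = q
      · exact Or.inl h3
      · have h4 : q = p := by omega
        rcases H.last with h5 | ⟨h5, r, hr, e', he', h6⟩
        · exact Or.inr (Or.inl (by omega))
        · refine Or.inr (Or.inr ⟨by omega, r, ?_, ?_⟩)
          · rw [hne' _ (by omega) (by omega), h4]
            exact hr
          · rw [h6]; exact hlt e' he'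
  · rw [Nat.add_sub_cancel]
    exact ⟨_, hself, e, by simp, rfl⟩
  · have hm := H.mem v hv
    constructor
    · rintro ⟨k, hk1, hk2, h2⟩
      rcases Nat.lt_or_ge k q with h3 | h3
      · rw [hne k hk1 h3] at h2
        rcases Nat.lt_or_ge k p with h4 | h4
        · obtain ⟨e', he', h5⟩ := hm.1 ⟨k, hk1, h4, h2⟩
          exact ⟨e', by simp [he'], h5⟩
        · rw [H.free k h4 (by omega)] at h2
          exact absurd h2.symm hv
      · have h4 : k = q := by omega
        subst h4
        rw [Function.update_self] at h2
        exact ⟨e, by simp, h2⟩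
    · rintro ⟨e', he', h2⟩
      rcases List.mem_append.1 he' with h3 | h3
      · obtain ⟨k, hk1, hk2, h4⟩ := hm.2 ⟨e', h3, h2⟩
        exact ⟨k, hk1, by omega, by rw [hne k hk1 (by omega)]; exact h4⟩
      · have h4 : e' = e := by simpa using h3
        subst h4
        exact ⟨q, by omega, by omega, by rw [Function.update_self]; exact h2⟩

lemma Items.layoutInv {l : List (ℝ × Slot U)} (hl : Items n h l) {o : ℕ}
    (ho : o = endPos n l 0 - n) {A : ℕ → Slot U} (hA : ∀ k, k < n → A k = .free) :
    ∀ l₁ l₂, l = l₁ ++ l₂ →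
      LayoutInv n h o l₁ (layout n l₁ (o, A)).1 (layout n l₁ (o, A)).2 := by
  intro l₁
  have hn : 0 < n := by have := hl.length_lt; omega
  induction l₁ using List.reverseRecOn with
  | nil =>
    intro l₂ _
    refine ⟨le_rfl, by simp [layout], fun k _ _ => hA _ (Nat.mod_lt _ hn), fun k h1 h2 => ?_,
      Or.inl rfl, fun v hv => ?_⟩
    · simp [layout] at h2; omega
    · simp only [layout, List.foldl_nil, List.not_mem_nil, false_and, exists_false, iff_false]
      rintro ⟨k, h1, h2, -⟩
      omega
  | append_singleton l₁ e ih =>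
    intro l₂ hl₂
    rw [List.append_assoc, List.singleton_append] at hl₂
    have H := ih _ hl₂
    have he : e ∈ l := by rw [hl₂]; simp
    have hp := Items.pos_lt (hl₂ ▸ hl) (o := o) (by rw [ho, hl₂])
    have hs := List.pairwise_append.1 (hl₂ ▸ hl.sorted)
    rw [layout_append]
    have h1 : (layout n l₁ (o, A)).1 = endPos n l₁ o := layout_fst _ _ _
    exact H.snoc (hl.nonneg e he) (hl.lt_one e he) (hl.hash e he)
      (fun e' he' => hs.2.2 e' he' e (by simp)) (by rw [h1]; exact hp.1) (by rw [h1]; exact hp.2)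

lemma realDisp_eq_sub {k : ℕ} {r : ℝ} (h0 : 0 ≤ r) (h1 : home n r ≤ k) (h2 : k < home n r + n) :
    realDisp n k r = k - n * r := by
  have h3 := realDisp_home_add (n := n) (i := k - home n r) (r := r) (by omega)
  rw [show home n r + (k - home n r) = k by omega, Nat.cast_sub h1] at h3
  have h4 := home_add_fract (n := n) h0
  linarith

lemma Items.layout_spec {l : List (ℝ × Slot U)} (hl : Items n h l) {o : ℕ}
    (ho : o = endPos n l 0 - n) {A : ℕ → Slot U} (hA : ∀ k, k < n → A k = .free) :
    OrderedHash n (slotHash n h (layout n l (o, A)).2) ∧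
      (∀ v, v ≠ .free → ((∃ i, (layout n l (o, A)).2 (i % n) = v) ↔ ∃ e ∈ l, e.2 = v)) ∧
      (layout n l (o, A)).1 ≤ n + o := by
  have hn : 0 < n := by have := hl.length_lt; omega
  have H := hl.layoutInv ho hA l [] (by simp)
  have hp : (layout n l (o, A)).1 = endPos n l o := layout_fst _ _ _
  set p := (layout n l (o, A)).1
  set A' := (layout n l (o, A)).2
  have hoc : ∀ k r, o ≤ k → k < n + o → slotHash n h A' k = some r → k < p := by
    intro k r h1 h2 h3
    by_contra h4
    rw [slotHash, H.free k (by omega) h2] at h3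
    simp [Slot.hash?] at h3
  refine ⟨⟨hn, fun i => by simp [slotHash], ?_, ?_, ?_⟩, fun v hv => ?_, H.le_add⟩
  · intro i r hr
    obtain ⟨k, hk, hik⟩ := exists_add_mod hn o i
    rw [slotHash, hik] at hr
    exact (H.slot (o + k) (by omega) (hoc _ r (by omega) (by omega) hr) r hr).1
  · intro i r hr
    obtain ⟨k, hk, hik⟩ := exists_add_mod hn o i
    rw [slotHash, hik] at hr
    exact (H.slot (o + k) (by omega) (hoc _ r (by omega) (by omega) hr) r hr).2.1
  · intro i r' hr'
    obtain ⟨k, hk, hik⟩ := exists_add_mod hn o (i + 1)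
    rw [slotHash, hik] at hr'
    have hkp := hoc _ r' (by omega) (by omega) hr'
    obtain ⟨g0, g1, g2, g3, g4⟩ := H.slot (o + k) (by omega) hkp r' hr'
    rw [realDisp_congr (home_lt g0 g1 hn) hik]
    have hd := realDisp_eq_sub g0 g2 g3
    rcases g4 with g4 | g4 | ⟨g4, r, g5, g6⟩
    · left
      rw [realDisp_nonpos_iff]
      have := disp_home_add (n := n) (i := 0) (r := r') hn
      rwa [add_zero, g4] at this
    · have hk0 : k = 0 := by omega
      subst hk0
      by_cases ho0 : home n r' = o
      · left
        rw [realDisp_nonpos_iff]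
        have := disp_home_add (n := n) (i := 0) (r := r') hn
        rwa [add_zero, ho0] at this
      · right
        -- An item in slot `o` that is not at home forces `o > 0`. So the first pass ran past the
        -- end of the table, and by monotonicity the second one ends exactly at `n + o`: the last
        -- item written is the cyclic predecessor of slot `o`.
        have hpo : p = n + o := by
          have h2 := endPos_mono n l (Nat.zero_le o)
          have := H.le_add
          omega
        rcases H.last with h5 | ⟨h5, r, hr, -⟩
        · omega
        have him : i % n = (p - 1) % n := by
          have h6 : i + 1 ≡ p - 1 + 1 [MOD n] := by
            rw [Nat.ModEq, hik, hpo, show n + o - 1 + 1 = o + n by omega]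
            simp
          exact Nat.ModEq.add_right_cancel' _ h6
        obtain ⟨b0, b1, b2, b3, -⟩ := H.slot (p - 1) (by omega) (by omega) r hr
        refine ⟨r, by rw [slotHash, him]; exact hr, ?_⟩
        rw [realDisp_congr (home_lt b0 b1 hn) him, hd, realDisp_eq_sub b0 b2 b3,
          Nat.cast_sub (by omega), hpo]
        push_cast
        have hn' : (0 : ℝ) < n := by exact_mod_cast hn
        nlinarith
    · right
      have him : i % n = (o + k - 1) % n := by
        have h6 : i + 1 ≡ o + k - 1 + 1 [MOD n] := by
          rw [Nat.ModEq, hik, show o + k - 1 + 1 = o + k by omega]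
        exact Nat.ModEq.add_right_cancel' _ h6
      obtain ⟨b0, b1, b2, b3, -⟩ := H.slot (o + k - 1) (by omega) (by omega) r g5
      refine ⟨r, by rw [slotHash, him]; exact g5, ?_⟩
      rw [realDisp_congr (home_lt b0 b1 hn) him, hd, realDisp_eq_sub b0 b2 b3,
        Nat.cast_sub (by omega)]
      push_cast
      have hn' : (0 : ℝ) < n := by exact_mod_cast hn
      nlinarith
  · rw [← H.mem v hv]
    constructor
    · rintro ⟨i, hi⟩
      obtain ⟨k, hk, hik⟩ := exists_add_mod hn o i
      rw [hik] at hi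
      refine ⟨o + k, by omega, ?_, hi⟩
      by_contra h4
      rw [H.free _ (by omega) (by omega)] at hi
      exact hv hi.symm
    · rintro ⟨k, -, -, hk⟩
      exact ⟨k, hk⟩

end Graveyard

namespace Graveyard

variable {U : Type*}

/-! ### Block transfers of two interleaved scans -/

open Classical in
/-- A potential for two interleaved scans that have reached the blocks `α` and `β`. -/
noncomputable def pot (s : Mem U) (α β : Bool × ℕ) : ℕ :=
  if ∃ l, s.resident = α :: β :: l ∨ s.resident = β :: α :: l then 0
  else if ∃ l, s.resident = α :: l ∨ s.resident = β :: l then 1 else 2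

lemma pot_le_two (s : Mem U) (α β : Bool × ℕ) : pot s α β ≤ 2 := by
  unfold pot; split_ifs <;> simp

lemma pot_comm (s : Mem U) (α β : Bool × ℕ) : pot s α β = pot s β α := by
  classical
  have h1 : (∃ l, s.resident = α :: β :: l ∨ s.resident = β :: α :: l) ↔
      ∃ l, s.resident = β :: α :: l ∨ s.resident = α :: β :: l := exists_congr fun _ => or_comm
  have h2 : (∃ l, s.resident = α :: l ∨ s.resident = β :: l) ↔
      ∃ l, s.resident = β :: l ∨ s.resident = α :: l := exists_congr fun _ => or_comm
  unfold pot
  exact if_congr h1 rfl (if_congr h2 rfl rfl)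

lemma pot_le_one {s : Mem U} {α : Bool × ℕ} (β : Bool × ℕ) {l : List (Bool × ℕ)}
    (h : s.resident = α :: l) : pot s α β ≤ 1 := by
  unfold pot
  split_ifs with h1 h2
  · simp
  · simp
  · exact absurd ⟨l, Or.inl h⟩ h2

lemma pot_eq_zero {s : Mem U} {α β : Bool × ℕ} {l : List (Bool × ℕ)}
    (h : s.resident = α :: β :: l) : pot s α β = 0 := by
  unfold pot
  rw [if_pos ⟨l, Or.inl h⟩]

/-- The potential counts how far the two most recently used blocks are from being the current blocks
of the two scans. While both scans stay in their blocks, every miss lowers it, and this needs room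
for two blocks; entering a new block costs at most one miss and leaves a potential of at most one.
-/
lemma miss_add_pot_touch {c : Config} (hc : 2 ≤ c.M / c.B - 1) (s : Mem U) (b : Bool) (p q : ℕ)
    {β : Bool × ℕ} (hβ : β.1 ≠ b) :
    miss c s b p + pot (s.touch c b p) (b, p / c.B) β ≤
      pot s (b, q / c.B) β + if p / c.B = q / c.B then 0 else 2 := by
  obtain ⟨k, hk⟩ := Nat.exists_eq_add_of_le' hc
  set α : Bool × ℕ := (b, p / c.B) with hα
  have hne : β ≠ α := fun h => hβ (by rw [h])
  have hres : (s.touch c b p).resident = α :: (s.resident.erase α).take (k + 1) := by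
    simp [Mem.touch, hk, hα]
  have h1 := pot_le_one β hres
  split_ifs with hpq
  · rw [← hpq, ← hα, add_zero]
    conv_rhs => unfold pot
    split_ifs with h2 h3
    · obtain ⟨l, h2 | h2⟩ := h2
      · have h4 : pot (s.touch c b p) α β = 0 := by
          apply pot_eq_zero (l := l.take k)
          rw [hres, h2]
          simp
        rw [h4]
        simp [miss, ← hα, h2]
      · have h4 : pot (s.touch c b p) α β = 0 := by
          apply pot_eq_zero (l := l.take k)
          rw [hres, h2, List.erase_cons_tail (by simpa using hne)]
          simp
        rw [h4]
        simp [miss, ← hα, h2]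
    · obtain ⟨l, h3 | h3⟩ := h3
      · have : miss c s b p = 0 := by simp [miss, ← hα, h3]
        omega
      · have h4 : pot (s.touch c b p) α β = 0 := by
          apply pot_eq_zero (l := (l.erase α).take k)
          rw [hres, h3, List.erase_cons_tail (by simpa using hne)]
          simp
        have := miss_le_one c s b p
        omega
    · have := miss_le_one c s b p
      omega
  · have := miss_le_one c s b p
    omega

lemma miss_add_pot_scan {c : Config} (hc : 2 ≤ c.M / c.B - 1) (s : Mem U) (b : Bool) {n p q : ℕ}
    (hn : 0 < n) (hpq : p ≤ q) {β : Bool × ℕ} (hβ : β.1 ≠ b) :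
    miss c s b (q % n) + pot (s.touch c b (q % n)) (b, q % n / c.B) β ≤
      pot s (b, p % n / c.B) β + 2 * crossings n c.B p q := by
  refine (miss_add_pot_touch hc s b (q % n) (p % n) hβ).trans ?_
  split_ifs with h
  · omega
  · have : crossings n c.B p q ≠ 0 := fun h0 => h (block_eq_of_crossings hn hpq h0)
    omega

lemma pot_write (c : Config) (s : Mem U) (b : Bool) (p : ℕ) (v : Slot U) (α β : Bool × ℕ) :
    pot (s.write c b p v) α β = pot (s.touch c b p) α β := rfl

lemma clear_spec {c : Config} (hc : 1 ≤ c.M / c.B - 1) (b : Bool) {n : ℕ} (hn : 0 < n)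
    (s : Mem U) : (clear c b n s).transfers ≤ s.transfers + (n / c.B + 2) ∧
      (clear c b n s).arr (!b) = s.arr (!b) ∧ ∀ k, k < n → (clear c b n s).arr b k = .free := by
  have key : ∀ m, m ≤ n →
      let s' := (List.range m).foldl (fun s q => s.write c b q .free) s
      -- The miss at the next slot is included, so that the induction pays for each access one step
      -- in advance.
      (s'.transfers + miss c s' b (m % n) ≤ s.transfers + 1 + crossings n c.B 0 m) ∧
      s'.arr (!b) = s.arr (!b) ∧ ∀ k, k < m → s'.arr b k = .free := by
    intro m
    induction m with
    | zero =>
      intro _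
      refine ⟨?_, rfl, by omega⟩
      have := miss_le_one c s b (0 % n)
      simp only [List.range_zero, List.foldl_nil]
      omega
    | succ m ih =>
      intro hm
      obtain ⟨h1, h2, h3⟩ := ih (by omega)
      simp only [List.range_succ, List.foldl_append, List.foldl_cons, List.foldl_nil] at h1 ⊢
      set s' := (List.range m).foldl (fun s q => s.write c b q .free) s
      refine ⟨?_, ?_, ?_⟩
      · have h4 := miss_touch_succ hc s' b hn m
        rw [Nat.mod_eq_of_lt (by omega : m < n)] at h4 h1
        rw [write_transfers, miss_write, crossings_add n c.B (Nat.zero_le m) (Nat.le_succ m)]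
        rw [Nat.succ_eq_add_one]
        omega
      · rw [write_arr_ne _ _ (by simp)]; exact h2
      · intro k hk
        rw [write_arr]
        by_cases hkm : k = m
        · rw [hkm, Function.update_self]
        · rw [Function.update_of_ne hkm]; exact h3 k (by omega)
  obtain ⟨h1, h2, h3⟩ := key n le_rfl
  have h4 := crossings_period n c.B 0
  rw [zero_add] at h4
  refine ⟨?_, h2, h3⟩
  change (clear c b n s).transfers + miss c (clear c b n s) b _ ≤ _ at h1
  omega

/-! ### The passes of a rebuild -/

/-- The situation in a pass of a rebuild after `j` steps of the scan of the old table, when the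
items `l` have been appended to the new one. -/
structure Reached (c : Config) (t : Table) (commit : Bool) (n p₀ : ℕ) (s₀ : Mem U)
    (l : List (ℝ × Slot U)) (j p : ℕ) (s : Mem U) : Prop where
  pos : p = endPos n l p₀
  old : s.arr t.side = s₀.arr t.side
  new : s.arr (!t.side) = if commit then (layout n l (p₀, s₀.arr (!t.side))).2
    else s₀.arr (!t.side)
  -- The last accessed positions are `j - 1` and `p - 1`; at the start nothing has been accessed,
  -- and the constant `2` pays for any initial potential. Without `commit` the second scan stands
  -- still and its block is a dummy.
  cost : s.transfers + pot s (t.side, (j - 1) % t.cap / c.B)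
      (!t.side, if commit then (p - 1) % n / c.B else 0) ≤
    s₀.transfers + 2 + 2 * crossings t.cap c.B 0 (j - 1) +
      if commit then 2 * crossings n c.B (p₀ - 1) (p - 1) else 0

variable {c : Config} {h : U → ℝ} {t : Table} {commit : Bool} {n f p₀ : ℕ} {s₀ : Mem U}
  {l : List (ℝ × Slot U)} {j p : ℕ} {s : Mem U}

lemma reached_nil (c : Config) (t : Table) (commit : Bool) (n p₀ : ℕ) (s₀ : Mem U) :
    Reached c t commit n p₀ s₀ [] 0 p₀ s₀ := by
  refine ⟨rfl, rfl, by split_ifs <;> rfl, ?_⟩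
  have := pot_le_two s₀ (t.side, (0 - 1) % t.cap / c.B)
    (!t.side, if commit then (p₀ - 1) % n / c.B else 0)
  omega

lemma Reached.emit (hc : 2 ≤ c.M / c.B - 1) (hn : 0 < n)
    (H : Reached c t commit n p₀ s₀ l j p s) (r : ℝ) (v : Slot U) :
    Reached c t commit n p₀ s₀ (l ++ [(r, v)]) j
      (Graveyard.emit c commit (!t.side) n r v p s).1
      (Graveyard.emit c commit (!t.side) n r v p s).2 := by
  have hpos := H.pos
  have hp0 : p₀ ≤ p := by
    rw [hpos]
    have := add_length_le_endPos n l p₀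
    omega
  refine ⟨?_, ?_, ?_, ?_⟩
  · rw [endPos_append, ← hpos]
    rfl
  · unfold Graveyard.emit
    cases commit
    · exact H.old
    · simp only [if_true]
      rw [write_arr_ne _ _ (by simp)]
      exact H.old
  · unfold Graveyard.emit
    have := H.new
    cases commit
    · simpa using this
    · simp only [if_true] at this ⊢
      rw [write_arr, this, layout_append]
      have h1 : (layout n l (p₀, s₀.arr (!t.side))).1 = p := by rw [layout_fst, hpos]
      conv_rhs => rw [layout, List.foldl_cons, List.foldl_nil]
      rw [h1]
  · unfold Graveyard.emit
    have := H.cost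
    cases commit
    · simpa using this
    · simp only [if_true, Nat.add_sub_cancel] at this ⊢
      set q := max p (home n r)
      have h1 := miss_add_pot_scan hc s (!t.side) hn (p := p - 1) (q := q)
        (by omega) (β := (t.side, (j - 1) % t.cap / c.B)) (by simp)
      rw [pot_comm, pot_comm s] at h1
      rw [crossings_add n c.B (a := p₀ - 1) (b := p - 1) (d := q) (by omega) (by omega),
        write_transfers, pot_write]
      omega

open Classical in
/-- The numbers of the next tombstones with hash at most `r`. -/
noncomputable def tombsUpto (n f : ℕ) (r : ℝ) : (fuel : ℕ) → (k : ℕ) → List ℕ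
  | 0, _ => []
  | fuel + 1, k => if k ≤ f / 2 ∧ tombHash n f k ≤ r then k :: tombsUpto n f r fuel (k + 1) else []

/-- The item that represents tombstone number `k`. -/
noncomputable def tombItem (U : Type*) (n f k : ℕ) : ℝ × Slot U :=
  (tombHash n f k, .tomb (tombHash n f k))

lemma Reached.emitTombs (hc : 2 ≤ c.M / c.B - 1) (hn : 0 < n) (r : ℝ) :
    ∀ fuel k (l : List (ℝ × Slot U)) (p : ℕ) (s : Mem U),
    Reached c t commit n p₀ s₀ l j p s →
    Reached c t commit n p₀ s₀ (l ++ (tombsUpto n f r fuel k).map (tombItem U n f)) j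
      (Graveyard.emitTombs c commit (!t.side) n f r fuel p k s).1.1
      (Graveyard.emitTombs c commit (!t.side) n f r fuel p k s).2 ∧
    (Graveyard.emitTombs c commit (!t.side) n f r fuel p k s).1.2 =
      k + (tombsUpto n f r fuel k).length := by
  intro fuel
  induction fuel with
  | zero =>
    intro k l p s H
    simpa [tombsUpto, Graveyard.emitTombs] using H
  | succ fuel ih =>
    intro k l p s H
    unfold tombsUpto Graveyard.emitTombs
    split_ifs with h1
    · obtain ⟨h2, h3⟩ := ih (k + 1) _ _ _ (H.emit hc hn (tombHash n f k) (.tomb (tombHash n f k)))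
      refine ⟨?_, ?_⟩
      · simpa [tombItem] using h2
      · simp only [List.length_cons]
        rw [h3]
        ring
    · simpa using H

/-- The key `u` is taken in step `j` of the scan of the array `A`. -/
def Taken (h : U → ℝ) (cap : ℕ) (A : ℕ → Slot U) (j : ℕ) (u : U) : Prop :=
  A (j % cap) = .key u ∧
    ((j < cap ∧ home cap (h u) ≤ j) ∨ (cap ≤ j ∧ j < cap + home cap (h u)))

open Classical in
/-- A step of a pass, without the memory: the number of the next tombstone and the list of items
so far. -/
noncomputable def scanStep (h : U → ℝ) (cap n f : ℕ) (A : ℕ → Slot U)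
    (st : ℕ × List (ℝ × Slot U)) (j : ℕ) : ℕ × List (ℝ × Slot U) :=
  if hu : ∃ u, Taken h cap A j u then
    (st.1 + (tombsUpto n f (h hu.choose) (f / 2) st.1).length,
      st.2 ++ (tombsUpto n f (h hu.choose) (f / 2) st.1).map (tombItem U n f) ++
        [(h hu.choose, .key hu.choose)])
  else st

lemma scanStep_of_taken {cap : ℕ} {A : ℕ → Slot U} {u : U} (hu : Taken h cap A j u)
    (st : ℕ × List (ℝ × Slot U)) : scanStep h cap n f A st j =
    (st.1 + (tombsUpto n f (h u) (f / 2) st.1).length,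
      st.2 ++ (tombsUpto n f (h u) (f / 2) st.1).map (tombItem U n f) ++ [(h u, .key u)]) := by
  have hex : ∃ u, Taken h cap A j u := ⟨u, hu⟩
  have h1 : hex.choose = u := by
    have h2 := hex.choose_spec.1
    rw [hu.1] at h2
    simpa using h2.symm
  rw [scanStep, dif_pos hex, h1]

lemma scanStep_of_not {cap : ℕ} {A : ℕ → Slot U} (hu : ¬ ∃ u, Taken h cap A j u)
    (st : ℕ × List (ℝ × Slot U)) : scanStep h cap n f A st j = st := by
  rw [scanStep, dif_neg hu]

/-- The number of the next tombstone and the list of items after `j` steps of the scan. -/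
noncomputable def scan (h : U → ℝ) (cap n f : ℕ) (A : ℕ → Slot U) (j : ℕ) :
    ℕ × List (ℝ × Slot U) :=
  (List.range j).foldl (scanStep h cap n f A) (1, [])

lemma scan_succ (h : U → ℝ) (cap n f : ℕ) (A : ℕ → Slot U) (j : ℕ) :
    scan h cap n f A (j + 1) = scanStep h cap n f A (scan h cap n f A j) j := by
  simp [scan, List.range_succ]

lemma Reached.touch (hc : 2 ≤ c.M / c.B - 1) (hcap : 0 < t.cap)
    (H : Reached c t commit n p₀ s₀ l j p s) :
    Reached c t commit n p₀ s₀ l (j + 1) p (s.touch c t.side (j % t.cap)) := by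
  refine ⟨H.pos, H.old, H.new, ?_⟩
  have h1 := H.cost
  have h2 := miss_add_pot_scan hc s t.side hcap (p := j - 1) (q := j) (by omega)
    (β := (!t.side, if commit then (p - 1) % n / c.B else 0)) (by simp)
  rw [touch_transfers, Nat.add_sub_cancel,
    crossings_add t.cap c.B (a := 0) (b := j - 1) (d := j) (by omega) (by omega)]
  omega

/-- The memory-free `scanStep` mirrors the program, which separates the order of the items from the
cost of the pass. -/
lemma Reached.mergeStep (hc : 2 ≤ c.M / c.B - 1) (hn : 0 < n) (hcap : 0 < t.cap)
    {k : ℕ} (H : Reached c t commit n p₀ s₀ l j p s) :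
    let st := Graveyard.mergeStep c h t commit n f ((p, k), s) j
    let st' := scanStep h t.cap n f (s₀.arr t.side) (k, l) j
    st.1.2 = st'.1 ∧ Reached c t commit n p₀ s₀ st'.2 (j + 1) st.1.1 st.2 := by
  intro st st'
  have H' := H.touch hc hcap
  by_cases hu : ∃ u, Taken h t.cap (s₀.arr t.side) j u
  · obtain ⟨u, hu⟩ := hu
    have h1 : st' = _ := scanStep_of_taken hu _
    have h2 := hu.1
    rw [← H.old] at h2
    have h3 : st =
        (((Graveyard.emit c commit (!t.side) n (h u) (.key u)
          (Graveyard.emitTombs c commit (!t.side) n f (h u) (f / 2) p k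
            (s.touch c t.side (j % t.cap))).1.1
          (Graveyard.emitTombs c commit (!t.side) n f (h u) (f / 2) p k
            (s.touch c t.side (j % t.cap))).2).1,
          (Graveyard.emitTombs c commit (!t.side) n f (h u) (f / 2) p k
            (s.touch c t.side (j % t.cap))).1.2),
        (Graveyard.emit c commit (!t.side) n (h u) (.key u)
          (Graveyard.emitTombs c commit (!t.side) n f (h u) (f / 2) p k
            (s.touch c t.side (j % t.cap))).1.1
          (Graveyard.emitTombs c commit (!t.side) n f (h u) (f / 2) p k
            (s.touch c t.side (j % t.cap))).2).2) := by
      simp only [st, Graveyard.mergeStep, Mem.read, h2]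
      rw [if_pos hu.2]
    obtain ⟨h4, h5⟩ := H'.emitTombs (f := f) hc hn (h u) (f / 2) k _ _ _
    have h6 := h4.emit hc hn (h u) (.key u)
    rw [h1, h3]
    exact ⟨h5, h6⟩
  · have h1 : st' = _ := scanStep_of_not hu _
    have h3 : st = ((p, k), s.touch c t.side (j % t.cap)) := by
      simp only [st, Graveyard.mergeStep, Mem.read]
      split
      · rename_i u hv
        rw [if_neg]
        intro h4
        exact hu ⟨u, by rw [← H.old]; exact hv, h4⟩
      · rfl
    rw [h1, h3]
    exact ⟨rfl, H'⟩

lemma reached_foldl (hc : 2 ≤ c.M / c.B - 1) (hn : 0 < n) (h : U → ℝ) (commit : Bool) (f p₀ : ℕ)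
    (s₀ : Mem U) : ∀ j, j ≤ 2 * t.cap →
    let st := (List.range j).foldl (Graveyard.mergeStep c h t commit n f) ((p₀, 1), s₀)
    let st' := scan h t.cap n f (s₀.arr t.side) j
    st.1.2 = st'.1 ∧ Reached c t commit n p₀ s₀ st'.2 j st.1.1 st.2 := by
  intro j
  induction j with
  | zero => intro _; exact ⟨rfl, reached_nil _ _ _ _ _ _⟩
  | succ j ih =>
    intro hj
    obtain ⟨h1, h2⟩ := ih (by omega)
    simp only [List.range_succ, List.foldl_append, List.foldl_cons, List.foldl_nil, scan_succ]
    generalize (List.range j).foldl (Graveyard.mergeStep c h t commit n f) ((p₀, 1), s₀) = st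
      at h1 h2
    obtain ⟨⟨p, k⟩, s⟩ := st
    have h3 := h2.mergeStep (f := f) (h := h) (k := k) hc hn (by omega)
    simp only at h1
    subst h1
    exact h3

/-- The list of all items that are moved to the new table. -/
noncomputable def allItems (h : U → ℝ) (cap n f : ℕ) (A : ℕ → Slot U) : List (ℝ × Slot U) :=
  (scan h cap n f A (2 * cap)).2 ++
    (tombsUpto n f 1 (f / 2) (scan h cap n f A (2 * cap)).1).map (tombItem U n f)

/-- The list `allItems` depends neither on `commit` nor on the starting slot, so the dry pass and
the writing pass append the same items. -/
lemma mergePass_reached (hc : 2 ≤ c.M / c.B - 1) (hn : 0 < n) (h : U → ℝ) (commit : Bool)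
    (f p₀ : ℕ) (s₀ : Mem U) :
    Reached c t commit n p₀ s₀ (allItems h t.cap n f (s₀.arr t.side)) (2 * t.cap)
      (mergePass c h t commit n f p₀ s₀).1 (mergePass c h t commit n f p₀ s₀).2 := by
  obtain ⟨h1, h2⟩ := reached_foldl (t := t) hc hn h commit f p₀ s₀ (2 * t.cap) le_rfl
  obtain ⟨h3, -⟩ := h2.emitTombs (f := f) hc hn 1 (f / 2)
    (((List.range (2 * t.cap)).foldl (Graveyard.mergeStep c h t commit n f) ((p₀, 1), s₀)).1.2)
    _ _ _
  rw [h1] at h3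
  rw [← h1] at h3
  unfold allItems
  rw [← h1]
  exact h3

end Graveyard

namespace Graveyard

variable {U : Type*}

/-! ### Tombstone hashes -/

lemma tombHash_lt_tombHash {n f k k' : ℕ} (hf : 0 < f) (h : k < k') :
    tombHash n f k < tombHash n f k' := by
  unfold tombHash
  have h1 : (0 : ℝ) < f := by exact_mod_cast hf
  have h2 : (k : ℝ) < k' := by exact_mod_cast h
  gcongr

lemma tombHash_nonneg {n f k : ℕ} (hf : 0 < f) (hfn : f ≤ n) (hk : 1 ≤ k) : 0 ≤ tombHash n f k := by
  unfold tombHash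
  have h1 : (0 : ℝ) < f := by exact_mod_cast hf
  have h2 : (f : ℝ) ≤ n := by exact_mod_cast hfn
  have h3 : (1 : ℝ) ≤ k := by exact_mod_cast hk
  have h4 : (1 : ℝ) / n ≤ 1 / f := one_div_le_one_div_of_le h1 h2
  have h5 : (1 : ℝ) / f ≤ 2 * k / f := by gcongr; linarith
  linarith

lemma tombHash_lt_one {n f k : ℕ} (hf : 0 < f) (hfn : f ≤ n) (hk : k ≤ f / 2) :
    tombHash n f k < 1 := by
  unfold tombHash
  have h1 : (0 : ℝ) < f := by exact_mod_cast hf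
  have h2 : (0 : ℝ) < n := by exact_mod_cast (by omega : 0 < n)
  have h3 : (2 * k : ℝ) ≤ f := by exact_mod_cast (by omega : 2 * k ≤ f)
  have h4 : 2 * (k : ℝ) / f ≤ 1 := (div_le_one h1).2 h3
  have h5 : 0 < 1 / (n : ℝ) := by positivity
  linarith

/-- With enough fuel the emission stops only because the tombstones are exhausted or the next one
has a hash beyond `r`. -/
lemma tombsUpto_eq (n f : ℕ) (r : ℝ) : ∀ fuel k, f / 2 < k + fuel → k ≤ f / 2 + 1 →
    ∃ m, tombsUpto n f r fuel k = List.range' k m ∧ k + m ≤ f / 2 + 1 ∧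
      (∀ k', k ≤ k' → k' < k + m → tombHash n f k' ≤ r) ∧
      (k + m ≤ f / 2 → r < tombHash n f (k + m)) := by
  intro fuel
  induction fuel with
  | zero => intro k h1 h2; exact ⟨0, rfl, by omega, by omega, by omega⟩
  | succ fuel ih =>
    intro k h1 h2
    unfold tombsUpto
    split_ifs with h3
    · obtain ⟨m, h4, h5, h6, h7⟩ := ih (k + 1) (by omega) (by omega)
      refine ⟨m + 1, by rw [h4, List.range'_succ], by omega, fun k' hk1 hk2 => ?_, fun hk => ?_⟩
      · rcases Nat.eq_or_lt_of_le hk1 with h8 | h8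
        · rw [← h8]; exact h3.2
        · exact h6 k' (by omega) (by omega)
      · have := h7 (by omega)
        rwa [show k + 1 + m = k + (m + 1) by ring] at this
    · refine ⟨0, rfl, by omega, by omega, fun hk => ?_⟩
      by_contra h8
      exact h3 ⟨by omega, not_lt.1 h8⟩

/-! ### The items of a rebuild -/

/-- The list of items after `j` steps of the scan is sorted; it contains the keys taken so far, and
the tombstones up to number `k - 1`. -/
structure ScanInv (h : U → ℝ) (cap n f : ℕ) (A : ℕ → Slot U) (j k : ℕ) (l : List (ℝ × Slot U)) :
    Prop where
  one_le : 1 ≤ k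
  le : k ≤ f / 2 + 1
  sorted : l.Pairwise (fun e e' => e.1 < e'.1)
  mem : ∀ e, e ∈ l ↔ (∃ u, e = (h u, .key u) ∧ ∃ i, i < j ∧ Taken h cap A i u) ∨
    ∃ k', 1 ≤ k' ∧ k' < k ∧ e = tombItem U n f k'
  next : k ≤ f / 2 → ∀ e ∈ l, e.1 < tombHash n f k

variable {h : U → ℝ} {cap n f : ℕ} {A : ℕ → Slot U}

lemma ScanInv.tombs {j k : ℕ} {l : List (ℝ × Slot U)} (H : ScanInv h cap n f A j k l) (hf : 0 < f)
    (r : ℝ) : ∃ m, (tombsUpto n f r (f / 2) k).length = m ∧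
      ScanInv h cap n f A j (k + m) (l ++ (tombsUpto n f r (f / 2) k).map (tombItem U n f)) ∧
      (∀ k', k ≤ k' → k' < k + m → tombHash n f k' ≤ r) ∧
      (k + m ≤ f / 2 → r < tombHash n f (k + m)) := by
  have hle := H.le
  have hone := H.one_le
  obtain ⟨m, h1, h2, h3, h4⟩ := tombsUpto_eq n f r (f / 2) k (by omega) hle
  refine ⟨m, by rw [h1]; simp, ⟨by omega, h2, ?_, fun e => ?_, fun hk e he => ?_⟩, h3, h4⟩
  · rw [h1, List.pairwise_append]
    refine ⟨H.sorted, ?_, ?_⟩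
    · rw [List.pairwise_map]
      refine (List.pairwise_lt_range').imp ?_
      intro a b hab
      exact tombHash_lt_tombHash hf hab
    · intro e he e' he'
      obtain ⟨k', hk', rfl⟩ := List.mem_map.1 he'
      have hk' := List.mem_range'_1.1 hk'
      have h5 := H.next (by omega) e he
      rcases Nat.eq_or_lt_of_le hk'.1 with h6 | h6
      · rw [← h6]; exact h5
      · exact h5.trans (tombHash_lt_tombHash hf h6)
  · rw [List.mem_append, H.mem, h1, or_assoc]
    refine or_congr_right ?_
    rw [List.mem_map]
    constructor
    · rintro (⟨k', h5, h6, rfl⟩ | ⟨k', h5, rfl⟩)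
      · exact ⟨k', h5, by omega, rfl⟩
      · have := List.mem_range'_1.1 h5
        exact ⟨k', by omega, by omega, rfl⟩
    · rintro ⟨k', h5, h6, rfl⟩
      by_cases h7 : k' < k
      · exact Or.inl ⟨k', h5, h7, rfl⟩
      · exact Or.inr ⟨k', List.mem_range'_1.2 (by omega), rfl⟩
  · rw [h1] at he
    rcases List.mem_append.1 he with h5 | h5
    · have h6 := H.next (by omega) e h5
      rcases Nat.eq_zero_or_pos m with h7 | h7
      · simpa [h7] using h6
      · exact h6.trans (tombHash_lt_tombHash hf (by omega))
    · obtain ⟨k', hk', rfl⟩ := List.mem_map.1 h5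
      have hk' := List.mem_range'_1.1 hk'
      exact tombHash_lt_tombHash hf hk'.2

/-- The second conjunct is what makes the induction work: every item so far lies at or below a key
already taken, hence strictly below the next key. Ties with tombstones are excluded by `hne`. -/
lemma scanInv (hf : 0 < f)
    (hsort : ∀ i j u v, i < j → j < 2 * cap → Taken h cap A i u → Taken h cap A j v → h u < h v)
    (hne : ∀ i u k, Taken h cap A i u → h u ≠ tombHash n f k) : ∀ j, j ≤ 2 * cap →
    ScanInv h cap n f A j (scan h cap n f A j).1 (scan h cap n f A j).2 ∧
      ∀ e ∈ (scan h cap n f A j).2, ∃ u i, i < j ∧ Taken h cap A i u ∧ e.1 ≤ h u := by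
  intro j
  induction j with
  | zero =>
    intro _
    refine ⟨⟨le_rfl, by simp [scan], List.Pairwise.nil, fun e => ?_, fun _ e he => ?_⟩,
      fun e he => ?_⟩
    · simp only [scan, List.range_zero, List.foldl_nil, List.not_mem_nil, false_iff]
      rintro (⟨u, -, i, hi, -⟩ | ⟨k', h1, h2, -⟩) <;> omega
    · simp [scan] at he
    · simp [scan] at he
  | succ j ih =>
    intro hj
    obtain ⟨H, Hb⟩ := ih (by omega)
    rw [scan_succ]
    set st := scan h cap n f A j
    by_cases hu : ∃ u, Taken h cap A j u
    · obtain ⟨u, hu⟩ := hu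
      rw [scanStep_of_taken hu]
      obtain ⟨m, h1, H', h2, h3⟩ := H.tombs hf (h u)
      simp only
      rw [h1]
      set T := (tombsUpto n f (h u) (f / 2) st.1).map (tombItem U n f) with hT
      have hltu : ∀ e ∈ st.2 ++ T, e.1 < h u := by
        intro e he
        rcases List.mem_append.1 he with h4 | h4
        · obtain ⟨v, i, h5, h6, h7⟩ := Hb e h4
          exact h7.trans_lt (hsort i j v u h5 (by omega) h6 hu)
        · obtain ⟨m', h5, h6, h7, -⟩ := tombsUpto_eq n f (h u) (f / 2) st.1
            (by have := H.one_le; omega) H.le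
          have : m' = m := by rw [← h1, h5]; simp
          subst this
          rw [hT, h5] at h4
          obtain ⟨k', hk', rfl⟩ := List.mem_map.1 h4
          have hk' := List.mem_range'_1.1 hk'
          exact lt_of_le_of_ne (h7 k' hk'.1 hk'.2) (hne j u k' hu).symm
      refine ⟨⟨H'.one_le, H'.le, ?_, fun e => ?_, fun hk e he => ?_⟩, fun e he => ?_⟩
      · rw [List.pairwise_append]
        refine ⟨H'.sorted, List.pairwise_singleton _ _, fun e he e' he' => ?_⟩
        rw [List.mem_singleton.1 he']
        exact hltu e he
      · rw [List.mem_append, H'.mem, List.mem_singleton]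
        constructor
        · rintro ((⟨v, rfl, i, hi, h4⟩ | h4) | rfl)
          · exact Or.inl ⟨v, rfl, i, by omega, h4⟩
          · exact Or.inr h4
          · exact Or.inl ⟨u, rfl, j, by omega, hu⟩
        · rintro (⟨v, rfl, i, hi, h4⟩ | h4)
          · rcases Nat.lt_or_ge i j with h5 | h5
            · exact Or.inl (Or.inl ⟨v, rfl, i, h5, h4⟩)
            · have : i = j := by omega
              subst this
              have h6 := h4.1
              rw [hu.1] at h6
              have : u = v := by simpa using h6
              exact Or.inr (by rw [this])
          · exact Or.inl (Or.inr h4)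
      · rcases List.mem_append.1 he with h4 | h4
        · exact H'.next hk e h4
        · rw [List.mem_singleton.1 h4]
          exact h3 hk
      · refine ⟨u, j, by omega, hu, ?_⟩
        rcases List.mem_append.1 he with h4 | h4
        · exact (hltu e h4).le
        · rw [List.mem_singleton.1 h4]
    · rw [scanStep_of_not hu]
      refine ⟨⟨H.one_le, H.le, H.sorted, fun e => ?_, H.next⟩, fun e he => ?_⟩
      · rw [H.mem]
        refine or_congr_left (exists_congr fun u => and_congr_right fun _ => ?_)
        constructor
        · rintro ⟨i, hi, h1⟩; exact ⟨i, by omega, h1⟩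
        · rintro ⟨i, hi, h1⟩
          refine ⟨i, ?_, h1⟩
          rcases Nat.lt_or_ge i j with h5 | h5
          · exact h5
          · have : i = j := by omega
            subst this
            exact absurd ⟨u, h1⟩ hu
      · obtain ⟨u, i, h1, h2⟩ := Hb e he
        exact ⟨u, i, by omega, h2⟩

lemma allItems_spec (hf : 0 < f) (hfn : f ≤ n) {S : Finset U} (hSn : S.card + f = n)
    (hS : ∀ u, u ∈ S ↔ ∃ i, i < 2 * cap ∧ Taken h cap A i u)
    (h0 : ∀ u ∈ S, 0 ≤ h u) (h1 : ∀ u ∈ S, h u < 1)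
    (hsort : ∀ i j u v, i < j → j < 2 * cap → Taken h cap A i u → Taken h cap A j v → h u < h v)
    (hne : ∀ i u k, Taken h cap A i u → h u ≠ tombHash n f k) :
    Items n h (allItems h cap n f A) ∧ ∀ e, e ∈ allItems h cap n f A ↔
      (∃ u ∈ S, e = (h u, .key u)) ∨ ∃ k, 1 ≤ k ∧ k ≤ f / 2 ∧ e = tombItem U n f k := by
  classical
  obtain ⟨H, -⟩ := scanInv hf hsort hne (2 * cap) le_rfl
  obtain ⟨m, h2, H', h3, h4⟩ := H.tombs hf 1
  -- Tombstone hashes are below `1`, so the final emission with bound `1` exhausts them.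
  have hk : (scan h cap n f A (2 * cap)).1 + m = f / 2 + 1 := by
    by_contra hk
    have h5 := H'.le
    have := h4 (by omega)
    have := tombHash_lt_one hf hfn (k := (scan h cap n f A (2 * cap)).1 + m) (by omega)
    linarith
  have hmem : ∀ e, e ∈ allItems h cap n f A ↔
      (∃ u ∈ S, e = (h u, .key u)) ∨ ∃ k, 1 ≤ k ∧ k ≤ f / 2 ∧ e = tombItem U n f k := by
    intro e
    unfold allItems
    rw [H'.mem, hk]
    refine or_congr ?_ ?_
    · constructor
      · rintro ⟨u, rfl, i, h5⟩; exact ⟨u, (hS u).2 ⟨i, h5⟩, rfl⟩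
      · rintro ⟨u, hu, rfl⟩
        exact ⟨u, rfl, (hS u).1 hu⟩
    · refine exists_congr fun k => and_congr_right fun _ => and_congr_left fun _ => ?_
      omega
  refine ⟨⟨H'.sorted, ?_, ?_, ?_, ?_⟩, hmem⟩
  · intro e he
    rcases (hmem e).1 he with ⟨u, hu, rfl⟩ | ⟨k, hk1, hk2, rfl⟩
    · exact h0 u hu
    · exact tombHash_nonneg hf hfn hk1
  · intro e he
    rcases (hmem e).1 he with ⟨u, hu, rfl⟩ | ⟨k, hk1, hk2, rfl⟩
    · exact h1 u hu
    · exact tombHash_lt_one hf hfn hk2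
  · intro e he
    rcases (hmem e).1 he with ⟨u, hu, rfl⟩ | ⟨k, hk1, hk2, rfl⟩ <;> rfl
  · have hnd : ((allItems h cap n f A).map Prod.fst).Nodup := by
      rw [List.Nodup, List.pairwise_map]
      exact H'.sorted.imp (fun h => ne_of_lt h)
    have h5 := List.toFinset_card_of_nodup hnd
    rw [List.length_map] at h5
    rw [← h5]
    calc _ ≤ (S.image h ∪ (Finset.Icc 1 (f / 2)).image (tombHash n f)).card := by
          apply Finset.card_le_card
          intro r hr
          rw [List.mem_toFinset, List.mem_map] at hr
          obtain ⟨e, he, rfl⟩ := hr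
          rw [Finset.mem_union, Finset.mem_image, Finset.mem_image]
          rcases (hmem e).1 he with ⟨u, hu, rfl⟩ | ⟨k, hk1, hk2, rfl⟩
          · exact Or.inl ⟨u, hu, rfl⟩
          · exact Or.inr ⟨k, Finset.mem_Icc.2 ⟨hk1, hk2⟩, rfl⟩
      _ ≤ (S.image h).card + ((Finset.Icc 1 (f / 2)).image (tombHash n f)).card :=
        Finset.card_union_le _ _
      _ ≤ S.card + f / 2 := by
        refine add_le_add Finset.card_image_le (Finset.card_image_le.trans ?_)
        simp
      _ < n := by omega

/-! ### The scan of an ordered table -/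

lemma Taken.bounds {j : ℕ} {u : U} (hT : Taken h cap A j u) (hh : home cap (h u) < cap) :
    home cap (h u) ≤ j ∧ j < home cap (h u) + cap := by
  obtain ⟨-, h1 | h1⟩ := hT <;> omega

/-- If the home of `v` is at most `i`, then `chain` leads from slot `j` back to slot `i` with
decreasing hashes. Otherwise `u` already has the smaller home slot. -/
lemma OrderedHash.taken_lt (hF : OrderedHash cap (slotHash cap h A)) {i j : ℕ} {u v : U}
    (hij : i < j) (hu : Taken h cap A i u) (hv : Taken h cap A j v) : h u < h v := by
  have hu' : slotHash cap h A i = some (h u) := by rw [slotHash, hu.1]; rfl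
  have hv' : slotHash cap h A j = some (h v) := by rw [slotHash, hv.1]; rfl
  have bu := hu.bounds (hF.home_lt hu')
  have bv := hv.bounds (hF.home_lt hv')
  by_cases h1 : home cap (h v) ≤ i
  · have hd : disp cap j (h v) = j - home cap (h v) := by
      have := disp_home_add (n := cap) (i := j - home cap (h v)) (r := h v) (by omega)
      rwa [show home cap (h v) + (j - home cap (h v)) = j by omega] at this
    obtain ⟨r, hr, -, h2⟩ := hF.chain hv' (j - i) (by omega) (by omega)
    rw [show j - (j - i) = i by omega] at hr h2
    rw [hu'] at hr
    have : h u = r := by simpa using hr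
    subst this
    have h3 := h2 (by omega)
    rw [realDisp_eq_sub (hF.nonneg _ _ hu') bu.1 bu.2,
      realDisp_eq_sub (hF.nonneg _ _ hv') bv.1 bv.2, Nat.cast_sub hij.le] at h3
    have hn : (0 : ℝ) < cap := by exact_mod_cast hF.pos
    by_contra hcon
    have := mul_le_mul_of_nonneg_left (not_lt.1 hcon) hn.le
    linarith
  · by_contra hcon
    have := home_mono (n := cap) (not_lt.1 hcon)
    omega

lemma OrderedHash.exists_taken (hF : OrderedHash cap (slotHash cap h A)) (u : U) :
    (∃ i, A (i % cap) = .key u) ↔ ∃ i, i < 2 * cap ∧ Taken h cap A i u := by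
  have hn := hF.pos
  constructor
  · rintro ⟨i, hi⟩
    have hlt := Nat.mod_lt i hn
    by_cases h1 : home cap (h u) ≤ i % cap
    · exact ⟨i % cap, by omega, by simpa using hi, Or.inl ⟨hlt, h1⟩⟩
    · exact ⟨i % cap + cap, by omega, by simpa using hi, Or.inr ⟨by omega, by omega⟩⟩
  · rintro ⟨i, -, hi, -⟩
    exact ⟨i, hi⟩

/-! ### Rebuilds -/

lemma newCap_pos {c : Config} (hL : 1 ≤ c.L) (m : ℕ) : 0 < newCap c m :=
  lt_of_lt_of_le hL (le_max_left _ _)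

lemma lt_newCap {c : Config} (hL : 1 ≤ c.L) (hx : 1 ≤ c.x) (m : ℕ) : m < newCap c m := by
  rcases Nat.eq_zero_or_pos m with h | h
  · subst h; exact newCap_pos hL 0
  · refine lt_of_lt_of_le ?_ (le_max_right _ _)
    have : 0 < ⌈(m : ℝ) / c.x⌉₊ := by
      rw [Nat.ceil_pos]
      have : (0 : ℝ) < m := by exact_mod_cast h
      positivity
    omega

/-- The outcome of a rebuild. -/
structure RebuildSpec (c : Config) (h : U → ℝ) (t : Table) (S : Finset U) (s : Mem U)
    (res : Table × Mem U) : Prop where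
  cap : res.1.cap = newCap c S.card
  keys : res.1.keys = S.card
  left : res.1.left = max 1 ((newCap c S.card - S.card) / 4)
  ordered : OrderedHash res.1.cap (slotHash res.1.cap h (res.2.arr res.1.side))
  key_iff : ∀ u, (∃ i, res.2.arr res.1.side (i % res.1.cap) = .key u) ↔ u ∈ S
  tomb_iff : ∀ r, (∃ i, res.2.arr res.1.side (i % res.1.cap) = .tomb r) ↔
    ∃ k, 1 ≤ k ∧ k ≤ (newCap c S.card - S.card) / 2 ∧
      r = tombHash (newCap c S.card) (newCap c S.card - S.card) k
  cost : res.2.transfers ≤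
    s.transfers + 8 * (t.cap / c.B) + 3 * (newCap c S.card / c.B) + 16

lemma rebuild_spec {c : Config} (hc : 2 ≤ c.M / c.B - 1) (hL : 1 ≤ c.L) (hx : 1 ≤ c.x)
    {t : Table} {s : Mem U} {S : Finset U} (hcard : t.keys = S.card)
    (hS : ∀ u, u ∈ S ↔ ∃ i, i < 2 * t.cap ∧ Taken h t.cap (s.arr t.side) i u)
    (h0 : ∀ u ∈ S, 0 ≤ h u) (h1 : ∀ u ∈ S, h u < 1)
    (hsort : ∀ i j u v, i < j → Taken h t.cap (s.arr t.side) i u →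
      Taken h t.cap (s.arr t.side) j v → h u < h v)
    (hne : ∀ u ∈ S, ∀ n f k, h u ≠ tombHash n f k) :
    RebuildSpec c h t S s (rebuild c h t s) := by
  set n := newCap c S.card with hn
  set f := n - S.card with hf
  have hnpos : 0 < n := newCap_pos hL _
  have hlt : S.card < n := lt_newCap hL hx _
  set A := s.arr t.side with hA
  -- A key taken at an index of at least `2 * t.cap` would have its home outside the table. It would
  -- also be taken within the first two rounds, so `hS` puts it into `S`, where hashes are below
  -- `1`. A table without slots has nothing to take.
  have hTlt : ∀ i u, Taken h t.cap A i u → i < 2 * t.cap := by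
    rintro i u ⟨hAi, h3 | h3⟩
    · omega
    · by_contra hcon
      rcases Nat.eq_zero_or_pos t.cap with h4 | h4
      · have h5 : home t.cap (h u) = 0 := by simp [h4, home]
        omega
      · have hu : u ∈ S ∨ ¬ u ∈ S := em _
        rcases hu with hu | hu
        · have := home_lt (h0 u hu) (h1 u hu) h4
          omega
        · have h6 : i ≥ 2 * t.cap := by omega
          have h7 : ¬ home t.cap (h u) ≤ i % t.cap := by
            intro h8
            exact hu ((hS u).2 ⟨i % t.cap, by have := Nat.mod_lt i h4; omega, by
              refine ⟨by simpa using hAi, Or.inl ⟨Nat.mod_lt i h4, h8⟩⟩⟩)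
          exact hu ((hS u).2 ⟨i % t.cap + t.cap, by have := Nat.mod_lt i h4; omega, by
              refine ⟨by simpa using hAi, Or.inr ⟨by omega, by omega⟩⟩⟩)
  obtain ⟨hI, hmem⟩ := allItems_spec (h := h) (cap := t.cap) (n := n) (f := f) (A := A) (S := S)
    (by omega) (by omega) (by omega) hS h0 h1
    (fun i j u v hij _ => hsort i j u v hij)
    (fun i u k hT => hne u ((hS u).2 ⟨i, hTlt i u hT, hT⟩) n f k)
  have R1 := mergePass_reached (t := t) hc hnpos h false f 0 s
  set r1 := mergePass c h t false n f 0 s with hr1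
  obtain ⟨C1, C2, C3⟩ := clear_spec (c := c) (by omega) (!t.side) hnpos r1.2
  set s2 := clear c (!t.side) n r1.2 with hs2
  rw [Bool.not_not] at C2
  have hA2 : s2.arr t.side = A := C2.trans R1.old
  have R2 := mergePass_reached (t := t) hc hnpos h true f (r1.1 - n) s2
  set r2 := mergePass c h t true n f (r1.1 - n) s2 with hr2
  rw [hA2] at R2
  have ho : r1.1 - n = endPos n (allItems h t.cap n f A) 0 - n := by rw [R1.pos]
  obtain ⟨L1, L2, L3⟩ := hI.layout_spec ho (A := s2.arr (!t.side)) C3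
  have hnew : r2.2.arr (!t.side) = _ := R2.new
  rw [if_pos rfl] at hnew
  have hres : rebuild c h t s =
      ({ side := !t.side, cap := n, keys := t.keys, left := max 1 (f / 4) }, r2.2) := by
    unfold rebuild
    simp only [hcard]
    rfl
  rw [hres]
  refine ⟨rfl, hcard, rfl, ?_, fun u => ?_, fun r => ?_, ?_⟩
  · simp only [hnew]
    exact L1
  · simp only [hnew]
    rw [L2 _ (by simp)]
    constructor
    · rintro ⟨e, he, h3⟩
      rcases (hmem e).1 he with ⟨v, hv, rfl⟩ | ⟨k, -, -, rfl⟩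
      · have : v = u := by simpa using h3
        rwa [← this]
      · simp [tombItem] at h3
    · intro hu
      exact ⟨_, (hmem _).2 (Or.inl ⟨u, hu, rfl⟩), rfl⟩
  · simp only [hnew]
    rw [L2 _ (by simp)]
    constructor
    · rintro ⟨e, he, h3⟩
      rcases (hmem e).1 he with ⟨v, hv, rfl⟩ | ⟨k, hk1, hk2, rfl⟩
      · simp at h3
      · exact ⟨k, hk1, hk2, by simpa [tombItem, eq_comm] using h3⟩
    · rintro ⟨k, hk1, hk2, rfl⟩
      exact ⟨_, (hmem _).2 (Or.inr ⟨k, hk1, hk2, rfl⟩), rfl⟩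
  -- Each pass crosses at most `2 * (t.cap / c.B + 1)` boundaries of the old table, at two transfers
  -- each, plus `2` for the initial potential. Clearing costs `n / c.B + 2`, and writing `2 * (n /
  -- c.B + 1)`.
  · change r2.2.transfers ≤ s.transfers + 8 * (t.cap / c.B) + 3 * (n / c.B) + 16
    have D1 := R1.cost
    have D2 := R2.cost
    simp only [if_true] at D1 D2
    have h2 : crossings t.cap c.B 0 (2 * t.cap - 1) ≤ 2 * (t.cap / c.B + 1) := by
      have e1 := crossings_mono t.cap c.B (a := 0) (a' := 0) (b := 2 * t.cap - 1)
        (b' := t.cap + t.cap) le_rfl (by omega)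
      have e2 := crossings_add t.cap c.B (a := 0) (b := t.cap) (d := t.cap + t.cap) (by omega)
        (by omega)
      have e3 := crossings_period t.cap c.B 0
      have e4 := crossings_period t.cap c.B t.cap
      rw [zero_add] at e3
      omega
    have h3 : crossings n c.B (r1.1 - n - 1) (r2.1 - 1) ≤ n / c.B + 1 := by
      have hp : r2.1 ≤ n + (r1.1 - n) := by
        rw [R2.pos]
        rwa [layout_fst] at L3
      refine le_trans (crossings_mono n c.B le_rfl ?_) (crossings_period n c.B (r1.1 - n - 1))
      omega
    simp only [Bool.false_eq_true, if_false] at D1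
    omega

end Graveyard

namespace Graveyard

variable {U : Type*}

/-! ### The density of the tombstones -/

lemma disp_eq_ite {n c : ℕ} (hc : c < n) {r : ℝ} (hr : home n r < n) :
    disp n c r = if home n r ≤ c then c - home n r else c + n - home n r := by
  unfold disp
  split_ifs with h
  · rw [show c + n - home n r = c - home n r + n by omega, Nat.add_mod_right,
      Nat.mod_eq_of_lt (by omega)]
  · rw [Nat.mod_eq_of_lt (by omega)]

/-- The exact position of tombstone `k` is `k / ρ - 1` with `ρ = f / (2 * n)`. The extra disjunct is
for `T = 0`, where no home slot is smaller than `T`; it is empty for `k ≥ 1`, as `ρ ≤ 1/2`. -/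
lemma home_tombHash_lt_iff {n f k T : ℕ} (hf : 0 < f) (hfn : f ≤ n) :
    home n (tombHash n f k) < T ∨ T = 0 ∧ (k : ℝ) < f / (2 * n) ↔
      (k : ℝ) < (T + 1) * (f / (2 * n)) := by
  have h1 : (0 : ℝ) < f := by exact_mod_cast hf
  have h2 : (0 : ℝ) < n := by exact_mod_cast (by omega : 0 < n)
  rcases Nat.eq_zero_or_pos T with hT | hT
  · subst hT; simp
  have h3 : (n : ℝ) * tombHash n f k = k / (f / (2 * n)) - 1 := by
    unfold tombHash
    field_simp
  have h4 : home n (tombHash n f k) < T ↔ (k : ℝ) < (T + 1) * (f / (2 * n)) := by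
    unfold home
    rw [Nat.floor_lt' hT.ne', h3, sub_lt_iff_lt_add, div_lt_iff₀ (by positivity)]
  rw [h4]
  constructor
  · rintro (h | ⟨h, -⟩)
    · exact h
    · omega
  · exact Or.inl

/-- The count is that of the integers `1 ≤ k < (T + 1) * ρ`. Cutting off at `f / 2` does not spoil
the error of `1`, since `(T + 1) * ρ ≤ f / 2 + ρ` and `ρ ≤ 1/2`. -/
lemma card_home_lt {n f : ℕ} (hf : 0 < f) (hfn : f ≤ n) {T : ℕ} (hT : T ≤ n) :
    (T + 1) * ((f : ℝ) / (2 * n)) - 1 ≤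
      ((Finset.Icc 1 (f / 2)).filter (fun k => home n (tombHash n f k) < T)).card ∧
    (((Finset.Icc 1 (f / 2)).filter (fun k => home n (tombHash n f k) < T)).card : ℝ) ≤
      (T + 1) * ((f : ℝ) / (2 * n)) := by
  have h1 : (0 : ℝ) < f := by exact_mod_cast hf
  have h2 : (f : ℝ) ≤ n := by exact_mod_cast hfn
  have h3 : (0 : ℝ) < n := h1.trans_le h2
  have h4 : (T : ℝ) ≤ n := by exact_mod_cast hT
  set ρ : ℝ := f / (2 * n) with hρ
  have hρ0 : 0 < ρ := by positivity
  have hρ1 : ρ ≤ 1 / 2 := by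
    rw [hρ, div_le_iff₀ (by positivity)]
    linarith
  have hρn : n * ρ = f / 2 := by
    rw [hρ]; field_simp
  rcases Nat.eq_zero_or_pos T with hT0 | hT0
  · subst hT0
    simp only [not_lt_zero, Finset.filter_false, Finset.card_empty, Nat.cast_zero, zero_add,
      one_mul]
    constructor <;> linarith
  have hiff : ∀ k, home n (tombHash n f k) < T ↔ (k : ℝ) < (T + 1) * ρ := by
    intro k
    rw [← home_tombHash_lt_iff hf hfn]
    constructor
    · exact Or.inl
    · rintro (h | ⟨h, -⟩)
      · exact h
      · omega
  simp only [hiff]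
  have hx0 : 0 ≤ (T + 1) * ρ := by positivity
  constructor
  · set m := min (f / 2) (⌈(T + 1) * ρ⌉₊ - 1) with hm
    have hsub : Finset.Icc 1 m ⊆
        (Finset.Icc 1 (f / 2)).filter (fun k : ℕ => (k : ℝ) < (T + 1) * ρ) := by
      intro k hk
      have hk := Finset.mem_Icc.1 hk
      rw [Finset.mem_filter, Finset.mem_Icc]
      refine ⟨by omega, ?_⟩
      rw [← Nat.lt_ceil]
      omega
    have hcard := Finset.card_le_card hsub
    rw [Nat.card_Icc, Nat.add_sub_cancel] at hcard
    refine le_trans ?_ (Nat.cast_le.2 hcard)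
    have hc1 : (T + 1) * ρ ≤ ⌈(T + 1) * ρ⌉₊ := Nat.le_ceil _
    rcases min_choice (f / 2) (⌈(T + 1) * ρ⌉₊ - 1) with hm' | hm'
    · rw [hm, hm']
      have h5 : (f : ℝ) ≤ 2 * (f / 2 : ℕ) + 1 := by exact_mod_cast (by omega : f ≤ 2 * (f / 2) + 1)
      have h6 : (T + 1) * ρ ≤ n * ρ + ρ := by nlinarith
      linarith
    · rw [hm, hm']
      have h5 : ((⌈(T + 1) * ρ⌉₊ : ℕ) : ℝ) ≤ ((⌈(T + 1) * ρ⌉₊ - 1 : ℕ) : ℝ) + 1 := by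
        exact_mod_cast (by omega : ⌈(T + 1) * ρ⌉₊ ≤ ⌈(T + 1) * ρ⌉₊ - 1 + 1)
      linarith
  · have hsub : (Finset.Icc 1 (f / 2)).filter (fun k : ℕ => (k : ℝ) < (T + 1) * ρ) ⊆
        Finset.Icc 1 ⌊(T + 1) * ρ⌋₊ := by
      intro k hk
      rw [Finset.mem_filter, Finset.mem_Icc] at hk
      rw [Finset.mem_Icc]
      exact ⟨hk.1.1, Nat.le_floor hk.2.le⟩
    have hcard := Finset.card_le_card hsub
    rw [Nat.card_Icc, Nat.add_sub_cancel] at hcard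
    exact (Nat.cast_le.2 hcard).trans (Nat.floor_le hx0)

/-- A window of `j` slots contains the homes of `j * f / (2 * n)` tombstones, up to a constant. -/
lemma card_tombs_window {n f : ℕ} (hf : 0 < f) (hfn : f ≤ n) (c : ℕ) {j : ℕ} (hj : j ≤ n) :
    j * ((f : ℝ) / (2 * n)) - 2 ≤
      ((Finset.Icc 1 (f / 2)).filter (fun k => disp n c (tombHash n f k) < j)).card ∧
    (((Finset.Icc 1 (f / 2)).filter (fun k => disp n c (tombHash n f k) < j)).card : ℝ) ≤
      j * ((f : ℝ) / (2 * n)) + 2 := by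
  have hn : 0 < n := by omega
  have hhome : ∀ k ∈ Finset.Icc 1 (f / 2), home n (tombHash n f k) < n := fun k hk => by
    have hk := Finset.mem_Icc.1 hk
    exact home_lt (tombHash_nonneg hf hfn hk.1) (tombHash_lt_one hf hfn hk.2) hn
  wlog hc : c < n generalizing c
  · have h1 := this (c % n) (Nat.mod_lt _ hn)
    have h2 : (Finset.Icc 1 (f / 2)).filter (fun k => disp n (c % n) (tombHash n f k) < j) =
        (Finset.Icc 1 (f / 2)).filter (fun k => disp n c (tombHash n f k) < j) :=
      Finset.filter_congr fun k hk => by rw [disp_mod (hhome k hk)]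
    rwa [h2] at h1
  have h1 : (0 : ℝ) < f := by exact_mod_cast hf
  have h2 : (f : ℝ) ≤ n := by exact_mod_cast hfn
  have h3 : (0 : ℝ) < n := h1.trans_le h2
  set ρ : ℝ := f / (2 * n) with hρ
  have hρ0 : 0 < ρ := by positivity
  have hρ1 : ρ ≤ 1 / 2 := by
    rw [hρ, div_le_iff₀ (by positivity)]
    linarith
  set G : ℕ → Finset ℕ := fun T =>
    (Finset.Icc 1 (f / 2)).filter (fun k => home n (tombHash n f k) < T) with hG
  have hGb : ∀ T, T ≤ n → (T + 1) * ρ - 1 ≤ (G T).card ∧ ((G T).card : ℝ) ≤ (T + 1) * ρ :=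
    fun T hT => card_home_lt hf hfn hT
  have hGmono : ∀ T T', T ≤ T' → G T ⊆ G T' := fun T T' h k hk => by
    simp only [hG, Finset.mem_filter] at hk ⊢
    exact ⟨hk.1, hk.2.trans_le h⟩
  -- A window that reaches back past slot `0` consists of a prefix and a suffix of the table.
  rcases Nat.lt_or_ge (c + 1) j with hjc | hjc
  · have heq : (Finset.Icc 1 (f / 2)).filter (fun k => disp n c (tombHash n f k) < j) =
        G (c + 1) ∪ (G n \ G (n + c + 1 - j)) := by
      ext k
      simp only [hG, Finset.mem_union, Finset.mem_sdiff, Finset.mem_filter]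
      by_cases hk : k ∈ Finset.Icc 1 (f / 2)
      · have := hhome k hk
        rw [disp_eq_ite hc this]
        split_ifs <;> simp only [hk, true_and] <;> omega
      · simp [hk]
    have hdisj : Disjoint (G (c + 1)) (G n \ G (n + c + 1 - j)) := by
      rw [Finset.disjoint_left]
      intro k hk hk'
      exact (Finset.mem_sdiff.1 hk').2 (hGmono _ _ (by omega) hk)
    rw [heq, Finset.card_union_of_disjoint hdisj, Nat.cast_add,
      Finset.cast_card_sdiff (hGmono _ _ (by omega))]
    have g1 := hGb (c + 1) (by omega)
    have g2 := hGb n le_rfl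
    have g3 := hGb (n + c + 1 - j) (by omega)
    rw [Nat.cast_sub (by omega)] at g3
    push_cast at g1 g3
    constructor <;> linarith
  · have heq : (Finset.Icc 1 (f / 2)).filter (fun k => disp n c (tombHash n f k) < j) =
        G (c + 1) \ G (c + 1 - j) := by
      ext k
      simp only [hG, Finset.mem_sdiff, Finset.mem_filter]
      by_cases hk : k ∈ Finset.Icc 1 (f / 2)
      · have := hhome k hk
        rw [disp_eq_ite hc this]
        split_ifs <;> simp only [hk, true_and] <;> omega
      · simp [hk]
    rw [heq, Finset.cast_card_sdiff (hGmono _ _ (by omega))]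
    have g1 := hGb (c + 1) (by omega)
    have g3 := hGb (c + 1 - j) (by omega)
    rw [Nat.cast_sub (by omega)] at g3
    push_cast at g1 g3
    constructor <;> linarith

/-! ### Changing the point of reference -/

lemma disp_add_wrap {n i e : ℕ} {r : ℝ} (hr : home n r < n) (he : e < n)
    (h : n ≤ disp n i r + e) : disp n (i + e) r + n = disp n i r + e := by
  have hd := disp_lt (by omega : 0 < n) i r
  have h1 : disp n (i + e) r = ((i + n - home n r) % n + e) % n := by
    unfold disp
    rw [Nat.mod_add_mod]
    congr 1
    omega
  have h2 : disp n (i + e) r = (disp n i r + e) % n := h1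
  rw [h2, show disp n i r + e = disp n i r + e - n + n by omega, Nat.add_mod_right,
    Nat.mod_eq_of_lt (by omega)]

/-- Moving the point of reference from `q` to `q + e` wraps exactly those displacements that become
smaller than `e`. Under the three inequalities either all of `t`, `r`, `u` wrap or none does, so
their order is the same at both points. -/
lemma realDisp_rotate {n q e : ℕ} {t r u : ℝ} (he : e < n) (ht : home n t < n) (hr : home n r < n)
    (hu : home n u < n) (h1 : realDisp n q t ≤ realDisp n q u)
    (h2 : realDisp n (q + e) t < realDisp n (q + e) r)
    (h3 : realDisp n (q + e) r < realDisp n (q + e) u) :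
    realDisp n q t < realDisp n q r ∧ realDisp n q r < realDisp n q u := by
  have d1 := disp_le_of_realDisp_le h1
  have d2 := disp_le_of_realDisp_le h2.le
  have d3 := disp_le_of_realDisp_le h3.le
  have hn : 0 < n := by omega
  have key : ∀ x, home n x < n → (disp n q x + e < n ∧ disp n (q + e) x = disp n q x + e) ∨
      (n ≤ disp n q x + e ∧ disp n (q + e) x + n = disp n q x + e) := by
    intro x hx
    rcases Nat.lt_or_ge (disp n q x + e) n with h | h
    · exact Or.inl ⟨h, disp_add hx h⟩
    · exact Or.inr ⟨h, disp_add_wrap hx he h⟩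
  have l1 := disp_lt hn q t
  have l2 := disp_lt hn q r
  have l3 := disp_lt hn q u
  unfold realDisp at *
  rcases key t ht with ⟨a1, a2⟩ | ⟨a1, a2⟩ <;> rcases key r hr with ⟨b1, b2⟩ | ⟨b1, b2⟩ <;>
    rcases key u hu with ⟨c1, c2⟩ | ⟨c1, c2⟩ <;> first | (exfalso; omega) | skip
  all_goals
    have a3 : ((disp n (q + e) t : ℕ) : ℝ) + (if disp n q t + e < n then 0 else n : ℕ) =
      disp n q t + e := by
      split_ifs <;> exact_mod_cast (by omega)
    have b3 : ((disp n (q + e) r : ℕ) : ℝ) + (if disp n q r + e < n then 0 else n : ℕ) =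
      disp n q r + e := by
      split_ifs <;> exact_mod_cast (by omega)
    have c3 : ((disp n (q + e) u : ℕ) : ℝ) + (if disp n q u + e < n then 0 else n : ℕ) =
      disp n q u + e := by
      split_ifs <;> exact_mod_cast (by omega)
  · rw [if_pos a1] at a3; rw [if_pos b1] at b3; rw [if_pos c1] at c3
    push_cast at a3 b3 c3
    constructor <;> linarith
  · rw [if_neg (by omega)] at a3; rw [if_neg (by omega)] at b3; rw [if_neg (by omega)] at c3
    constructor <;> linarith

/-! ### Tombstones and insertions -/

section

variable {n : ℕ} {h : U → ℝ} {A A' : ℕ → Slot U} {u : U} {P D : ℕ}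

/-- A tombstone that does not come before `u` is in the slot that is used up by the insertion
of `u`, or in a later one. -/
lemma PlaceSpec.tomb_beyond (hP : PlaceSpec n h u P D A A') (hF : OrderedHash n (slotHash n h A))
    (h0 : 0 ≤ h u) (h1 : h u < 1) {i x : ℕ} {r : ℝ} (hi : i ≤ D) (hx : A (x % n) = .tomb r)
    (hlt : realDisp n (home n (h u) + i) r < realDisp n (home n (h u) + i) (h u)) :
    disp n (home n (h u) + i) r ≤ i ∧ D + disp n (home n (h u) + i) r ≤ i + disp n x r ∧
      slotHash n h A (home n (h u) + n + i + disp n x r - disp n (home n (h u) + i) r) =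
        some r := by
  have hn := hF.pos
  have hDn := hP.lt
  have hxr : slotHash n h A x = some r := by rw [slotHash, hx]; rfl
  have hr := hF.home_lt hxr
  set a := home n (h u) with ha
  have hd := disp_le_of_realDisp_le hlt.le
  rw [disp_home_add (by omega)] at hd
  set d := disp n (a + i) r with hdd
  set e := disp n x r with hee
  have hen : e < n := disp_lt hn _ _
  have hmod : (a + n + i + e - d) % n = x % n := by
    have hsub := disp_sub hr (i := a + n + i) (j := d)
      (by rw [disp_congr hr (j := a + i) (by rw [show a + n + i = a + i + n by ring]; simp)])
      (by omega)
    rw [disp_congr hr (i := a + n + i) (j := a + i)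
      (by rw [show a + n + i = a + i + n by ring]; simp), ← hdd, Nat.sub_self] at hsub
    have h2 := disp_add hr (i := a + n + i - d) (j := e) (by omega)
    rw [show a + n + i - d + e = a + n + i + e - d by omega, hsub, zero_add] at h2
    rw [mod_eq_home_add hr, h2, mod_eq_home_add (i := x) hr]
  have hs : slotHash n h A (a + n + i + e - d) = some r := by rw [hF.congr hmod]; exact hxr
  refine ⟨hd, ?_, hs⟩
  by_contra hcon
  -- The tombstone stands at distance `k` from the home of `u`. If `k < D`, it was examined, and
  -- examined tombstones come before `u`.
  set k := i + e - d with hk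
  have hk1 : (a + k) % n = x % n := by
    rw [← hmod, show a + n + i + e - d = a + k + n by omega]
    simp
  obtain ⟨r', hr', h3⟩ := hP.examined hF h0 h1 (k := k) (by omega)
  rw [← ha] at hr' h3
  rw [hF.congr hk1, hxr] at hr'
  have : r = r' := by simpa using hr'
  subst this
  rw [hk1] at h3
  have h4 := h3 hx
  have hdk : disp n (a + k) r = e := by rw [disp_congr hr hk1]
  have e1 : realDisp n (a + k) r = realDisp n (a + i) r + k - i := by
    unfold realDisp
    rw [hdk, ← hdd]
    have : (k : ℝ) + d = i + e := by exact_mod_cast (by omega : k + d = i + e)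
    linarith
  rw [e1] at h4
  rw [realDisp_home_add (by omega)] at h4 hlt
  linarith

/-- If there is a tombstone with the hash of `u`, then the insertion of `u` uses it up. -/
lemma PlaceSpec.used_of_mem (hP : PlaceSpec n h u P D A A') (hF : OrderedHash n (slotHash n h A))
    (h0 : 0 ≤ h u) (h1 : h u < 1) (hinj : ∀ i w, A (i % n) = .key w → h w ≠ h u)
    {x : ℕ} (hx : slotHash n h A x = some (h u)) :
    slotHash n h A (home n (h u) + D) = some (h u) := by
  have hn := hF.pos
  have hPD := hP.le
  have hDn := hP.lt
  have hr := home_lt h0 h1 hn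
  set i := disp n x (h u) with hi
  have hin : i < n := disp_lt hn _ _
  have hxi : slotHash n h A (home n (h u) + i) = some (h u) := by
    rw [← hx]
    exact hF.congr (mod_eq_home_add hr).symm
  have hPi : P ≤ i := by
    by_contra hcon
    obtain ⟨r, h2, h3⟩ := hP.pass' hF h0 h1 (by omega : i < P)
    rw [hxi] at h2
    have : h u = r := by simpa using h2
    rw [← this] at h3
    exact lt_irrefl _ h3
  -- If the insertion stopped earlier, `chain` would give the item found there a hash smaller than
  -- that of `u`.
  have hPi' : i = P := by
    by_contra hne
    obtain ⟨r, h2, -, h3⟩ := hF.chain hxi (i - P) (by rw [disp_home_add hin]; omega) (by omega)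
    rw [show home n (h u) + i - (i - P) = home n (h u) + P by omega] at h2 h3
    have h4 := hP.position' hF h0 h1 h2
    have h5 := h3 (by omega)
    rw [realDisp_home_add hin, Nat.cast_sub hPi] at h5
    rw [realDisp_home_add (by omega)] at h4
    linarith
  subst hPi'
  rcases Nat.eq_or_lt_of_le hPD with h2 | h2
  · rw [← h2]; exact hxi
  · obtain ⟨w, hw1, hw2⟩ := hP.keys' le_rfl h2
    rw [hxi] at hw2
    have : h u = h w := by simpa using hw2
    exact absurd this.symm (hinj _ _ hw1)

end

/-! ### The state of the table in a rebuild window -/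

/-- The hashes of the keys in `K` are in `[0, 1)` and different, and no tombstone is created with
such a hash. -/
structure GoodHash (h : U → ℝ) (K : Finset U) : Prop where
  nonneg : ∀ u ∈ K, 0 ≤ h u
  lt_one : ∀ u ∈ K, h u < 1
  inj : Set.InjOn h K
  ne_tomb : ∀ u ∈ K, ∀ n f k, h u ≠ tombHash n f k

open Classical in
/-- The state of a table with `n` slots that was rebuilt with `f` slots more than keys. The keys
in `base` were present at the rebuild, those in `ins` have been inserted since then,
and those in `cur` are present now. -/
structure Core (n f : ℕ) (h : U → ℝ) (base ins cur : Finset U) (A : ℕ → Slot U) : Prop where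
  ordered : OrderedHash n (slotHash n h A)
  key_iff : ∀ u, (∃ i, A (i % n) = .key u) ↔ u ∈ cur
  sub : cur ⊆ base ∪ ins
  hash : ∀ r ∈ hashSet n (slotHash n h A), (∃ u ∈ base ∪ ins, r = h u) ∨
    ∃ k ∈ Finset.Icc 1 (f / 2), r = tombHash n f k
  -- The window runs from behind a surviving tombstone to slot `c`, or is the whole table.
  -- Tombstones used up in it are made up for by insertions with hashes in the same window, since an
  -- insertion never passes over a surviving tombstone that it could use.
  balance : ∀ (c : ℕ) (θ : ℝ), (n ≤ θ ∨ ∃ k ∈ Finset.Icc 1 (f / 2),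
      tombHash n f k ∈ hashSet n (slotHash n h A) ∧ θ = realDisp n c (tombHash n f k)) →
    (base.filter (fun v => realDisp n c (h v) < θ)).card +
      ((Finset.Icc 1 (f / 2)).filter (fun k => realDisp n c (tombHash n f k) < θ)).card ≤
    ((hashSet n (slotHash n h A)).filter (fun r => realDisp n c r < θ)).card

section

variable {n f : ℕ} {h : U → ℝ} {base ins cur K : Finset U} {A A' : ℕ → Slot U} {u : U} {P D : ℕ}

open Classical in
lemma Core.card_hashSet_le (H : Core n f h base ins cur A) :
    (hashSet n (slotHash n h A)).card ≤ (base ∪ ins).card + f / 2 := by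
  calc _ ≤ ((base ∪ ins).image h ∪ (Finset.Icc 1 (f / 2)).image (tombHash n f)).card := by
        apply Finset.card_le_card
        intro r hr
        rw [Finset.mem_union, Finset.mem_image, Finset.mem_image]
        rcases H.hash r hr with ⟨u, hu, rfl⟩ | ⟨k, hk, rfl⟩
        · exact Or.inl ⟨u, hu, rfl⟩
        · exact Or.inr ⟨k, hk, rfl⟩
    _ ≤ _ := by
        refine (Finset.card_union_le _ _).trans (add_le_add Finset.card_image_le ?_)
        exact Finset.card_image_le.trans (by simp)

/-- Different slots hold different hashes, so a full table would have `n` of them. -/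
lemma OrderedHash.exists_free {F : ℕ → Option ℝ} (hF : OrderedHash n F)
    (hlt : (hashSet n F).card < n) : ∃ e, F e = none := by
  classical
  by_contra hcon
  push Not at hcon
  have hocc : ∀ i, ∃ r, F i = some r := fun i => Option.ne_none_iff_exists'.1 (hcon i)
  choose g hg using hocc
  have h1 : ((Finset.range n).image g).card = n := by
    rw [Finset.card_image_of_injOn, Finset.card_range]
    intro a ha b hb hab
    have ha' := Finset.mem_range.1 (Finset.mem_coe.1 ha)
    have hb' := Finset.mem_range.1 (Finset.mem_coe.1 hb)
    have h2 := hF.mod_eq_of_hash_eq (hg a) (by rw [hab]; exact hg b)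
    rwa [Nat.mod_eq_of_lt ha', Nat.mod_eq_of_lt hb'] at h2
  have h2 : (Finset.range n).image g ⊆ hashSet n F := by
    intro r hr
    obtain ⟨i, -, rfl⟩ := Finset.mem_image.1 hr
    exact (mem_hashSet hF).2 ⟨i, hg i⟩
  have := Finset.card_le_card h2
  omega

-- The delicate point is `balance`: if the item dropped from slot `D` lies in the window, the hash
-- of `u` has to lie there too, so that the count of hashes does not fall.
open Classical in
lemma Core.insert (H : Core n f h base ins cur A) (hK : GoodHash h K) (hsub : base ∪ ins ⊆ K)
    (hu : u ∈ K) (hcur : u ∉ cur) {e : ℕ} (he : slotHash n h A e = none)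
    (hP : PlaceSpec n h u P D A A') :
    Core n f h base (ins ∪ {u}) (cur ∪ {u}) A' := by
  have hF := H.ordered
  have h0 := hK.nonneg u hu
  have h1 := hK.lt_one u hu
  have hinj : ∀ i w, A (i % n) = .key w → h w ≠ h u := by
    intro i w hw heq
    have hwc := (H.key_iff w).1 ⟨i, hw⟩
    have := hK.inj (hsub (H.sub hwc)) hu heq
    exact hcur (this ▸ hwc)
  have hF' := hP.ordered hF he h0 h1 hinj
  have hmem : ∀ r, r ∈ hashSet n (slotHash n h A') ↔ r = h u ∨
      (r ∈ hashSet n (slotHash n h A) ∧ slotHash n h A (home n (h u) + D) ≠ some r) := by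
    intro r
    rw [mem_hashSet hF', mem_hashSet hF]
    exact hP.hash_iff hF r
  have hhome := home_lt h0 h1 hF.pos
  refine ⟨hF', fun v => ?_, ?_, fun r hr => ?_, fun c θ hθ => ?_⟩
  · rw [hP.key_iff hF.pos, H.key_iff]
    simp
  · intro v hv
    simp only [Finset.mem_union, Finset.mem_singleton] at hv ⊢
    rcases hv with hv | hv
    · have := H.sub hv
      simp only [Finset.mem_union] at this
      tauto
    · tauto
  · rcases (hmem r).1 hr with rfl | ⟨hr', -⟩
    · exact Or.inl ⟨u, by simp, rfl⟩
    · rcases H.hash r hr' with ⟨v, hv, rfl⟩ | h2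
      · refine Or.inl ⟨v, ?_, rfl⟩
        simp only [Finset.mem_union] at hv ⊢
        tauto
      · exact Or.inr h2
  · have hθ' : n ≤ θ ∨ ∃ k ∈ Finset.Icc 1 (f / 2),
      tombHash n f k ∈ hashSet n (slotHash n h A) ∧ θ = realDisp n c (tombHash n f k) := by
      rcases hθ with h2 | ⟨k, hk, h2, h3⟩
      · exact Or.inl h2
      · rcases (hmem _).1 h2 with h4 | ⟨h4, -⟩
        · exact absurd h4.symm (hK.ne_tomb u hu _ _ _)
        · exact Or.inr ⟨k, hk, h4, h3⟩
    refine (H.balance c θ hθ').trans ?_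
    by_cases hq : ∃ t, slotHash n h A (home n (h u) + D) = some t ∧ realDisp n c t < θ
    · obtain ⟨t, ht, htθ⟩ := hq
      have htm : t ∈ hashSet n (slotHash n h A) := (mem_hashSet hF).2 ⟨_, ht⟩
      -- Suppose that `u` comes before the surviving tombstone `r` and the dropped item `t` after
      -- it. By `PlaceSpec.tomb_beyond`, `r` stands in slot `D` or behind it, and `chain` back to
      -- slot `D`, where `t` is, shows that `t` does not come after `r`.
      have huθ : realDisp n c (h u) < θ := by
        rcases hθ with h2 | ⟨k, hk, h2, h3⟩
        · have h4 := realDisp_le n c (h u)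
          have h5 : ((disp n c (h u) : ℕ) : ℝ) < n := by exact_mod_cast disp_lt hF.pos _ _
          linarith
        · by_contra hcon
          rcases (hmem _).1 h2 with h4 | ⟨h4, h5⟩
          · exact absurd h4.symm (hK.ne_tomb u hu _ _ _)
          obtain ⟨x, hx⟩ := (mem_hashSet hF).1 h4
          have hkh := hF.home_lt hx
          have hth := hF.home_lt ht
          set r := tombHash n f k
          have hxt : A (x % n) = .tomb r := by
            rw [slotHash] at hx
            cases hs : A (x % n) with
            | free => rw [hs] at hx; simp [Slot.hash?] at hx
            | key w =>
              rw [hs] at hx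
              have hw := hsub (H.sub ((H.key_iff w).1 ⟨x, hs⟩))
              exact absurd (by simpa [Slot.hash?] using hx) (hK.ne_tomb w hw n f k)
            | tomb r' =>
              rw [hs] at hx
              have : r' = r := by simpa [Slot.hash?] using hx
              rw [this]
          have hne : realDisp n c r ≠ realDisp n c (h u) := by
            intro heq
            exact hK.ne_tomb u hu n f k
              (eq_of_realDisp_eq (hF.nonneg _ _ hx) h0 hkh hhome heq).symm
          obtain ⟨g, hg, hcg⟩ := exists_add_mod hF.pos (home n (h u) + D) c
          have hused := hP.used' hF h0 h1 ht
          have hlt1 : realDisp n c t < realDisp n c r := by rw [← h3]; exact htθ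
          have hlt2 : realDisp n c r < realDisp n c (h u) :=
            lt_of_le_of_ne (by rw [← h3]; exact not_lt.1 hcon) hne
          rw [realDisp_congr hth hcg, realDisp_congr hkh hcg] at hlt1
          rw [realDisp_congr hkh hcg, realDisp_congr hhome hcg] at hlt2
          obtain ⟨hl1, hl2⟩ := realDisp_rotate hg hth hkh hhome hused hlt1 hlt2
          obtain ⟨b1, b2, b3⟩ := hP.tomb_beyond hF h0 h1 le_rfl hxt hl2
          set d := disp n (home n (h u) + D) r with hdd
          set e2 := disp n x r with hee
          have hsl : home n (h u) + n + D + e2 - d = home n (h u) + n + D + (e2 - d) := by omega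
          rw [hsl] at b3
          have hdQ : disp n (home n (h u) + n + D) r = d := disp_congr hkh (by
            rw [show home n (h u) + n + D = home n (h u) + D + n by ring]; simp)
          have hse : disp n (home n (h u) + n + D + (e2 - d)) r = e2 := by
            have he2 := disp_lt hF.pos x r
            rw [disp_add hkh (by omega), hdQ]
            omega
          obtain ⟨t', ht', hle, -⟩ := hF.chain b3 (e2 - d) (by omega) (by omega)
          rw [Nat.add_sub_cancel] at ht' hle
          have hmodQ : (home n (h u) + n + D) % n = (home n (h u) + D) % n := by
            rw [show home n (h u) + n + D = home n (h u) + D + n by ring]; simp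
          rw [hF.congr hmodQ, ht] at ht'
          have : t = t' := by simpa using ht'
          subst this
          have hrd : realDisp n (home n (h u) + n + D + (e2 - d)) r =
              realDisp n (home n (h u) + D) r + (e2 - d : ℕ) := by
            rw [realDisp_add hkh (by
              have he2 := disp_lt hF.pos x r
              omega), realDisp_congr hkh hmodQ]
          rw [hrd, realDisp_congr hth hmodQ] at hle
          linarith
      set X := (hashSet n (slotHash n h A)).filter (fun r => realDisp n c r < θ) with hX
      have htX : t ∈ X := Finset.mem_filter.2 ⟨htm, htθ⟩
      -- A tombstone with the hash of `u` may be left from an earlier deletion of `u`; in that case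
      -- it is exactly the dropped item `t`.
      have huX : h u ∉ X.erase t := by
        intro h2
        rw [Finset.mem_erase, hX, Finset.mem_filter, mem_hashSet hF] at h2
        obtain ⟨h3, ⟨x, hx⟩, -⟩ := h2
        have := hP.used_of_mem hF h0 h1 hinj hx
        rw [ht] at this
        exact h3 (by simpa using this.symm)
      calc X.card = (Insert.insert (h u) (X.erase t)).card := by
            rw [Finset.card_insert_of_notMem huX, Finset.card_erase_add_one htX]
        _ ≤ _ := by
            apply Finset.card_le_card
            intro r hr
            rw [Finset.mem_filter, hmem]
            rcases Finset.mem_insert.1 hr with rfl | h2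
            · exact ⟨Or.inl rfl, huθ⟩
            · rw [Finset.mem_erase, hX, Finset.mem_filter] at h2
              refine ⟨Or.inr ⟨h2.2.1, ?_⟩, h2.2.2⟩
              rw [ht]
              simpa using h2.1.symm
    · push Not at hq
      apply Finset.card_le_card
      intro r hr
      rw [Finset.mem_filter] at hr ⊢
      refine ⟨(hmem r).2 (Or.inr ⟨hr.1, fun h2 => ?_⟩), hr.2⟩
      have := hq r h2
      linarith [hr.2]

-- The tombstone inherits the hash of the key, so the set of hashes, and with it `balance`, is
-- unchanged.
open Classical in
lemma Core.delete (H : Core n f h base ins cur A) {p : ℕ} (hp : p < n) (hu : A p = .key u) :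
    Core n f h base ins (cur.erase u) (Function.update A p (.tomb (h u))) := by
  have hF := H.ordered
  have hsame : slotHash n h (Function.update A p (.tomb (h u))) = slotHash n h A := by
    funext i
    unfold slotHash
    by_cases hi : i % n = p
    · rw [hi, Function.update_self, hu]
      rfl
    · rw [Function.update_of_ne hi]
  refine ⟨hsame ▸ hF, fun v => ?_, (Finset.erase_subset _ _).trans H.sub, hsame ▸ H.hash,
    hsame ▸ H.balance⟩
  rw [Finset.mem_erase, ← H.key_iff]
  constructor
  · rintro ⟨i, hi⟩
    by_cases hip : i % n = p
    · rw [hip, Function.update_self] at hi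
      simp at hi
    · rw [Function.update_of_ne hip] at hi
      refine ⟨?_, i, hi⟩
      rintro rfl
      have h1 : slotHash n h A i = some (h v) := by rw [slotHash, hi]; rfl
      have h2 : slotHash n h A p = some (h v) := by rw [slotHash, Nat.mod_eq_of_lt hp, hu]; rfl
      have := hF.mod_eq_of_hash_eq h1 h2
      rw [Nat.mod_eq_of_lt hp] at this
      exact hip this
  · rintro ⟨hne, i, hi⟩
    refine ⟨i, ?_⟩
    rw [Function.update_of_ne]
    · exact hi
    · intro hip
      rw [hip, hu] at hi
      exact hne (by simpa using hi.symm)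

end

end Graveyard

namespace Graveyard

variable {U : Type*}

-- Right after a rebuild all created tombstones are present, and `balance` holds for every window
-- because the hashes of keys and tombstones are pairwise different.
open Classical in
lemma RebuildSpec.core {c : Config} {h : U → ℝ} {t : Table} {S K : Finset U} {s : Mem U}
    {res : Table × Mem U} (H : RebuildSpec c h t S s res) (hK : GoodHash h K) (hS : S ⊆ K)
    (hlt : S.card < newCap c S.card) :
    Core (newCap c S.card) (newCap c S.card - S.card) h S ∅ S (res.2.arr res.1.side) := by
  have hF := H.ordered
  have hkey := H.key_iff
  have htomb := H.tomb_iff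
  rw [H.cap] at hF hkey htomb
  set n := newCap c S.card
  set f := n - S.card with hf
  set A := res.2.arr res.1.side
  have hmem : ∀ r, r ∈ hashSet n (slotHash n h A) ↔
      (∃ u ∈ S, r = h u) ∨ ∃ k ∈ Finset.Icc 1 (f / 2), r = tombHash n f k := by
    intro r
    rw [mem_hashSet hF]
    constructor
    · rintro ⟨i, hi⟩
      rw [slotHash] at hi
      cases hs : A (i % n) with
      | free => rw [hs] at hi; simp [Slot.hash?] at hi
      | key u =>
        rw [hs] at hi
        exact Or.inl ⟨u, (hkey u).1 ⟨i, hs⟩, by simpa [Slot.hash?, eq_comm] using hi⟩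
      | tomb r' =>
        rw [hs] at hi
        obtain ⟨k, h1, h2, h3⟩ := (htomb r').1 ⟨i, hs⟩
        refine Or.inr ⟨k, Finset.mem_Icc.2 ⟨h1, h2⟩, ?_⟩
        rw [← h3]
        simpa [Slot.hash?, eq_comm] using hi
    · rintro (⟨u, hu, rfl⟩ | ⟨k, hk, rfl⟩)
      · obtain ⟨i, hi⟩ := (hkey u).2 hu
        exact ⟨i, by rw [slotHash, hi]; rfl⟩
      · have hk := Finset.mem_Icc.1 hk
        obtain ⟨i, hi⟩ := (htomb _).2 ⟨k, hk.1, hk.2, rfl⟩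
        exact ⟨i, by rw [slotHash, hi]; rfl⟩
  refine ⟨hF, hkey, by simp, fun r hr => by simpa using (hmem r).1 hr, fun a θ _ => ?_⟩
  have i1 : (S.filter (fun v => realDisp n a (h v) < θ)).card =
      ((S.filter (fun v => realDisp n a (h v) < θ)).image h).card :=
    (Finset.card_image_of_injOn (hK.inj.mono (by
      intro v hv
      exact hS (Finset.mem_filter.1 (Finset.mem_coe.1 hv)).1))).symm
  have i2 : ((Finset.Icc 1 (f / 2)).filter (fun k => realDisp n a (tombHash n f k) < θ)).card =
      (((Finset.Icc 1 (f / 2)).filter (fun k => realDisp n a (tombHash n f k) < θ)).image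
        (tombHash n f)).card := by
    refine (Finset.card_image_of_injOn ?_).symm
    intro k _ k' _ hkk
    by_contra hne
    rcases lt_or_gt_of_ne hne with h1 | h1
    · exact absurd hkk (tombHash_lt_tombHash (by omega) h1).ne
    · exact absurd hkk (tombHash_lt_tombHash (by omega) h1).ne'
  rw [i1, i2, ← Finset.card_union_of_disjoint]
  · apply Finset.card_le_card
    intro r hr
    rw [Finset.mem_filter, hmem]
    rcases Finset.mem_union.1 hr with h1 | h1
    · obtain ⟨u, hu, rfl⟩ := Finset.mem_image.1 h1
      have hu := Finset.mem_filter.1 hu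
      exact ⟨Or.inl ⟨u, hu.1, rfl⟩, hu.2⟩
    · obtain ⟨k, hk, rfl⟩ := Finset.mem_image.1 h1
      have hk := Finset.mem_filter.1 hk
      exact ⟨Or.inr ⟨k, hk.1, rfl⟩, hk.2⟩
  · rw [Finset.disjoint_left]
    intro r h1 h2
    obtain ⟨u, hu, rfl⟩ := Finset.mem_image.1 h1
    obtain ⟨k, hk, h3⟩ := Finset.mem_image.1 h2
    exact hK.ne_tomb u (hS (Finset.mem_filter.1 hu).1) n f k h3.symm

/-! ### The events in which an operation crosses a block boundary -/

open Classical in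
/-- Some window of slots that ends with slot `c` contains the homes of at least `θ` keys of `S` more
than `κ` times the number of its slots. -/
def Excess (n : ℕ) (S : Finset U) (κ : ℝ) (h : U → ℝ) (c : ℕ) (θ : ℝ) : Prop :=
  ∃ j, j < n ∧ θ ≤ ((S.filter (fun v => disp n c (h v) < j)).card : ℝ) - j * κ

lemma Excess.mono {n : ℕ} {S : Finset U} {κ : ℝ} {h : U → ℝ} {c : ℕ} {θ θ' : ℝ}
    (H : Excess n S κ h c θ) (hθ : θ' ≤ θ) : Excess n S κ h c θ' := by
  obtain ⟨j, hj, h1⟩ := H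
  exact ⟨j, hj, hθ.trans h1⟩

lemma Excess.congr {n : ℕ} {S : Finset U} {κ : ℝ} {h : U → ℝ} {c c' : ℕ} {θ : ℝ}
    (H : Excess n S κ h c θ) (hS : ∀ v ∈ S, home n (h v) < n) (hc : c % n = c' % n) :
    Excess n S κ h c' θ := by
  classical
  obtain ⟨j, hj, h1⟩ := H
  refine ⟨j, hj, ?_⟩
  rwa [Finset.filter_congr (q := fun v => disp n c (h v) < j)]
  intro v hv
  rw [disp_congr (hS v hv) hc]

open Classical in
/-- Events, one of which occurs if an operation on the key `u` examines more than `d` slots. -/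
def CrossEvent (n f : ℕ) (base ins : Finset U) (h : U → ℝ) (u : U) (d : ℕ) : Prop :=
  Excess n ((base ∪ ins).erase u) (1 - (f : ℝ) / (2 * n)) h (home n (h u) + d / 2)
    ((d : ℝ) / 2 - 4) ∨
  Excess n ((ins \ base).erase u) (3 / 4 * ((f : ℝ) / (2 * n))) h (home n (h u) + d / 2)
    ((f : ℝ) / (2 * n) * d / 8 - 4)

open Classical in
/-- A bound on the number of block boundaries that an operation on `u` crosses. -/
noncomputable def crossBound (n f B : ℕ) (base ins : Finset U) (h : U → ℝ) (u : U) : ℕ :=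
  ((Finset.Ico 1 n).filter (fun d => (home n (h u) + d) % n % B = 0 ∧
    CrossEvent n f base ins h u d)).card

/-- The boundary between the distances `d - 1` and `d` is charged to `d`. -/
lemma crossings_le_crossBound {n f B : ℕ} {base ins : Finset U} {h : U → ℝ} {u : U} {D : ℕ}
    (hD : D < n) (H : ∀ d, 1 ≤ d → d ≤ D → CrossEvent n f base ins h u d) :
    crossings n B (home n (h u)) (home n (h u) + D) ≤ crossBound n f B base ins h u := by
  classical
  unfold crossings crossBound
  refine Finset.card_le_card_of_injOn (fun i => i + 1 - home n (h u)) ?_ ?_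
  · intro i hi
    simp only [Finset.coe_filter, Finset.mem_Ico, Set.mem_ofPred_eq] at hi ⊢
    refine ⟨by omega, ?_, H _ (by omega) (by omega)⟩
    rw [show home n (h u) + (i + 1 - home n (h u)) = i + 1 by omega]
    exact hi.2
  · intro i hi i' hi' hii
    simp only [Finset.coe_filter, Finset.mem_Ico, Set.mem_ofPred_eq] at hi hi' hii
    omega

section

variable {n f : ℕ} {h : U → ℝ} {base ins cur K : Finset U} {A A' : ℕ → Slot U} {u : U} {P D : ℕ}

lemma card_le_card_erase_add_one [DecidableEq U] (S : Finset U) (u : U) (p : U → Prop)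
    [DecidablePred p] :
    (S.filter p).card ≤ ((S.erase u).filter p).card + 1 := by
  rw [Finset.filter_erase]
  have := Finset.pred_card_le_card_erase (s := S.filter p) (a := u)
  omega

-- The items of the overfull window are keys or created tombstones. Its `j` slots contain at most `j
-- * f / (2 * n) + 2` homes of tombstones, and leaving out `u` costs one more, which explains the
-- loss of `3`.
open Classical in
lemma Core.excess_of_overflow (H : Core n f h base ins cur A) (hf : 0 < f) (hfn : f ≤ n) {x : ℕ}
    (hx : slotHash n h A x = none) {s e : ℕ} {r : ℝ} (hs : slotHash n h A s = some r)
    (he : e ≤ disp n s r) (hns : n ≤ s) (u : U) :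
    Excess n ((base ∪ ins).erase u) (1 - (f : ℝ) / (2 * n)) h (s - e) ((e : ℝ) - 3) := by
  obtain ⟨j, -, hjn, hj⟩ := H.ordered.exists_window hs hx he hns
  refine ⟨j, hjn, ?_⟩
  have h1 : ((hashSet n (slotHash n h A)).filter (fun r => disp n (s - e) r < j)).card ≤
      (((base ∪ ins).filter (fun v => disp n (s - e) (h v) < j))).card +
      ((Finset.Icc 1 (f / 2)).filter (fun k => disp n (s - e) (tombHash n f k) < j)).card := by
    calc _ ≤ ((((base ∪ ins).filter (fun v => disp n (s - e) (h v) < j))).image h ∪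
        ((Finset.Icc 1 (f / 2)).filter (fun k => disp n (s - e) (tombHash n f k) < j)).image
          (tombHash n f)).card := by
          apply Finset.card_le_card
          intro r hr
          rw [Finset.mem_filter] at hr
          rw [Finset.mem_union, Finset.mem_image, Finset.mem_image]
          rcases H.hash r hr.1 with ⟨v, hv, rfl⟩ | ⟨k, hk, rfl⟩
          · exact Or.inl ⟨v, Finset.mem_filter.2 ⟨hv, hr.2⟩, rfl⟩
          · exact Or.inr ⟨k, Finset.mem_filter.2 ⟨hk, hr.2⟩, rfl⟩
      _ ≤ _ := (Finset.card_union_le _ _).trans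
        (add_le_add Finset.card_image_le Finset.card_image_le)
  have h2 := card_le_card_erase_add_one (base ∪ ins) u (fun v => disp n (s - e) (h v) < j)
  have h3 := (card_tombs_window hf hfn (s - e) hjn.le).2
  have h4 : ((j + e : ℕ) : ℝ) ≤ (((((base ∪ ins).erase u).filter
      (fun v => disp n (s - e) (h v) < j)).card + 1 +
      ((Finset.Icc 1 (f / 2)).filter (fun k => disp n (s - e) (tombHash n f k) < j)).card : ℕ) : ℝ) := by
    exact_mod_cast (by omega)
  push_cast at h4
  linarith

lemma GoodHash.home_lt (hK : GoodHash h K) (hn : 0 < n) {v : U} (hv : v ∈ K) :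
    home n (h v) < n := Graveyard.home_lt (hK.nonneg v hv) (hK.lt_one v hv) hn

-- The item at distance `d - 1` has its home no later than `u`, so it is pushed past the slot at
-- distance `d / 2` by `e = d - 1 - d / 2` slots, and `2 * e + 2 ≥ d`.
open Classical in
lemma Core.find_crossEvent (H : Core n f h base ins cur A) (hK : GoodHash h K)
    (hsub : base ∪ ins ⊆ K) (hf : 0 < f) (hfn : f ≤ n) {x : ℕ} (hx : slotHash n h A x = none)
    (hD : ∀ k, k < D → ∃ r, slotHash n h A (home n (h u) + k) = some r ∧
      k ≤ disp n (home n (h u) + k) r) {d : ℕ} (h1 : 1 ≤ d) (hdD : d ≤ D) :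
    CrossEvent n f base ins h u d := by
  left
  have hF := H.ordered
  obtain ⟨r, hr, hk⟩ := hD (d - 1) (by omega)
  set e := d - 1 - d / 2 with he
  have hmod : (home n (h u) + n + (d - 1)) % n = (home n (h u) + (d - 1)) % n := by
    rw [show home n (h u) + n + (d - 1) = home n (h u) + (d - 1) + n by ring]; simp
  have h2 := H.excess_of_overflow hf hfn hx (s := home n (h u) + n + (d - 1)) (e := e) (r := r)
    (by rw [hF.congr hmod]; exact hr)
    (by rw [disp_congr (hF.home_lt hr) hmod]; omega) (by omega) u
  refine (h2.congr ?_ ?_).mono ?_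
  · intro v hv
    exact hK.home_lt hF.pos (hsub (Finset.mem_of_mem_erase hv))
  · rcases Nat.lt_or_ge d 2 with h3 | h3
    · have : d = 1 := by omega
      subst this
      simp [he]
    · rw [show home n (h u) + n + (d - 1) - e = home n (h u) + d / 2 + n by omega]
      simp
  · have : (d : ℝ) ≤ 2 * e + 2 := by exact_mod_cast (by omega : d ≤ 2 * e + 2)
    linarith

open Classical in
lemma Core.place_crossEvent (H : Core n f h base ins cur A) (hK : GoodHash h K)
    (hsub : base ∪ ins ⊆ K) (hu : u ∈ K) (hf : 16 ≤ f) (hfn : f ≤ n) (hins : ins.card ≤ f / 4)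
    {x : ℕ} (hx : slotHash n h A x = none) (hbase : base.card + f = n)
    (hP : PlaceSpec n h u P D A A') {d : ℕ} (hdD : d ≤ D) :
    CrossEvent n f base ins h u d := by
  have hF := H.ordered
  have hn := hF.pos
  have h0 := hK.nonneg u hu
  have h1 := hK.lt_one u hu
  have hDn := hP.lt
  have hbK : ∀ v ∈ base ∪ ins, home n (h v) < n := fun v hv => hK.home_lt hn (hsub hv)
  set i := d / 2 with hi
  set c := home n (h u) + i with hc
  have hdi : (d : ℝ) ≤ 2 * i + 1 := by exact_mod_cast (by omega : d ≤ 2 * i + 1)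
  set present := (Finset.Icc 1 (f / 2)).filter
    (fun k => tombHash n f k ∈ hashSet n (slotHash n h A)) with hpres
  have htomb : ∀ k ∈ present, ∃ x, A (x % n) = .tomb (tombHash n f k) := by
    intro k hk
    obtain ⟨x, hx⟩ := (mem_hashSet hF).1 (Finset.mem_filter.1 hk).2
    refine ⟨x, ?_⟩
    rw [slotHash] at hx
    cases hs : A (x % n) with
    | free => rw [hs] at hx; simp [Slot.hash?] at hx
    | key w =>
      rw [hs] at hx
      have hw := hsub (H.sub ((H.key_iff w).1 ⟨x, hs⟩))
      exact absurd (by simpa [Slot.hash?] using hx) (hK.ne_tomb w hw n f k)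
    | tomb r' =>
      rw [hs] at hx
      have : r' = tombHash n f k := by simpa [Slot.hash?] using hx
      rw [this]
  -- A surviving tombstone whose home lies between that of `u` and slot `c` comes after `u`, so it
  -- stands at distance at least `D` and is an overflow past `c` by at least `D - i`.
  by_cases hnear : ∃ k ∈ present, disp n c (tombHash n f k) < i
  · left
    obtain ⟨k, hk, hlt⟩ := hnear
    obtain ⟨x', hx'⟩ := htomb k hk
    have hxr : slotHash n h A x' = some (tombHash n f k) := by rw [slotHash, hx']; rfl
    have hr := hF.home_lt hxr
    obtain ⟨b1, b2, b3⟩ := hP.tomb_beyond hF h0 h1 (i := i) (by omega) hx'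
      (realDisp_lt_of_disp_lt (by rw [disp_home_add (by omega)]; exact hlt))
    rw [← hc] at b1 b2 b3
    set r := tombHash n f k
    set dd := disp n c r with hdd
    set e2 := disp n x' r with he2
    have he2n : e2 < n := disp_lt hn _ _
    have hcn : (c + n) % n = c % n := by simp
    have hsl : home n (h u) + n + i + e2 - dd = c + n + (e2 - dd) := by omega
    rw [hsl] at b3
    have hds : disp n (c + n + (e2 - dd)) r = e2 := by
      have h2 : disp n (c + n) r = dd := disp_congr hr hcn
      rw [disp_add hr (by omega), h2]
      omega
    have h2 := H.excess_of_overflow (by omega) hfn hx (e := e2 - dd) b3 (by omega) (by omega) u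
    rw [Nat.add_sub_cancel] at h2
    refine (h2.congr (fun v hv => hbK v (Finset.mem_of_mem_erase hv)) hcn).mono ?_
    have : (d : ℝ) ≤ 2 * (e2 - dd : ℕ) := by exact_mod_cast (by omega : d ≤ 2 * (e2 - dd))
    linarith
  · right
    push Not at hnear
    -- In a window that contains no surviving tombstone every hash belongs to a key of `base` or to
    -- an inserted one.
    have hfil : ∀ θ : ℝ, (∀ k ∈ present, θ ≤ realDisp n c (tombHash n f k)) →
        ((hashSet n (slotHash n h A)).filter (fun r => realDisp n c r < θ)).card ≤
        (base.filter (fun v => realDisp n c (h v) < θ)).card +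
        ((ins \ base).filter (fun v => realDisp n c (h v) < θ)).card := by
      intro θ hθ
      rw [← Finset.card_union_of_disjoint (Finset.disjoint_filter_filter
        Finset.disjoint_sdiff)]
      refine (Finset.card_le_card ?_).trans (Finset.card_image_le (f := h))
      intro r hr
      rw [Finset.mem_filter] at hr
      rw [Finset.mem_image]
      rcases H.hash r hr.1 with ⟨v, hv, rfl⟩ | ⟨k, hk, rfl⟩
      · refine ⟨v, ?_, rfl⟩
        simp only [Finset.mem_union, Finset.mem_filter, Finset.mem_sdiff] at hv ⊢
        tauto
      · have := hθ k (Finset.mem_filter.2 ⟨hk, hr.1⟩)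
        linarith [hr.2]
    have hrd : ∀ r, realDisp n c r < n := fun r => by
      have h2 := realDisp_le n c r
      have h3 : ((disp n c r : ℕ) : ℝ) < n := by exact_mod_cast disp_lt hn c r
      linarith
    have hinsb : (ins \ base).card ≤ ins.card := Finset.card_le_card Finset.sdiff_subset
    -- By `balance` on the whole table, using up all `f / 2` tombstones would take at least that
    -- many inserted keys, but there are at most `f / 4`.
    have hne : present.Nonempty := by
      by_contra hemp
      rw [Finset.not_nonempty_iff_eq_empty] at hemp
      have h2 := H.balance c n (Or.inl le_rfl)
      have h3 := hfil n (by simp [hemp])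
      simp only [hrd, Finset.filter_true, Nat.card_Icc] at h2 h3
      omega
    obtain ⟨k, hk, hmin⟩ := Finset.exists_min_image present
      (fun k => realDisp n c (tombHash n f k)) hne
    have hk' := Finset.mem_filter.1 hk
    set τ := tombHash n f k with hτ
    set θ := realDisp n c τ with hθ
    have h2 := H.balance c θ (Or.inr ⟨k, hk'.1, hk'.2, rfl⟩)
    have h3 := hfil θ hmin
    set g := disp n c τ with hg
    have hig : i ≤ g := hnear k hk
    have hgn : g < n := disp_lt hn _ _
    have h4 : ((Finset.Icc 1 (f / 2)).filter (fun k => disp n c (tombHash n f k) < g)).card ≤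
        ((Finset.Icc 1 (f / 2)).filter (fun k => realDisp n c (tombHash n f k) < θ)).card := by
      apply Finset.card_le_card
      refine Finset.monotone_filter_right _ ?_
      intro k' _ hk'
      exact realDisp_lt_of_disp_lt hk'
    have h5 : ((ins \ base).filter (fun v => realDisp n c (h v) < θ)).card ≤
        ((ins \ base).filter (fun v => disp n c (h v) < g + 1)).card := by
      apply Finset.card_le_card
      refine Finset.monotone_filter_right _ ?_
      intro v _ hv
      exact Nat.lt_succ_of_le (disp_le_of_realDisp_le (le_of_lt hv))
    have h6 := (card_tombs_window (by omega) hfn c hgn.le).1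
    -- Behind the nearest surviving tombstone, `balance` and `hfil` leave the created tombstones
    -- outnumbered by inserted keys. The keys of `base` cancel.
    have h7 : ((((Finset.Icc 1 (f / 2)).filter
        (fun k => disp n c (tombHash n f k) < g)).card : ℕ) : ℝ) ≤
        ((ins \ base).filter (fun v => disp n c (h v) < g + 1)).card := by
      exact_mod_cast (by omega)
    have hfp : (0 : ℝ) < f := by exact_mod_cast (by omega : 0 < f)
    have hfn' : (f : ℝ) ≤ n := by exact_mod_cast hfn
    have hnp : (0 : ℝ) < n := hfp.trans_le hfn'
    set ρ : ℝ := f / (2 * n) with hρ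
    have hρ0 : 0 < ρ := by positivity
    have hρ1 : ρ ≤ 1 / 2 := by
      rw [hρ, div_le_iff₀ (by positivity)]
      linarith
    have hρn : n * ρ = f / 2 := by rw [hρ]; field_simp
    -- `Excess` admits only windows shorter than `n`. On all `n` slots the at most `f / 4` inserted
    -- keys could not match almost `f / 2` tombstones once `16 ≤ f`.
    have hlt : g + 1 < n := by
      by_contra hcon
      have hg1 : g + 1 = n := by omega
      have h8 : ((ins \ base).filter (fun v => disp n c (h v) < g + 1)).card ≤ f / 4 :=
        (Finset.card_filter_le _ _).trans (hinsb.trans hins)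
      have h9 : (((ins \ base).filter (fun v => disp n c (h v) < g + 1)).card : ℝ) ≤ f / 4 :=
        (Nat.cast_le.2 h8).trans Nat.cast_div_le
      have h10 : (g : ℝ) = n - 1 := by
        have : ((g + 1 : ℕ) : ℝ) = n := by rw [hg1]
        push_cast at this
        linarith
      have h11 : (16 : ℝ) ≤ f := by exact_mod_cast hf
      rw [h10] at h6
      nlinarith
    refine ⟨g + 1, hlt, ?_⟩
    have h8 := card_le_card_erase_add_one (ins \ base) u (fun v => disp n c (h v) < g + 1)
    have h9 : ((((ins \ base).filter (fun v => disp n c (h v) < g + 1)).card : ℕ) : ℝ) ≤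
      (((ins \ base).erase u).filter (fun v => disp n c (h v) < g + 1)).card + 1 := by
      exact_mod_cast h8
    have hig' : (i : ℝ) ≤ g := by exact_mod_cast hig
    push_cast
    -- At least `ρ * g - 3` inserted keys other than `u` exceed `3/4 * ρ * (g + 1)` by about `ρ * g
    -- / 4`, and `g ≥ i`, which is about `d / 2`.
    nlinarith

end

end Graveyard

namespace Graveyard

variable {U : Type*}

/-! ### Rebuild windows -/

/-- Parameters for which blocks are large enough. -/
structure Admissible (c : Config) : Prop where
  one_le_x : 1 ≤ c.x
  three_mul_le : 3 * c.B ≤ c.M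
  le_L : c.B ≤ c.L
  le_B : 64 * c.x ≤ c.B

lemma Admissible.B_pos {c : Config} (hc : Admissible c) : 0 < c.B := by
  have h1 := hc.one_le_x
  have h2 := hc.le_B
  have : (0 : ℝ) < c.B := by linarith
  exact_mod_cast this

lemma Admissible.two_le {c : Config} (hc : Admissible c) : 2 ≤ c.M / c.B - 1 := by
  have : 3 ≤ c.M / c.B := (Nat.le_div_iff_mul_le hc.B_pos).2 hc.three_mul_le
  omega

lemma Admissible.one_le_L {c : Config} (hc : Admissible c) : 1 ≤ c.L :=
  le_trans hc.B_pos hc.le_L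

lemma Admissible.B_le_newCap {c : Config} (hc : Admissible c) (m : ℕ) : c.B ≤ newCap c m :=
  hc.le_L.trans (le_max_left _ _)

lemma Admissible.lt_newCap {c : Config} (hc : Admissible c) (m : ℕ) : m < newCap c m :=
  Graveyard.lt_newCap hc.one_le_L hc.one_le_x m

/-- The slack is at least `m / x`, so the capacity is at most `x + 1 ≤ 2 * x` times the slack. -/
lemma Admissible.newCap_le_mul {c : Config} (hc : Admissible c) (m : ℕ) :
    (newCap c m : ℝ) ≤ 2 * c.x * (newCap c m - m : ℕ) := by
  have h1 := hc.one_le_x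
  have h2 : m + ⌈(m : ℝ) / c.x⌉₊ ≤ newCap c m := le_max_right _ _
  have h3 : ((⌈(m : ℝ) / c.x⌉₊ : ℕ) : ℝ) ≤ (newCap c m - m : ℕ) := by
    exact_mod_cast (by omega)
  have h4 := (Nat.le_ceil ((m : ℝ) / c.x)).trans h3
  rw [div_le_iff₀ (by linarith)] at h4
  have h5 : (newCap c m : ℝ) = m + (newCap c m - m : ℕ) := by
    exact_mod_cast (by have := hc.lt_newCap m; omega)
  have h6 : (0 : ℝ) ≤ (newCap c m - m : ℕ) := by positivity
  nlinarith

/-- The slack is at least `n / (2 * x) ≥ B / (2 * x) ≥ 32`. This makes the maximum with `1` in the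
length of a rebuild window irrelevant. -/
lemma Admissible.le_slack {c : Config} (hc : Admissible c) (m : ℕ) : 32 ≤ newCap c m - m := by
  have h1 := hc.one_le_x
  have h2 := hc.newCap_le_mul m
  have h3 : (c.B : ℝ) ≤ newCap c m := by exact_mod_cast hc.B_le_newCap m
  have h4 := hc.le_B
  have h5 : (32 : ℝ) ≤ (newCap c m - m : ℕ) := by
    by_contra hcon
    push Not at hcon
    nlinarith
  exact_mod_cast h5

lemma Admissible.newCap_le {c : Config} (hc : Admissible c) {m n : ℕ} (hm : m ≤ n)
    (hL : c.L ≤ n) : newCap c m ≤ 2 * n := by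
  have h1 := hc.one_le_x
  have h2 : ⌈(m : ℝ) / c.x⌉₊ ≤ m := by
    rw [Nat.ceil_le]
    exact div_le_self (by positivity) h1
  unfold newCap
  omega

/-- The sets of keys that determine the state of the table in a rebuild window, and the number of
insertions and deletions left. -/
structure Window (U : Type*) where
  base : Finset U
  ins : Finset U
  cur : Finset U
  left : ℕ

/-- The number of slots. -/
noncomputable def Window.cap (c : Config) (w : Window U) : ℕ := newCap c w.base.card

/-- The number of slots without keys after the last rebuild. -/
noncomputable def Window.slack (c : Config) (w : Window U) : ℕ := w.cap c - w.base.card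

/-- The window that starts when a table with the keys `S` is rebuilt. -/
noncomputable def newWindow (c : Config) (S : Finset U) : Window U where
  base := S
  ins := ∅
  cur := S
  left := max 1 ((newCap c S.card - S.card) / 4)

/-- Count an insertion or deletion. -/
noncomputable def Window.tick (c : Config) (w : Window U) : Window U :=
  if w.left ≤ 1 then newWindow c w.cur else { w with left := w.left - 1 }

open Classical in
/-- The window after an operation. -/
noncomputable def Window.step (c : Config) (w : Window U) : Op U → Window U
  | .insert u => Window.tick c { w with ins := w.ins ∪ {u}, cur := w.cur ∪ {u} }
  | .delete u => Window.tick c { w with cur := w.cur.erase u }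
  | .query _ => w

/-- The window after a sequence of operations. -/
noncomputable def windowAfter (c : Config) (ops : List (Op U)) : Window U :=
  ops.foldl (Window.step c) (newWindow c ∅)

/-- The bounds on the numbers of keys in a window; `e` is `1` between an insertion or deletion and
its being counted. -/
structure Window.Counts (c : Config) (w : Window U) (e : ℕ) : Prop where
  one_le : 1 ≤ w.left
  left_le : w.left ≤ w.slack c / 4
  ins_le : w.ins.card + w.left ≤ w.slack c / 4 + e
  cur_le : w.cur.card + w.left ≤ w.base.card + w.slack c / 4 + e
  base_le : w.base.card + w.left ≤ w.cur.card + w.slack c / 4 + e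

lemma newWindow_counts {c : Config} (hc : Admissible c) (S : Finset U) :
    (newWindow c S).Counts c 0 := by
  have h1 := hc.le_slack S.card
  have h2 : (newWindow c S).left = (newWindow c S).slack c / 4 := by
    change max 1 ((newCap c S.card - S.card) / 4) = (newCap c S.card - S.card) / 4
    omega
  have h3 : 32 ≤ (newWindow c S).slack c := h1
  refine ⟨le_max_left _ _, h2.le, ?_, ?_, ?_⟩
  · rw [h2]; simp [newWindow]
  · rw [h2]; simp [newWindow]
  · rw [h2]; simp [newWindow]

lemma Window.Counts.tick {c : Config} (hc : Admissible c) {w : Window U} (H : w.Counts c 1) :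
    (w.tick c).Counts c 0 := by
  unfold Window.tick
  split_ifs with h
  · exact newWindow_counts hc _
  · have h1 := H.left_le
    have h2 := H.ins_le
    have h3 := H.cur_le
    have h4 := H.base_le
    have h5 : Window.slack c { w with left := w.left - 1 } = w.slack c := rfl
    refine ⟨?_, ?_, ?_, ?_, ?_⟩ <;> (try rw [h5]) <;> simp only <;> omega

lemma Window.Counts.step {c : Config} (hc : Admissible c) {w : Window U} (H : w.Counts c 0)
    (op : Op U) : (w.step c op).Counts c 0 := by
  classical
  have h1 := H.one_le
  have h2 := H.left_le
  have h3 := H.ins_le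
  have h4 := H.cur_le
  have h5 := H.base_le
  cases op with
  | insert u =>
    refine Window.Counts.tick hc ⟨h1, h2, ?_, ?_, ?_⟩
    · have : (w.ins ∪ {u}).card ≤ w.ins.card + 1 := (Finset.card_union_le _ _).trans (by simp)
      change (w.ins ∪ {u}).card + w.left ≤ w.slack c / 4 + 1
      omega
    · have : (w.cur ∪ {u}).card ≤ w.cur.card + 1 := (Finset.card_union_le _ _).trans (by simp)
      change (w.cur ∪ {u}).card + w.left ≤ w.base.card + w.slack c / 4 + 1
      omega
    · have : w.cur.card ≤ (w.cur ∪ {u}).card := Finset.card_le_card Finset.subset_union_left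
      change w.base.card + w.left ≤ (w.cur ∪ {u}).card + w.slack c / 4 + 1
      omega
  | delete u =>
    have h6 : (w.cur.erase u).card ≤ w.cur.card := Finset.card_erase_le
    have h7 := Finset.pred_card_le_card_erase (s := w.cur) (a := u)
    refine Window.Counts.tick hc ⟨h1, h2, ?_, ?_, ?_⟩
    · change w.ins.card + w.left ≤ w.slack c / 4 + 1
      omega
    · change (w.cur.erase u).card + w.left ≤ w.base.card + w.slack c / 4 + 1
      omega
    · change w.base.card + w.left ≤ (w.cur.erase u).card + w.slack c / 4 + 1
      omega
  | query u => exact H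

lemma Window.base_card_add_slack {c : Config} (hc : Admissible c) (w : Window U) :
    w.base.card + w.slack c = w.cap c := by
  have := hc.lt_newCap w.base.card
  unfold Window.slack Window.cap
  omega

/-- The state of the table in a window. -/
structure WinInv (c : Config) (h : U → ℝ) (w : Window U) (ts : Table × Mem U) : Prop where
  cap : ts.1.cap = w.cap c
  keys : ts.1.keys = w.cur.card
  left : ts.1.left = w.left
  core : Core (w.cap c) (w.slack c) h w.base w.ins w.cur (ts.2.arr ts.1.side)

/-- The block transfers of rebuilds, for each insertion or deletion. -/
noncomputable def rebuildShare (c : Config) : ℝ := 480 * c.x / c.B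

lemma rebuildShare_nonneg {c : Config} (hc : Admissible c) : 0 ≤ rebuildShare c := by
  have := hc.one_le_x
  unfold rebuildShare
  positivity

/-- The number of insertions and deletions in the window so far. -/
noncomputable def Window.used (c : Config) (w : Window U) : ℝ := (w.slack c / 4 : ℕ) - w.left

lemma newWindow_used {c : Config} (hc : Admissible c) (S : Finset U) :
    (newWindow c S).used c = 0 := by
  have h1 := hc.le_slack S.card
  have h2 : (newWindow c S).left = (newWindow c S).slack c / 4 := by
    change max 1 ((newCap c S.card - S.card) / 4) = (newCap c S.card - S.card) / 4
    omega
  rw [Window.used, h2, sub_self]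

lemma rebuild_winInv {c : Config} (hc : Admissible c) {h : U → ℝ} {S K : Finset U}
    (hK : GoodHash h K) (hS : S ⊆ K) {t : Table} {s : Mem U}
    (H : RebuildSpec c h t S s (rebuild c h t s)) : WinInv c h (newWindow c S) (rebuild c h t s) :=
  ⟨H.cap, H.keys, H.left, H.core hK hS (hc.lt_newCap _)⟩

/-- The new capacity is at most `2 * n` and `1 ≤ n / B`, so the cost is at most `8 + 6 + 16 = 30`
times `n / B`. With `n ≤ 16 * x * (f / 4)` this yields the constant `480 = 30 * 16` of
`rebuildShare`. -/
lemma rebuild_cost_le {c : Config} (hc : Admissible c) {n f m : ℕ} (hn : c.L ≤ n) (hm : m ≤ n)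
    (hf : 32 ≤ f) (hnf : (n : ℝ) ≤ 2 * c.x * f) :
    ((8 * (n / c.B) + 3 * (newCap c m / c.B) + 16 : ℕ) : ℝ) ≤ rebuildShare c * (f / 4 : ℕ) := by
  have hB : (0 : ℝ) < c.B := by exact_mod_cast hc.B_pos
  have h1 : ((n / c.B : ℕ) : ℝ) ≤ n / c.B := Nat.cast_div_le
  have h2 : ((newCap c m / c.B : ℕ) : ℝ) ≤ newCap c m / c.B := Nat.cast_div_le
  have h3 : (newCap c m : ℝ) ≤ 2 * n := by exact_mod_cast hc.newCap_le hm hn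
  have h4 : (newCap c m : ℝ) / c.B ≤ 2 * n / c.B := by gcongr
  have h5 : (c.B : ℝ) ≤ n := by exact_mod_cast hc.le_L.trans hn
  have h6 : 1 ≤ (n : ℝ) / c.B := by rwa [one_le_div hB]
  have h7 : (f : ℝ) ≤ 8 * (f / 4 : ℕ) := by exact_mod_cast (by omega : f ≤ 8 * (f / 4))
  have hx := hc.one_le_x
  have h8 : (n : ℝ) ≤ 16 * c.x * (f / 4 : ℕ) := by nlinarith
  have h9 : (n : ℝ) / c.B ≤ 16 * c.x * (f / 4 : ℕ) / c.B := by gcongr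
  have h10 : rebuildShare c * (f / 4 : ℕ) = 30 * (16 * c.x * (f / 4 : ℕ) / c.B) := by
    unfold rebuildShare
    ring
  rw [h10]
  push_cast
  have h11 : 2 * (n : ℝ) / c.B = 2 * (n / c.B) := by ring
  rw [h11] at h4
  linarith

/-- Amortization: each update sets `rebuildShare` aside, so that the savings at the end of a window,
where `used` is reset to `0`, pay for the whole rebuild. -/
lemma tick_spec {c : Config} (hc : Admissible c) {h : U → ℝ} {K : Finset U} (hK : GoodHash h K)
    {w : Window U} {t : Table} {s : Mem U} (H : WinInv c h w (t, s)) (hw : w.Counts c 1)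
    (hcur : w.cur ⊆ K) :
    WinInv c h (w.tick c) (tick c h t s) ∧
      ((tick c h t s).2.transfers : ℝ) + rebuildShare c * (w.tick c).used c ≤
        s.transfers + rebuildShare c * (w.used c + 1) := by
  have hleft := H.left
  simp only at hleft
  unfold Graveyard.tick Window.tick
  rw [hleft]
  have h1 := hw.one_le
  split_ifs with hl
  · have hcap := H.cap
    have hcore := H.core
    simp only at hcap hcore
    rw [← hcap] at hcore
    have hF := hcore.ordered
    have R := rebuild_spec (c := c) (h := h) (t := t) (s := s) (S := w.cur) hc.two_le hc.one_le_L
      hc.one_le_x H.keys (fun u => by rw [← hcore.key_iff, hF.exists_taken])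
      (fun u hu => hK.nonneg u (hcur hu)) (fun u hu => hK.lt_one u (hcur hu))
      (fun i j u v hij => hF.taken_lt hij) (fun u hu => hK.ne_tomb u (hcur hu))
    refine ⟨rebuild_winInv hc hK hcur R, ?_⟩
    have h2 := R.cost
    have h3 := hw.cur_le
    have h4 := w.base_card_add_slack hc
    have h5 := rebuild_cost_le hc (n := w.cap c) (f := w.slack c) (m := w.cur.card)
      (le_max_left _ _) (by omega) (hc.le_slack _) (hc.newCap_le_mul _)
    have h6 : ((rebuild c h t s).2.transfers : ℝ) ≤
        s.transfers + (8 * (w.cap c / c.B) + 3 * (newCap c w.cur.card / c.B) + 16 : ℕ) := by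
      rw [hcap] at h2
      exact_mod_cast (by omega)
    rw [newWindow_used hc]
    have h7 : w.used c + 1 = (w.slack c / 4 : ℕ) := by
      have : w.left = 1 := by omega
      rw [Window.used, this]
      simp
    rw [h7]
    linarith
  · refine ⟨⟨H.cap, H.keys, by simp, H.core⟩, ?_⟩
    have h7 : Window.used c { w with left := w.left - 1 } = w.used c + 1 := by
      unfold Window.used
      rw [Nat.cast_sub h1]
      change ((w.slack c / 4 : ℕ) : ℝ) - _ = _
      push_cast
      ring
    rw [h7]

/-- The key of an operation. -/
def Op.key : Op U → U
  | .insert u => u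
  | .delete u => u
  | .query u => u

open Classical in
lemma Core.exists_free {n f : ℕ} {h : U → ℝ} {base ins cur : Finset U} {A : ℕ → Slot U}
    (H : Core n f h base ins cur A) (hbase : base.card + f = n) (hins : ins.card ≤ f / 4)
    (hf : 16 ≤ f) : ∃ e, slotHash n h A e = none := by
  apply H.ordered.exists_free
  have h1 := H.card_hashSet_le
  have h2 := Finset.card_union_le base ins
  omega

open Classical in
lemma Core.find_lt {n f : ℕ} {h : U → ℝ} {base ins cur : Finset U} {A : ℕ → Slot U}
    (H : Core n f h base ins cur A) {x : ℕ} (hx : slotHash n h A x = none) {a D : ℕ}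
    (hD : ∀ k, k < D → ∃ r, slotHash n h A (a + k) = some r) : D < n := by
  obtain ⟨k, hk, hxk⟩ := exists_add_mod H.ordered.pos a x
  by_contra hcon
  obtain ⟨r, hr⟩ := hD k (by omega)
  rw [H.ordered.congr hxk, hr] at hx
  simp at hx

-- One transfer for the first slot, `crossBound` for the boundaries crossed afterwards, and
-- `rebuildShare` as the saving for the next rebuild.
open Classical in
lemma step_spec {c : Config} (hc : Admissible c) {h : U → ℝ} {K : Finset U} (hK : GoodHash h K)
    {w : Window U} {ts : Table × Mem U} (H : WinInv c h w ts) (hw : w.Counts c 0)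
    (hsub : w.base ∪ w.ins ⊆ K) {op : Op U} (hop : op.key ∈ K)
    (hins : ∀ u, op = .insert u → u ∉ w.cur) :
    WinInv c h (w.step c op) (step c h ts op) ∧
      ((step c h ts op).2.transfers : ℝ) + rebuildShare c * (w.step c op).used c ≤
        ts.2.transfers + rebuildShare c * w.used c + (1 + rebuildShare c +
          crossBound (w.cap c) (w.slack c) c.B w.base w.ins h op.key) := by
  obtain ⟨t, s⟩ := ts
  have hcap := H.cap
  have hkeys := H.keys
  have hcore := H.core
  simp only at hcap hkeys hcore
  have hB := hc.B_pos
  have hc2 := hc.two_le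
  have hsl := w.base_card_add_slack hc
  have hslack : 32 ≤ w.slack c := hc.le_slack _
  have hinsc : w.ins.card ≤ w.slack c / 4 := by have := hw.ins_le; omega
  have hw1 := hw.one_le
  have hwl := hw.left_le
  have hwi := hw.ins_le
  have hwc := hw.cur_le
  have hwb := hw.base_le
  have hcurK : w.cur ⊆ K := hcore.sub.trans hsub
  obtain ⟨x, hx⟩ := hcore.exists_free hsl hinsc (by omega)
  have hF := hcore.ordered
  have hn := hF.pos
  have hα := rebuildShare_nonneg hc
  have hfind : ∀ u ∈ K, ∃ D, FindSpec c h t u 0 D s (find c h t u t.cap 0 s) ∧ D < t.cap ∧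
      (find c h t u t.cap 0 s).2.transfers ≤ s.transfers + (1 +
        crossBound (w.cap c) (w.slack c) c.B w.base w.ins h u) := by
    intro u hu
    obtain ⟨D, hD⟩ := find_spec (c := c) (by omega) h t u (by omega) t.cap 0 s (by omega)
    have h1 : ∀ k, k < D → ∃ r, slotHash (w.cap c) h (s.arr t.side) (home (w.cap c) (h u) + k) =
        some r ∧ k ≤ disp (w.cap c) (home (w.cap c) (h u) + k) r := by
      intro k hk
      have := hD.le_disp (by rw [hcap]; exact hF) (hK.nonneg u hu) (hK.lt_one u hu) hk
      rwa [hcap] at this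
    have h2 : D < w.cap c := hcore.find_lt hx (fun k hk => by
      obtain ⟨r, hr, -⟩ := h1 k hk
      exact ⟨r, hr⟩)
    refine ⟨D, hD, by omega, ?_⟩
    have h3 := hD.cost
    have h4 := miss_le_one c s t.side ((home t.cap (h u) + 0) % t.cap)
    have h5 : crossings (w.cap c) c.B (home (w.cap c) (h u)) (home (w.cap c) (h u) + D) ≤
        crossBound (w.cap c) (w.slack c) c.B w.base w.ins h u :=
      crossings_le_crossBound h2 (fun d hd1 hd2 =>
        hcore.find_crossEvent hK hsub (by omega) (by omega) hx h1 hd1 hd2)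
    rw [add_zero] at h3 h4
    rw [hcap] at h3 h4
    rw [hcap]
    omega
  cases op with
  | insert u =>
    have hu : u ∈ K := hop
    have hucur : u ∉ w.cur := hins u rfl
    obtain ⟨e, he, hxe⟩ := exists_add_mod hn (home (w.cap c) (h u)) x
    obtain ⟨P, D, -, hP₀, hcost⟩ := place_spec (c := c) (by omega) h t u (e := e) (by omega)
      t.cap 0 s (by omega) (by omega)
      (by rw [hcap, ← hxe]; exact hx) (fun k hk => by omega)
    have hP : PlaceSpec (w.cap c) h u P D (s.arr t.side)
        ((place c h t u t.cap 0 s).arr t.side) := by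
      rw [hcap] at hP₀
      rw [hcap]
      exact hP₀
    have hcost2 : (place c h t u t.cap 0 s).transfers ≤ s.transfers + (1 +
        crossBound (w.cap c) (w.slack c) c.B w.base w.ins h u) := by
      have h4 := miss_le_one c s t.side ((home t.cap (h u) + 0) % t.cap)
      have h5 : crossings (w.cap c) c.B (home (w.cap c) (h u)) (home (w.cap c) (h u) + D) ≤
          crossBound (w.cap c) (w.slack c) c.B w.base w.ins h u :=
        crossings_le_crossBound hP.lt (fun d hd1 hd2 =>
          hcore.place_crossEvent hK hsub hu (by omega) (by omega) hinsc hx hsl hP hd2)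
      rw [add_zero] at hcost h4
      rw [hcap] at hcost h4
      rw [hcap]
      omega
    set w' : Window U := { w with ins := w.ins ∪ {u}, cur := w.cur ∪ {u} } with hw'
    have hcard : (w.cur ∪ {u}).card = w.cur.card + 1 := by
      rw [Finset.card_union_of_disjoint (by simpa using hucur)]
      simp
    have hicard : (w.ins ∪ {u}).card ≤ w.ins.card + 1 :=
      (Finset.card_union_le _ _).trans (by simp)
    have hcounts : w'.Counts c 1 := by
      refine ⟨hw1, hwl, ?_, ?_, ?_⟩
      · change (w.ins ∪ {u}).card + w.left ≤ w.slack c / 4 + 1; omega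
      · change (w.cur ∪ {u}).card + w.left ≤ w.base.card + w.slack c / 4 + 1; omega
      · change w.base.card + w.left ≤ (w.cur ∪ {u}).card + w.slack c / 4 + 1; omega
    have hinv : WinInv c h w' ({ t with keys := t.keys + 1 }, place c h t u t.cap 0 s) :=
      ⟨hcap, by simp only [hw', hcard, hkeys], H.left,
        hcore.insert hK hsub hu hucur hx hP⟩
    obtain ⟨T1, T2⟩ := tick_spec hc hK hinv hcounts (by
      intro v hv
      rcases Finset.mem_union.1 hv with h1 | h1
      · exact hcurK h1
      · rw [Finset.mem_singleton.1 h1]; exact hu)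
    refine ⟨T1, T2.trans ?_⟩
    have h6 : ((place c h t u t.cap 0 s).transfers : ℝ) ≤ s.transfers + (1 +
        crossBound (w.cap c) (w.slack c) c.B w.base w.ins h u) := by exact_mod_cast hcost2
    have h7 : w'.used c = w.used c := rfl
    rw [h7]
    change _ ≤ (s.transfers : ℝ) + rebuildShare c * w.used c + (1 + rebuildShare c +
      crossBound (w.cap c) (w.slack c) c.B w.base w.ins h u)
    linarith
  | delete u =>
    have hu : u ∈ K := hop
    obtain ⟨D, hD, hDn, hcost⟩ := hfind u hu
    set w' : Window U := { w with cur := w.cur.erase u } with hw'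
    have h6 : (w.cur.erase u).card ≤ w.cur.card := Finset.card_erase_le
    have h7 := Finset.pred_card_le_card_erase (s := w.cur) (a := u)
    have hcounts : w'.Counts c 1 := by
      refine ⟨hw1, hwl, ?_, ?_, ?_⟩
      · change w.ins.card + w.left ≤ w.slack c / 4 + 1
        omega
      · change (w.cur.erase u).card + w.left ≤ w.base.card + w.slack c / 4 + 1
        omega
      · change w.base.card + w.left ≤ (w.cur.erase u).card + w.slack c / 4 + 1
        omega
    have hsubK : w'.cur ⊆ K := (Finset.erase_subset _ _).trans hcurK
    have hused : w'.used c = w.used c := rfl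
    have h8 : ((find c h t u t.cap 0 s).2.transfers : ℝ) ≤ s.transfers + (1 +
        crossBound (w.cap c) (w.slack c) c.B w.base w.ins h u) := by exact_mod_cast hcost
    rcases hD.result with ⟨g1, -, g2, g3⟩ | ⟨g1, -⟩
    · set p := (home t.cap (h u) + D) % t.cap with hp
      have hpn : p < t.cap := Nat.mod_lt _ (by omega)
      have hres : step c h (t, s) (.delete u) = tick c h { t with keys := t.keys - 1 }
          ((find c h t u t.cap 0 s).2.write c t.side p (.tomb (h u))) := by
        clear hD hcost h8 g2 g3
        simp only [Graveyard.step]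
        generalize find c h t u t.cap 0 s = res at g1 ⊢
        obtain ⟨r, s'⟩ := res
        simp only at g1
        subst g1
        rfl
      have hucur : u ∈ w.cur := (hcore.key_iff u).1 ⟨p, by
        rw [Nat.mod_eq_of_lt (hcap ▸ hpn)]; exact g2⟩
      have hinv : WinInv c h w' ({ t with keys := t.keys - 1 },
          (find c h t u t.cap 0 s).2.write c t.side p (.tomb (h u))) := by
        refine ⟨hcap, ?_, H.left, ?_⟩
        · simp only [hw', hkeys, Finset.card_erase_of_mem hucur]
        · simp only [write_arr]
          rw [hD.arr]
          exact hcore.delete (hcap ▸ hpn) g2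
      obtain ⟨T1, T2⟩ := tick_spec hc hK hinv hcounts hsubK
      rw [hres]
      refine ⟨T1, T2.trans ?_⟩
      -- The slot of `u` was examined last, so writing the tombstone costs no transfer.
      rw [write_transfers, g3, add_zero, hused]
      change _ ≤ (s.transfers : ℝ) + rebuildShare c * w.used c + (1 + rebuildShare c +
        crossBound (w.cap c) (w.slack c) c.B w.base w.ins h u)
      linarith
    · have hres : step c h (t, s) (.delete u) = tick c h t (find c h t u t.cap 0 s).2 := by
        clear hD hcost h8
        simp only [Graveyard.step]
        generalize find c h t u t.cap 0 s = res at g1 ⊢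
        obtain ⟨r, s'⟩ := res
        simp only at g1
        subst g1
        rfl
      -- A failed search proves the absence of `u`, so erasing it changes nothing, in agreement with
      -- the program, which leaves its key counter alone.
      have hucur : u ∉ w.cur := by
        intro hmem
        refine hD.eq_some_iff (by rw [hcap]; exact hF) (hK.nonneg u hu) (hK.lt_one u hu) ?_ g1
        rw [hcap]
        exact (hcore.key_iff u).2 hmem
      have her : w.cur.erase u = w.cur := Finset.erase_eq_of_notMem hucur
      have hinv : WinInv c h w' (t, (find c h t u t.cap 0 s).2) := by
        refine ⟨hcap, ?_, H.left, ?_⟩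
        · simp only [hw', her, hkeys]
        · simp only [hw', her, hD.arr]
          exact hcore
      obtain ⟨T1, T2⟩ := tick_spec hc hK hinv hcounts hsubK
      rw [hres]
      refine ⟨T1, T2.trans ?_⟩
      rw [hused]
      change _ ≤ (s.transfers : ℝ) + rebuildShare c * w.used c + (1 + rebuildShare c +
        crossBound (w.cap c) (w.slack c) c.B w.base w.ins h u)
      linarith
  | query u =>
    obtain ⟨D, hD, hDn, hcost⟩ := hfind u hop
    have h8 : ((find c h t u t.cap 0 s).2.transfers : ℝ) ≤ s.transfers + (1 +
        crossBound (w.cap c) (w.slack c) c.B w.base w.ins h u) := by exact_mod_cast hcost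
    refine ⟨⟨hcap, hkeys, H.left, ?_⟩, ?_⟩
    · change Core (w.cap c) (w.slack c) h w.base w.ins w.cur
        ((find c h t u t.cap 0 s).2.arr t.side)
      rw [hD.arr]
      exact hcore
    · change ((find c h t u t.cap 0 s).2.transfers : ℝ) + rebuildShare c * w.used c ≤
        (s.transfers : ℝ) + rebuildShare c * w.used c + (1 + rebuildShare c +
        crossBound (w.cap c) (w.slack c) c.B w.base w.ins h u)
      linarith

end Graveyard

namespace Graveyard

/-! ### Uniformly random home slots -/

section

variable {T : Type*} {n : ℕ}

/-- The number of keys of `S` whose homes are among the `j` slots that end with slot `s`. -/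
def windowCount (S : Finset T) (g : T → ZMod n) (s : ZMod n) (j : ℕ) : ℕ :=
  (S.filter (fun v => (s - g v).val < j)).card

/-- The largest excess, over all windows of slots that end with slot `s`, of the number of keys of
`S` whose homes are in the window over `κ` times its number of slots. -/
noncomputable def maxExcess [NeZero n] (S : Finset T) (κ : ℝ) (s : ZMod n) (g : T → ZMod n) : ℝ :=
  (Finset.range n).sup' (Finset.nonempty_range_iff.2 (NeZero.ne n))
    (fun j => (windowCount S g s j : ℝ) - j * κ)

/-- The number of keys of `S` whose home is slot `s`. -/
def slotCount (S : Finset T) (g : T → ZMod n) (s : ZMod n) : ℕ := (S.filter (fun v => g v = s)).card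

variable {S : Finset T} {κ : ℝ} {g : T → ZMod n} {s : ZMod n}

lemma slotCount_le_update [DecidableEq T] {v : T} (a : ZMod n) :
    slotCount S g s ≤ slotCount S (Function.update g v a) s + 1 := by
  rw [slotCount, slotCount, ← Finset.card_singleton v]
  refine le_trans (Finset.card_le_card ?_) (Finset.card_union_le _ _)
  intro w hw
  simp only [Finset.mem_filter, Finset.mem_union, Finset.mem_singleton] at hw ⊢
  rcases eq_or_ne w v with rfl | hwv
  · exact Or.inr rfl
  · rw [Function.update_of_ne hwv]
    exact Or.inl hw

variable [NeZero n]

lemma le_maxExcess {j : ℕ} (hj : j < n) : (windowCount S g s j : ℝ) - j * κ ≤ maxExcess S κ s g :=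
  Finset.le_sup' (fun j : ℕ => (windowCount S g s j : ℝ) - j * κ) (Finset.mem_range.2 hj)

lemma maxExcess_le_iff {y : ℝ} : maxExcess S κ s g ≤ y ↔
    ∀ j < n, (windowCount S g s j : ℝ) - j * κ ≤ y := by
  simp [maxExcess]

lemma le_maxExcess_iff {θ : ℝ} : θ ≤ maxExcess S κ s g ↔
    ∃ j < n, θ ≤ (windowCount S g s j : ℝ) - j * κ := by
  simp [maxExcess]

lemma maxExcess_nonneg : 0 ≤ maxExcess S κ s g := by
  have := le_maxExcess (S := S) (κ := κ) (g := g) (s := s) (Nat.pos_of_ne_zero (NeZero.ne n))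
  simpa [windowCount] using this

lemma val_sub_one_lt {a : ZMod n} (ha : a ≠ 0) {j : ℕ} (hj : a.val < j) : (a - 1).val < j - 1 := by
  have h0 : a.val ≠ 0 := by simpa [ZMod.val_eq_zero] using ha
  have h1 : a.val < n := ZMod.val_lt a
  have h2 : (1 : ZMod n).val = 1 := by
    rw [ZMod.val_one_eq_one_mod, Nat.mod_eq_of_lt (by omega)]
  rw [ZMod.val_sub (by omega), h2]
  omega

/-- Rotating all homes rotates the slot; this makes averages of functions of `maxExcess` independent
of the slot. -/
lemma maxExcess_add_const (a : ZMod n) :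
    maxExcess S κ s (fun v => g v + a) = maxExcess S κ (s - a) g := by
  unfold maxExcess windowCount
  simp only [sub_sub, add_comm]

lemma windowCount_le [DecidableEq T] (j : ℕ) :
    windowCount S g s j ≤ slotCount S g s + windowCount S g (s - 1) (j - 1) := by
  refine le_trans (Finset.card_le_card ?_) (Finset.card_union_le _ _)
  intro v hv
  simp only [Finset.mem_filter, Finset.mem_union] at hv ⊢
  by_cases h : g v = s
  · exact Or.inl ⟨hv.1, h⟩
  · refine Or.inr ⟨hv.1, ?_⟩
    rw [show s - 1 - g v = s - g v - 1 by ring]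
    exact val_sub_one_lt (sub_ne_zero.2 (Ne.symm h)) hv.2

variable [DecidableEq T]

/-- This is the recursion of a queue with service rate `κ`: a nonempty window that ends with `s` is
slot `s` together with a window that ends with `s - 1`. If the empty window is optimal, the left
side is `0`, and squaring makes the positive part unnecessary. -/
lemma maxExcess_sq_le : maxExcess S κ s g ^ 2 ≤
    (maxExcess S κ (s - 1) g + slotCount S g s - κ) ^ 2 := by
  obtain ⟨j, hj, h⟩ := (le_maxExcess_iff (S := S) (κ := κ) (g := g) (s := s)).1 le_rfl
  rcases Nat.eq_zero_or_pos j with rfl | hj0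
  · have h0 := maxExcess_nonneg (S := S) (κ := κ) (g := g) (s := s)
    have h1 : maxExcess S κ s g = 0 := le_antisymm (by simpa [windowCount] using h) h0
    rw [h1, zero_pow two_ne_zero]
    exact sq_nonneg _
  · have h1 := le_maxExcess (S := S) (κ := κ) (g := g) (s := s - 1) (j := j - 1) (by omega)
    have h2 : (windowCount S g s j : ℝ) ≤ slotCount S g s + windowCount S g (s - 1) (j - 1) := by
      exact_mod_cast windowCount_le j
    rw [Nat.cast_sub hj0, Nat.cast_one] at h1
    exact pow_le_pow_left₀ maxExcess_nonneg (by linarith) 2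

/-- Windows of fewer than `n` slots that end with `s - 1` never contain `s`, so moving a key away
from `s` can only fill them. This takes the place of independence of `maxExcess` at `s - 1` from the
number of keys at `s`. -/
lemma maxExcess_le_update {v : T} (hv : g v = s) (a : ZMod n) :
    maxExcess S κ (s - 1) g ≤ maxExcess S κ (s - 1) (Function.update g v a) := by
  refine maxExcess_le_iff.2 fun j hj => le_trans ?_ (le_maxExcess hj)
  gcongr
  refine Finset.card_le_card ?_
  intro w hw
  simp only [Finset.mem_filter] at hw ⊢
  refine ⟨hw.1, ?_⟩
  rcases eq_or_ne w v with rfl | hwv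
  · exfalso
    have h1 := hw.2
    rw [hv, show s - 1 - s = -1 by ring, ZMod.neg_val] at h1
    split_ifs at h1 with h2
    · have h3 : (1 : ZMod n).val = 0 := by rw [h2]; simp
      rw [ZMod.val_one_eq_one_mod] at h3
      have h4 : n = 1 := Nat.dvd_one.1 (Nat.dvd_of_mod_eq_zero h3)
      omega
    · have h3 : (1 : ZMod n).val ≤ 1 := by
        rw [ZMod.val_one_eq_one_mod]; exact Nat.mod_le _ _
      omega
  · rw [Function.update_of_ne hwv]
    exact hw.2

lemma maxExcess_update_of_notMem {u : T} (hu : u ∉ S) (a : ZMod n) :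
    maxExcess S κ s (Function.update g u a) = maxExcess S κ s g := by
  have : ∀ j, windowCount S (Function.update g u a) s j = windowCount S g s j := by
    intro j
    rw [windowCount, windowCount]
    congr 1
    refine Finset.filter_congr fun v hv => ?_
    rw [Function.update_of_ne (by rintro rfl; exact hu hv)]
  simp only [maxExcess, this]

variable [Fintype T]

/-- Resampling one coordinate preserves averages over all maps. -/
lemma sum_sum_update (u : T) (F : (T → ZMod n) → ZMod n → ℝ) :
    ∑ g : T → ZMod n, ∑ a, F g a = ∑ g : T → ZMod n, ∑ a, F (Function.update g u a) (g u) := by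
  rw [← Fintype.sum_prod_type', ← Fintype.sum_prod_type']
  have hinv : Function.Involutive (fun p : (T → ZMod n) × ZMod n =>
      (Function.update p.1 u p.2, p.1 u)) := by
    rintro ⟨g, a⟩
    simp
  exact (Equiv.sum_comp hinv.toPerm (fun p : (T → ZMod n) × ZMod n => F p.1 p.2)).symm

lemma mul_sum_eq_sum_update (u : T) (F : (T → ZMod n) → ℝ) :
    (n : ℝ) * ∑ g : T → ZMod n, F g = ∑ g : T → ZMod n, ∑ a, F (Function.update g u a) := by
  rw [← sum_sum_update u (fun g _ => F g)]
  simp [Finset.mul_sum]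

/-- Conditioning on the home of a key cannot increase an average by more than `C`, if moving the
key elsewhere cannot decrease the function by more than `C`. -/
lemma mul_sum_mul_slotCount_le (S : Finset T) (s : ZMod n) (F : (T → ZMod n) → ℝ) (C : ℝ)
    (H : ∀ g v a, g v = s → F g ≤ F (Function.update g v a) + C) :
    n * ∑ g : T → ZMod n, F g * slotCount S g s ≤
      S.card * ∑ g : T → ZMod n, (F g + C) := by
  have key : ∀ v : T, n * ∑ g : T → ZMod n, (if g v = s then F g else 0) ≤
      ∑ g : T → ZMod n, (F g + C) := by
    intro v
    calc n * ∑ g : T → ZMod n, (if g v = s then F g else 0)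
        = ∑ g : T → ZMod n, ∑ _a : ZMod n, (if g v = s then F g else 0) := by
          simp [Finset.mul_sum]
      _ ≤ ∑ g : T → ZMod n, ∑ a : ZMod n,
            (if g v = s then F (Function.update g v a) + C else 0) := by
          refine Finset.sum_le_sum fun g _ => Finset.sum_le_sum fun a _ => ?_
          split_ifs with h
          · exact H g v a h
          · exact le_rfl
      -- Exchanging `g v` with the fresh value `a` moves the condition onto `a`, which does not
      -- enter the summand.
      _ = ∑ g : T → ZMod n, ∑ a : ZMod n, (if a = s then F g + C else 0) :=
          (sum_sum_update v (fun g a => if a = s then F g + C else 0)).symm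
      _ = ∑ g : T → ZMod n, (F g + C) := by simp
  have h1 : ∀ g : T → ZMod n, F g * slotCount S g s = ∑ v ∈ S, if g v = s then F g else 0 := by
    intro g
    rw [slotCount, ← Finset.sum_filter, Finset.sum_const, nsmul_eq_mul, mul_comm]
  simp only [h1]
  rw [Finset.sum_comm, Finset.mul_sum, ← nsmul_eq_mul]
  exact Finset.sum_le_card_nsmul _ _ _ (fun v _ => key v)

lemma sum_comp_maxExcess (Q : ℝ → ℝ) (s s' : ZMod n) :
    ∑ g : T → ZMod n, Q (maxExcess S κ s g) = ∑ g : T → ZMod n, Q (maxExcess S κ s' g) := by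
  rw [← Equiv.sum_comp (Equiv.addRight (fun _ : T => s - s'))]
  refine Finset.sum_congr rfl fun g _ => ?_
  rw [show (Equiv.addRight (fun _ : T => s - s')) g = fun v => g v + (s - s') from rfl,
    maxExcess_add_const, sub_sub_cancel]

/-- Expand the square in `maxExcess_sq_le`. The second moments at `s` and `s - 1` cancel by
rotation, so the linear term, with drift `lam - κ`, is controlled by the rest. The mixed term is at
most `lam` times the mean of the excess, and the second moment of the slot count is at most `lam +
lam ^ 2`. -/
lemma sum_maxExcess_le {lam : ℝ} (hκ : 0 ≤ κ) (hlam : S.card ≤ lam * n) (s : ZMod n) :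
    2 * (κ - lam) * ∑ g : T → ZMod n, maxExcess S κ s g ≤
      (lam + lam ^ 2 + κ ^ 2) * Fintype.card (T → ZMod n) := by
  have hn : (0 : ℝ) < n := by exact_mod_cast Nat.pos_of_ne_zero (NeZero.ne n)
  have hlam0 : 0 ≤ lam := by
    by_contra h
    have : lam * n < 0 := mul_neg_of_neg_of_pos (by linarith) hn
    have h2 : (0 : ℝ) ≤ S.card := by positivity
    linarith
  have size : ∀ (F : (T → ZMod n) → ℝ) (C : ℝ), 0 ≤ C → (∀ g, 0 ≤ F g) →
      (∀ g v a, g v = s → F g ≤ F (Function.update g v a) + C) →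
      ∑ g : T → ZMod n, F g * slotCount S g s ≤ lam * ∑ g : T → ZMod n, (F g + C) := by
    intro F C hC hF H
    have h1 := mul_sum_mul_slotCount_le S s F C H
    have h2 : (S.card : ℝ) * ∑ g : T → ZMod n, (F g + C) ≤
        lam * n * ∑ g : T → ZMod n, (F g + C) :=
      mul_le_mul_of_nonneg_right hlam
        (Finset.sum_nonneg fun g _ => add_nonneg (hF g) hC)
    refine le_of_mul_le_mul_left ?_ hn
    linarith
  have h1 := size (fun g => maxExcess S κ (s - 1) g) 0 le_rfl (fun g => maxExcess_nonneg)
    (fun g v a hv => by simpa using maxExcess_le_update hv a)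
  have h2 := size (fun _ => 1) 0 le_rfl (fun _ => zero_le_one) (fun _ _ _ _ => by simp)
  have h3 := size (fun g => slotCount S g s) 1 zero_le_one (fun g => by positivity)
    (fun g v a _ => by
      have := slotCount_le_update (S := S) (g := g) (s := s) (v := v) a
      exact_mod_cast this)
  have h4 := sum_comp_maxExcess (S := S) (κ := κ) (fun y => y ^ 2) s (s - 1)
  have h5 : ∑ g : T → ZMod n, maxExcess S κ s g ^ 2 ≤
      ∑ g : T → ZMod n, (maxExcess S κ (s - 1) g ^ 2 +
        2 * (maxExcess S κ (s - 1) g * slotCount S g s) - 2 * κ * maxExcess S κ (s - 1) g +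
        ((slotCount S g s : ℝ) * slotCount S g s + κ ^ 2)) := by
    refine Finset.sum_le_sum fun g _ => maxExcess_sq_le.trans ?_
    have : 0 ≤ κ * slotCount S g s := by positivity
    nlinarith
  have h6 := sum_comp_maxExcess (S := S) (κ := κ) (fun y => y) s (s - 1)
  simp only [one_mul, add_zero, Finset.sum_add_distrib, Finset.sum_sub_distrib, ← Finset.mul_sum,
    Finset.sum_const, Finset.card_univ, nsmul_eq_mul, mul_one] at h1 h2 h3 h4 h5 h6
  rw [h6]
  have h7 := mul_le_mul_of_nonneg_left h2 hlam0
  linarith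

lemma card_boundaries_mul_le {B : ℕ} (hBn : B ≤ n) :
    (Finset.univ.filter (fun a : ZMod n => a.val % B = 0)).card * B ≤ 2 * n := by
  have h1 : (Finset.univ.filter (fun a : ZMod n => a.val % B = 0)).card ≤ n / B + 1 := by
    rw [← Finset.card_range (n / B + 1)]
    refine Finset.card_le_card_of_injOn (fun a => a.val / B) ?_ ?_
    · intro a _
      simp only [Finset.coe_range, Set.mem_Iio]
      exact Nat.lt_succ_of_le (Nat.div_le_div_right (ZMod.val_lt a).le)
    · intro a ha b hb hab
      simp only [Finset.coe_filter, Finset.mem_univ, true_and, Set.mem_ofPred_eq] at ha hb hab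
      apply ZMod.val_injective n
      rw [← Nat.div_add_mod a.val B, ← Nat.div_add_mod b.val B, ha, hb, hab]
  calc _ ≤ (n / B + 1) * B := Nat.mul_le_mul_right _ h1
    _ = n / B * B + B := by ring
    _ ≤ n + B := by gcongr; exact Nat.div_mul_le_self n B
    _ ≤ 2 * n := by omega

open Classical in
/-- The number of block boundaries at a distance `d` from the home of `u` for which the
excess near the boundary is at least `γ * d - 4`. -/
noncomputable def boundaryCount (S : Finset T) (κ γ : ℝ) (B : ℕ) (u : T) (g : T → ZMod n) : ℕ :=
  ((Finset.Ico 1 n).filter (fun d : ℕ => (g u + (d : ZMod n)).val % B = 0 ∧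
    γ * d - 4 ≤ maxExcess S κ (g u + ((d / 2 : ℕ) : ZMod n)) g)).card

/-- As `u ∉ S`, the excess does not depend on the home of `u`. For each `d` the boundary condition,
of probability at most `2 / B`, separates from the tail event, and summing the tails over `d` gives
the mean of `(maxExcess + 4) / γ`. -/
lemma mul_sum_boundaryCount_le {γ : ℝ} (hγ : 0 < γ) {B : ℕ} (hBn : B ≤ n) {u : T}
    (hu : u ∉ S) (s : ZMod n) : γ * B * ∑ g : T → ZMod n, (boundaryCount S κ γ B u g : ℝ) ≤
      2 * ∑ g : T → ZMod n, (maxExcess S κ s g + 4) := by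
  have hn : (0 : ℝ) < n := by exact_mod_cast Nat.pos_of_ne_zero (NeZero.ne n)
  set W : ℕ → ℝ := fun d => ∑ g : T → ZMod n, if γ * d - 4 ≤ maxExcess S κ s g then 1 else 0
    with hW
  have hd : ∀ d : ℕ, B * ∑ g : T → ZMod n, (if (g u + (d : ZMod n)).val % B = 0 ∧
      γ * d - 4 ≤ maxExcess S κ (g u + ((d / 2 : ℕ) : ZMod n)) g then (1 : ℝ) else 0) ≤ 2 * W d := by
    intro d
    -- Resample the home of `u`; for each value `a` of it, rotation invariance turns the sum over
    -- `g` into `W d`.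
    have h1 := mul_sum_eq_sum_update u (fun g : T → ZMod n => if (g u + (d : ZMod n)).val % B = 0 ∧
      γ * d - 4 ≤ maxExcess S κ (g u + ((d / 2 : ℕ) : ZMod n)) g then (1 : ℝ) else 0)
    simp only [Function.update_self, maxExcess_update_of_notMem hu] at h1
    rw [Finset.sum_comm] at h1
    have h2 : ∀ a : ZMod n, ∑ g : T → ZMod n, (if (a + (d : ZMod n)).val % B = 0 ∧
        γ * d - 4 ≤ maxExcess S κ (a + ((d / 2 : ℕ) : ZMod n)) g then (1 : ℝ) else 0) =
        if (a + (d : ZMod n)).val % B = 0 then W d else 0 := by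
      intro a
      split_ifs with h
      · simp only [h, true_and]
        exact sum_comp_maxExcess (fun y => if γ * d - 4 ≤ y then (1 : ℝ) else 0) _ _
      · simp [h]
    simp only [h2] at h1
    have h6 := Equiv.sum_comp (Equiv.addRight (d : ZMod n))
      (fun a => if a.val % B = 0 then W d else 0)
    simp only [Equiv.coe_addRight] at h6
    rw [← Finset.sum_filter (fun a : ZMod n => a.val % B = 0), Finset.sum_const,
      nsmul_eq_mul] at h6
    replace h1 := h1.trans (Eq.trans (by congr!) h6)
    have h3 : ((Finset.univ.filter (fun a : ZMod n => a.val % B = 0)).card : ℝ) * B ≤ 2 * n := by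
      exact_mod_cast card_boundaries_mul_le hBn
    have h4 : 0 ≤ W d := Finset.sum_nonneg fun g _ => by split_ifs <;> norm_num
    have h5 := mul_le_mul_of_nonneg_right h3 h4
    refine le_of_mul_le_mul_left ?_ hn
    linear_combination h5 + B * h1
  have hsum : ∑ g : T → ZMod n, (boundaryCount S κ γ B u g : ℝ) =
      ∑ d ∈ Finset.Ico 1 n, ∑ g : T → ZMod n, (if (g u + (d : ZMod n)).val % B = 0 ∧
        γ * d - 4 ≤ maxExcess S κ (g u + ((d / 2 : ℕ) : ZMod n)) g then (1 : ℝ) else 0) := by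
    rw [Finset.sum_comm]
    refine Finset.sum_congr rfl fun g _ => ?_
    rw [boundaryCount, Finset.sum_boole]
  have hWsum : γ * ∑ d ∈ Finset.Ico 1 n, W d ≤ ∑ g : T → ZMod n, (maxExcess S κ s g + 4) := by
    rw [hW, Finset.sum_comm, Finset.mul_sum]
    refine Finset.sum_le_sum fun g _ => ?_
    have h0 := maxExcess_nonneg (S := S) (κ := κ) (g := g) (s := s)
    rw [Finset.sum_boole]
    have h1 : ((Finset.Ico 1 n).filter (fun d : ℕ => γ * d - 4 ≤ maxExcess S κ s g)).card ≤
        ⌊(maxExcess S κ s g + 4) / γ⌋₊ := by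
      have := Nat.card_Icc 1 ⌊(maxExcess S κ s g + 4) / γ⌋₊
      rw [Nat.add_sub_cancel] at this
      rw [← this]
      refine Finset.card_le_card fun d hd => ?_
      simp only [Finset.mem_filter, Finset.mem_Ico, Finset.mem_Icc] at hd ⊢
      refine ⟨hd.1.1, Nat.le_floor ?_⟩
      rw [le_div_iff₀ hγ]
      linarith [hd.2]
    have h2 : ((⌊(maxExcess S κ s g + 4) / γ⌋₊ : ℕ) : ℝ) ≤ (maxExcess S κ s g + 4) / γ :=
      Nat.floor_le (by positivity)
    rw [le_div_iff₀ hγ] at h2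
    have h3 := mul_le_mul_of_nonneg_left (Nat.cast_le (α := ℝ).2 h1) hγ.le
    linarith
  calc γ * B * ∑ g : T → ZMod n, (boundaryCount S κ γ B u g : ℝ)
      = γ * ∑ d ∈ Finset.Ico 1 n, (B * ∑ g : T → ZMod n, (if (g u + (d : ZMod n)).val % B = 0 ∧
        γ * d - 4 ≤ maxExcess S κ (g u + ((d / 2 : ℕ) : ZMod n)) g then (1 : ℝ) else 0)) := by
        rw [hsum, mul_assoc, Finset.mul_sum]
    _ ≤ γ * ∑ d ∈ Finset.Ico 1 n, 2 * W d :=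
        mul_le_mul_of_nonneg_left (Finset.sum_le_sum fun d _ => hd d) hγ.le
    _ ≤ _ := by
        rw [← Finset.mul_sum]
        linarith

/-- The average number of block boundaries that are crossed. -/
lemma sum_boundaryCount_add_le {S₁ S₂ : Finset T} {ρ : ℝ} (hρ : 0 < ρ) (hρ' : ρ ≤ 1 / 2)
    (h₁ : S₁.card ≤ (1 - 3 / 2 * ρ) * n) (h₂ : S₂.card ≤ ρ / 2 * n) {B : ℕ}
    (hBn : B ≤ n) {u : T} (hu₁ : u ∉ S₁) (hu₂ : u ∉ S₂) :
    B * ρ * ∑ g : T → ZMod n, ((boundaryCount S₁ (1 - ρ) (1 / 2) B u g : ℝ) +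
      boundaryCount S₂ (3 / 4 * ρ) (ρ / 8) B u g) ≤ 116 * Fintype.card (T → ZMod n) := by
  set N : ℝ := (Fintype.card (T → ZMod n) : ℝ) with hN
  have hN0 : 0 ≤ N := by positivity
  have a1 := sum_maxExcess_le (κ := 1 - ρ) (by linarith) h₁ (0 : ZMod n)
  have a2 := sum_maxExcess_le (κ := 3 / 4 * ρ) (by linarith) h₂ (0 : ZMod n)
  have b1 := mul_sum_boundaryCount_le (κ := 1 - ρ) (γ := 1 / 2) (by norm_num) hBn hu₁ 0
  have b2 := mul_sum_boundaryCount_le (κ := 3 / 4 * ρ) (γ := ρ / 8) (by linarith) hBn hu₂ 0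
  simp only [Finset.sum_add_distrib, Finset.sum_const, Finset.card_univ, nsmul_eq_mul] at b1 b2 ⊢
  set V₁ := ∑ g : T → ZMod n, maxExcess S₁ (1 - ρ) 0 g
  set V₂ := ∑ g : T → ZMod n, maxExcess S₂ (3 / 4 * ρ) 0 g
  set C₁ : ℝ := ∑ g : T → ZMod n, (boundaryCount S₁ (1 - ρ) (1 / 2) B u g : ℝ)
  set C₂ : ℝ := ∑ g : T → ZMod n, (boundaryCount S₂ (3 / 4 * ρ) (ρ / 8) B u g : ℝ)
  -- The gap between `κ` and the density of keys is `ρ / 2` for `S₁`, whence a mean excess of `3 /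
  -- ρ`. For `S₂` the gap is only `ρ / 4`, but the variance terms are at most `ρ`, so the mean
  -- excess is bounded.
  have c1 : ρ * V₁ ≤ 3 * N := by
    have : (1 - 3 / 2 * ρ + (1 - 3 / 2 * ρ) ^ 2 + (1 - ρ) ^ 2) * N ≤ 3 * N :=
      mul_le_mul_of_nonneg_right (by nlinarith) hN0
    linarith
  have c2 : V₂ ≤ 2 * N := by
    have : (ρ / 2 + (ρ / 2) ^ 2 + (3 / 4 * ρ) ^ 2) * N ≤ ρ * N :=
      mul_le_mul_of_nonneg_right (by nlinarith) hN0
    refine le_of_mul_le_mul_left ?_ hρ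
    linarith
  have d1 := mul_le_mul_of_nonneg_left b1 hρ.le
  have d3 : ρ * N ≤ 1 / 2 * N := mul_le_mul_of_nonneg_right hρ' hN0
  -- The two kinds contribute `4 * (3 + 2) = 20` and `16 * (2 + 4) = 96`, in total `116`.
  linarith

end

end Graveyard

namespace Graveyard

/-! ### Uniform hash functions -/

section

variable {U Ω : Type*} [MeasurableSpace Ω] {μ : Measure Ω} {h : U → Ω → ℝ}

lemma IsUniformHash.ae_mem (H : IsUniformHash h μ) (u : U) : ∀ᵐ ω ∂μ, h u ω ∈ Set.Ico 0 1 := by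
  refine ae_of_ae_map (H.measurable u).aemeasurable ?_
  rw [H.uniform u]
  exact ae_restrict_mem measurableSet_Ico

lemma IsUniformHash.ae_ne (H : IsUniformHash h μ) (u : U) (a : ℝ) : ∀ᵐ ω ∂μ, h u ω ≠ a := by
  refine ae_of_ae_map (p := fun r => r ≠ a) (H.measurable u).aemeasurable ?_
  rw [H.uniform u]
  exact Measure.ae_ne _ a

lemma IsUniformHash.ae_ne_of_ne [IsProbabilityMeasure μ] (H : IsUniformHash h μ) {u v : U}
    (huv : u ≠ v) : ∀ᵐ ω ∂μ, h u ω ≠ h v ω := by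
  have h1 := (indepFun_iff_map_prod_eq_prod_map_map (H.measurable u).aemeasurable
    (H.measurable v).aemeasurable).1 (H.indep.indepFun huv)
  have h2 : ∀ᵐ p ∂(μ.map (fun ω => (h u ω, h v ω))), p.1 ≠ p.2 := by
    rw [h1, H.uniform u, H.uniform v]
    have h3 : MeasurableSet {p : ℝ × ℝ | p.1 = p.2} := measurableSet_diagonal
    change ((volume.restrict (Set.Ico (0 : ℝ) 1)).prod (volume.restrict (Set.Ico 0 1)))
      {p : ℝ × ℝ | p.1 ≠ p.2}ᶜ = 0
    rw [show {p : ℝ × ℝ | p.1 ≠ p.2}ᶜ = {p : ℝ × ℝ | p.1 = p.2} by ext; simp,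
      Measure.measure_prod_null h3]
    refine Eventually.of_forall fun a => ?_
    simp only [Set.preimage_ofPred_eq, Pi.zero_apply]
    rw [show {b : ℝ | a = b} = {a} by ext; simp [eq_comm]]
    exact measure_singleton a
  exact ae_of_ae_map ((H.measurable u).prodMk (H.measurable v)).aemeasurable h2

/-- There are only countably many possible tombstone hashes, and `K` is finite, so countably many
null events are excluded. -/
lemma IsUniformHash.ae_goodHash [IsProbabilityMeasure μ] (H : IsUniformHash h μ) (K : Finset U) :
    ∀ᵐ ω ∂μ, GoodHash (fun u => h u ω) K := by
  have h1 : ∀ᵐ ω ∂μ, ∀ u ∈ K, h u ω ∈ Set.Ico 0 1 :=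
    (ae_ball_iff K.countable_toSet).2 fun u _ => H.ae_mem u
  have h2 : ∀ᵐ ω ∂μ, ∀ u ∈ K, ∀ n f k, h u ω ≠ tombHash n f k :=
    (ae_ball_iff K.countable_toSet).2 fun u _ => ae_all_iff.2 fun n => ae_all_iff.2 fun f =>
      ae_all_iff.2 fun k => H.ae_ne u _
  have h3 : ∀ᵐ ω ∂μ, ∀ u ∈ K, ∀ v ∈ K, u ≠ v → h u ω ≠ h v ω :=
    (ae_ball_iff K.countable_toSet).2 fun u _ => (ae_ball_iff K.countable_toSet).2 fun v _ => by
      by_cases huv : u = v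
      · exact Eventually.of_forall fun ω hne => absurd huv hne
      · filter_upwards [H.ae_ne_of_ne huv] with ω hω _ using hω
  filter_upwards [h1, h2, h3] with ω g1 g2 g3
  refine ⟨fun u hu => (g1 u hu).1, fun u hu => (g1 u hu).2, ?_, g2⟩
  intro u hu v hv huv
  by_contra hne
  exact g3 u hu v hv hne huv

/-- The home slot of a hash, as an element of the cyclic group. -/
noncomputable def cyclicHome (n : ℕ) (r : ℝ) : ZMod n := (home n r : ℕ)

lemma measurable_cyclicHome (n : ℕ) : Measurable (cyclicHome n) := by
  have h1 : Measurable (fun r : ℝ => home n r) :=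
    Nat.measurable_floor.comp (measurable_const.mul measurable_id)
  exact (measurable_from_top (f := fun k : ℕ => (k : ZMod n))).comp h1

lemma preimage_cyclicHome_inter {n : ℕ} [NeZero n] (a : ZMod n) :
    cyclicHome n ⁻¹' {a} ∩ Set.Ico 0 1 = Set.Ico ((a.val : ℝ) / n) ((a.val + 1) / n) := by
  have hn : (0 : ℝ) < n := by exact_mod_cast Nat.pos_of_ne_zero (NeZero.ne n)
  have ha : (a.val : ℝ) + 1 ≤ n := by exact_mod_cast ZMod.val_lt a
  ext r
  simp only [Set.mem_inter_iff, Set.mem_preimage, Set.mem_singleton_iff, Set.mem_Ico]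
  rw [div_le_iff₀ hn, lt_div_iff₀ hn]
  constructor
  · rintro ⟨h1, h2, h3⟩
    have h4 : home n r = a.val := by
      rw [← h1, cyclicHome, ZMod.val_natCast, Nat.mod_eq_of_lt
        (Graveyard.home_lt h2 h3 (Nat.pos_of_ne_zero (NeZero.ne n)))]
    rw [home, Nat.floor_eq_iff (by positivity)] at h4
    constructor <;> linarith
  · rintro ⟨h1, h2⟩
    have h3 : 0 ≤ r := by
      by_contra hr
      have : r * n < 0 := mul_neg_of_neg_of_pos (by linarith) hn
      have h5 : (0 : ℝ) ≤ a.val := by positivity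
      linarith
    refine ⟨?_, h3, ?_⟩
    · rw [cyclicHome, show home n r = a.val from ?_, ZMod.natCast_zmod_val]
      rw [home, Nat.floor_eq_iff (by positivity)]
      constructor <;> linarith
    · have : r * n < 1 * n := by linarith
      exact lt_of_mul_lt_mul_right this hn.le

lemma IsUniformHash.measure_cyclicHome (H : IsUniformHash h μ) {n : ℕ} [NeZero n] (u : U)
    (a : ZMod n) : μ (h u ⁻¹' (cyclicHome n ⁻¹' {a})) = ENNReal.ofReal (1 / n) := by
  have hm : MeasurableSet (cyclicHome n ⁻¹' {a}) :=
    measurable_cyclicHome n (MeasurableSet.of_discrete)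
  rw [← Measure.map_apply (H.measurable u) hm, H.uniform u, Measure.restrict_apply hm,
    preimage_cyclicHome_inter, Real.volume_Ico]
  congr 1
  ring

lemma IsUniformHash.measurable_homes (H : IsUniformHash h μ) (K : Finset U) (n : ℕ) :
    Measurable (fun ω => fun v : K => cyclicHome n (h v ω)) :=
  measurable_pi_lambda _ fun v => (measurable_cyclicHome n).comp (H.measurable v)

/-- The home slots of finitely many keys are uniformly distributed. -/
lemma IsUniformHash.lintegral_homes [DecidableEq U] (H : IsUniformHash h μ) (K : Finset U) {n : ℕ}
    [NeZero n] (Φ : (K → ZMod n) → ℕ) :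
    ∫⁻ ω, (Φ (fun v => cyclicHome n (h v ω)) : ℝ≥0∞) ∂μ =
      ENNReal.ofReal ((∑ g : K → ZMod n, (Φ g : ℝ)) / Fintype.card (K → ZMod n)) := by
  have hn : (0 : ℝ) < n := by exact_mod_cast Nat.pos_of_ne_zero (NeZero.ne n)
  have hmeas := H.measurable_homes K n
  have hg : ∀ g : K → ZMod n, (μ.map (fun ω => fun v : K => cyclicHome n (h v ω))) {g} =
      ENNReal.ofReal (1 / Fintype.card (K → ZMod n)) := by
    intro g
    rw [Measure.map_apply hmeas (measurableSet_singleton g)]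
    have h1 := H.indep.measure_inter_preimage_eq_mul K
      (sets := fun v => if hv : v ∈ K then cyclicHome n ⁻¹' {g ⟨v, hv⟩} else ∅) (fun v hv => by
        simp only [hv, dif_pos]
        exact measurable_cyclicHome n (MeasurableSet.of_discrete))
    have h2 : (fun ω => fun v : K => cyclicHome n (h v ω)) ⁻¹' {g} = ⋂ v ∈ K, h v ⁻¹'
        (if hv : v ∈ K then cyclicHome n ⁻¹' {g ⟨v, hv⟩} else ∅) := by
      ext ω
      simp only [Set.mem_preimage, Set.mem_singleton_iff, Set.mem_iInter, funext_iff,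
        Subtype.forall]
      refine forall₂_congr fun v hv => ?_
      simp [hv]
    rw [h2, h1, Finset.prod_congr rfl (g := fun _ => ENNReal.ofReal (1 / n)) (fun v hv => by
      simp only [hv, dif_pos]; exact H.measure_cyclicHome v _), Finset.prod_const,
      ← ENNReal.ofReal_pow (by positivity)]
    congr 1
    rw [Fintype.card_fun, ZMod.card, Fintype.card_coe, one_div_pow, Nat.cast_pow]
  rw [← lintegral_map (f := fun g : K → ZMod n => (Φ g : ℝ≥0∞)) (by fun_prop) hmeas,
    lintegral_fintype]
  simp only [hg]
  rw [← Finset.sum_mul, ← Nat.cast_sum, ← ENNReal.ofReal_natCast, ← ENNReal.ofReal_mul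
    (by positivity), Nat.cast_sum, mul_one_div]

lemma val_sub_cyclicHome {n : ℕ} [NeZero n] {r : ℝ} (hr : home n r < n) (i : ℕ) :
    ((i : ZMod n) - cyclicHome n r).val = disp n i r := by
  have h1 : (i : ZMod n) - cyclicHome n r = ((i + n - home n r : ℕ) : ZMod n) := by
    rw [Nat.cast_sub (by omega), Nat.cast_add, ZMod.natCast_self, add_zero, cyclicHome]
  rw [h1, ZMod.val_natCast, disp]

lemma Excess.le_maxExcess [DecidableEq U] {n : ℕ} [NeZero n] {K S : Finset U} {h : U → ℝ}
    {κ θ : ℝ} {i : ℕ} (H : Excess n S κ h i θ) (hS : S ⊆ K) (hK : ∀ u ∈ K, home n (h u) < n) :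
    θ ≤ maxExcess (S.subtype (· ∈ K)) κ (i : ZMod n) (fun v => cyclicHome n (h v)) := by
  classical
  obtain ⟨j, hj, h1⟩ := H
  refine le_maxExcess_iff.2 ⟨j, hj, h1.trans ?_⟩
  gcongr
  refine Finset.card_le_card_of_surjOn Subtype.val ?_
  intro v hv
  simp only [Finset.coe_filter, Set.mem_ofPred_eq] at hv
  refine ⟨⟨v, hS hv.1⟩, ?_, rfl⟩
  simp only [Finset.coe_filter, Set.mem_ofPred_eq, Finset.mem_subtype]
  refine ⟨hv.1, ?_⟩
  rw [val_sub_cyclicHome (hK v (hS hv.1))]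
  exact hv.2

lemma crossBound_le_boundaryCount [DecidableEq U] {n : ℕ} [NeZero n] {f B : ℕ}
    {base ins K : Finset U} {h : U → ℝ} (hK : GoodHash h K) (hsub : base ∪ ins ⊆ K) {u : U}
    (hu : u ∈ K) :
    crossBound n f B base ins h u ≤
      boundaryCount (((base ∪ ins).erase u).subtype (· ∈ K)) (1 - (f : ℝ) / (2 * n)) (1 / 2) B
        ⟨u, hu⟩ (fun v : K => cyclicHome n (h v)) +
      boundaryCount (((ins \ base).erase u).subtype (· ∈ K)) (3 / 4 * ((f : ℝ) / (2 * n)))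
        ((f : ℝ) / (2 * n) / 8) B ⟨u, hu⟩ (fun v : K => cyclicHome n (h v)) := by
  have hn := Nat.pos_of_ne_zero (NeZero.ne n)
  have hhome : ∀ v ∈ K, home n (h v) < n := fun v hv => hK.home_lt hn hv
  refine le_trans (Finset.card_le_card ?_) (Finset.card_union_le _ _)
  intro d hd
  simp only [Finset.mem_filter, Finset.mem_union] at hd ⊢
  obtain ⟨h1, h2, h3⟩ := hd
  have h4 : (cyclicHome n (h u) + (d : ZMod n)).val % B = 0 := by
    rw [cyclicHome, ← Nat.cast_add, ZMod.val_natCast]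
    exact h2
  have h5 : ((home n (h u) + d / 2 : ℕ) : ZMod n) = cyclicHome n (h u) + ((d / 2 : ℕ) : ZMod n) := by
    rw [cyclicHome, Nat.cast_add]
  rcases h3 with h3 | h3
  · refine Or.inl ⟨h1, h4, ?_⟩
    have := Excess.le_maxExcess (K := K) (by convert h3) ((Finset.erase_subset _ _).trans hsub) hhome
    rw [h5] at this
    refine le_trans (le_of_eq ?_) this
    ring
  · refine Or.inr ⟨h1, h4, ?_⟩
    have := Excess.le_maxExcess (K := K) (by convert h3) ((Finset.erase_subset _ _).trans
      (Finset.sdiff_subset.trans (Finset.subset_union_right.trans hsub))) hhome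
    rw [h5] at this
    refine le_trans (le_of_eq ?_) this
    ring

/-- The number of block boundaries that an operation crosses has a small expectation. -/
lemma IsUniformHash.exists_crossBound_le [DecidableEq U] [IsProbabilityMeasure μ] (H : IsUniformHash h μ)
    {c : Config} (hc : Admissible c) {w : Window U} (hw : w.Counts c 0) (u : U) :
    ∃ G : Ω → ℝ≥0∞, Measurable G ∧
      (∀ᵐ ω ∂μ, crossBound (w.cap c) (w.slack c) c.B w.base w.ins (fun v => h v ω) u ≤ G ω) ∧
      ∫⁻ ω, G ω ∂μ ≤ ENNReal.ofReal (464 * c.x / c.B) := by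
  have hB := hc.B_pos
  have hx := hc.one_le_x
  have hsl := w.base_card_add_slack hc
  have hslack : 32 ≤ w.slack c := hc.le_slack _
  have hinsc : w.ins.card ≤ w.slack c / 4 := by have := hw.ins_le; omega
  have hBn : c.B ≤ w.cap c := hc.B_le_newCap _
  have hnx : (w.cap c : ℝ) ≤ 2 * c.x * w.slack c :=
    hc.newCap_le_mul _
  set n := w.cap c
  set f := w.slack c
  have : NeZero n := ⟨by omega⟩
  set ρ : ℝ := (f : ℝ) / (2 * n) with hρ
  have hn : (0 : ℝ) < n := by exact_mod_cast Nat.pos_of_ne_zero (NeZero.ne n)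
  have hf : (0 : ℝ) < f := by exact_mod_cast (show 0 < f by omega)
  have hρ0 : 0 < ρ := by positivity
  have hfρ : (f : ℝ) = 2 * ρ * n := by rw [hρ]; field_simp
  have hρ1 : ρ ≤ 1 / 2 := by
    have : (f : ℝ) ≤ n := by exact_mod_cast (show f ≤ n by omega)
    rw [hρ, div_le_iff₀ (by positivity)]
    linarith
  -- The tombstone density is at least `1 / (4 * x)`, which turns `116 / (ρ * B)` into `464 * x /
  -- B`.
  have hρx : 1 ≤ 4 * c.x * ρ := by
    refine le_of_mul_le_mul_right ?_ hn
    rw [hfρ] at hnx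
    linarith
  obtain ⟨K, hu, hsub⟩ : ∃ K : Finset U, u ∈ K ∧ w.base ∪ w.ins ⊆ K :=
    ⟨insert u (w.base ∪ w.ins), Finset.mem_insert_self _ _, Finset.subset_insert _ _⟩
  have hcross : ∀ᵐ ω ∂μ, _ := (H.ae_goodHash K).mono fun ω hω =>
    crossBound_le_boundaryCount (n := n) (f := f) (B := c.B) hω hsub hu
  have hu₁ : (⟨u, hu⟩ : K) ∉ ((w.base ∪ w.ins).erase u).subtype (· ∈ K) := by simp
  have hu₂ : (⟨u, hu⟩ : K) ∉ ((w.ins \ w.base).erase u).subtype (· ∈ K) := by simp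
  have hcard : ∀ S : Finset U, (S.subtype (· ∈ K)).card ≤ S.card := fun S => by
    rw [Finset.card_subtype]; exact Finset.card_filter_le _ _
  have h4 : ((f / 4 : ℕ) : ℝ) ≤ f / 4 := Nat.cast_div_le
  obtain ⟨S₁, hS₁'⟩ : ∃ S : Finset K, S = ((w.base ∪ w.ins).erase u).subtype (· ∈ K) := ⟨_, rfl⟩
  obtain ⟨S₂, hS₂'⟩ : ∃ S : Finset K, S = ((w.ins \ w.base).erase u).subtype (· ∈ K) := ⟨_, rfl⟩
  rw [← hS₁'] at hu₁ hcross
  rw [← hS₂'] at hu₂ hcross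
  have hS₁ : (S₁.card : ℝ) ≤ (1 - 3 / 2 * ρ) * n := by
    have h1 : S₁.card ≤ w.base.card + f / 4 :=
      hS₁' ▸ (hcard _).trans (Finset.card_erase_le.trans ((Finset.card_union_le _ _).trans (by omega)))
    have h2 : (S₁.card : ℝ) ≤ w.base.card + (f / 4 : ℕ) := by exact_mod_cast h1
    have h3 : (w.base.card : ℝ) + f = n := by exact_mod_cast hsl
    linarith
  have hS₂ : (S₂.card : ℝ) ≤ ρ / 2 * n := by
    have h1 : S₂.card ≤ f / 4 :=
      hS₂' ▸ (hcard _).trans (Finset.card_erase_le.trans ((Finset.card_le_card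
        Finset.sdiff_subset).trans hinsc))
    have h2 : (S₂.card : ℝ) ≤ (f / 4 : ℕ) := by exact_mod_cast h1
    linarith
  have key := sum_boundaryCount_add_le hρ0 hρ1 hS₁ hS₂ hBn hu₁ hu₂
  set Φ : (K → ZMod n) → ℕ := fun g => boundaryCount S₁ (1 - ρ) (1 / 2) c.B ⟨u, hu⟩ g +
    boundaryCount S₂ (3 / 4 * ρ) (ρ / 8) c.B ⟨u, hu⟩ g with hΦ
  -- The majorant depends on `ω` only through the home slots of the keys in the finite set `K`. It
  -- is therefore measurable, and no measurability of `crossBound` itself is needed.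
  refine ⟨fun ω => (Φ (fun v => cyclicHome n (h v ω)) : ℝ≥0∞),
    (measurable_from_top (f := fun k : ℕ => (k : ℝ≥0∞))).comp
      ((Measurable.of_discrete (f := Φ)).comp (H.measurable_homes K n)),
    hcross.mono fun ω hω => Nat.cast_le.2 hω, (H.lintegral_homes K Φ).le.trans ?_⟩
  simp only [hΦ, Nat.cast_add]
  refine ENNReal.ofReal_le_ofReal ?_
  have hN : (0 : ℝ) < Fintype.card (K → ZMod n) := by exact_mod_cast Fintype.card_pos
  have hB' : (0 : ℝ) < c.B := by exact_mod_cast hB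
  rw [div_le_div_iff₀ hN hB']
  generalize hs : ∑ g : K → ZMod n, ((boundaryCount S₁ (1 - ρ) (1 / 2) c.B ⟨u, hu⟩ g : ℝ) +
    boundaryCount S₂ (3 / 4 * ρ) (ρ / 8) c.B ⟨u, hu⟩ g) = Z at key ⊢
  have hs0 : 0 ≤ Z := hs ▸ Finset.sum_nonneg fun g _ => by positivity
  have h6 := mul_le_mul_of_nonneg_right hρx (mul_nonneg hs0 hB'.le)
  have h7 := mul_le_mul_of_nonneg_left key (show (0 : ℝ) ≤ 4 * c.x by positivity)
  linarith

end

end Graveyard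

namespace Graveyard

variable {U : Type*}

/-! ### Sequences of operations -/

/-- The initial rebuild reads a table without slots, from which nothing is taken. Resetting the
internal memory and the count of transfers does not affect `WinInv`. -/
lemma start_winInv {c : Config} (hc : Admissible c) {h : U → ℝ} {K : Finset U}
    (hK : GoodHash h K) : WinInv c h (newWindow c ∅) (start c h) := by
  have hno : ∀ (A : ℕ → Slot U) i u, ¬ Taken h 0 A i u := by
    rintro A i u ⟨-, ⟨h1, -⟩ | ⟨-, h1⟩⟩
    · omega
    · simp [home] at h1
  have R := rebuild_spec (c := c) (h := h) hc.two_le hc.one_le_L hc.one_le_x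
    (t := { side := false, cap := 0, keys := 0, left := 0 })
    (s := { arr := fun _ _ => .free, resident := [], transfers := 0 }) (S := ∅) rfl
    (fun u => by simp) (by simp) (by simp)
    (fun i j u v _ hi _ => absurd hi (hno _ _ _)) (by simp)
  have H := rebuild_winInv hc hK (Finset.empty_subset K) R
  exact ⟨H.cap, H.keys, H.left, H.core⟩

lemma Window.step_cur [DecidableEq U] (c : Config) (w : Window U) (op : Op U) :
    (w.step c op).cur = op.keys w.cur := by
  have htick : ∀ w : Window U, (w.tick c).cur = w.cur := by
    intro w
    unfold Window.tick
    split_ifs <;> rfl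
  cases op with
  | insert u =>
    rw [Window.step, htick, Op.keys]
    ext
    simp
  | delete u =>
    rw [Window.step, htick, Op.keys]
    ext
    simp
  | query u => rfl

lemma windowAfter_cur [DecidableEq U] (c : Config) (ops : List (Op U)) :
    (windowAfter c ops).cur = keysAfter ops := by
  have : ∀ (ops : List (Op U)) (w : Window U),
      (ops.foldl (Window.step c) w).cur = ops.foldl Op.keys w.cur := by
    intro ops
    induction ops with
    | nil => intro w; rfl
    | cons op l ih =>
      intro w
      rw [List.foldl_cons, List.foldl_cons, ih, Window.step_cur]
  exact this ops _

open Classical in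
lemma Window.step_subset (c : Config) {w : Window U} {K : Finset U}
    (hw : w.base ∪ w.ins ⊆ K) (hcur : w.cur ⊆ K) {op : Op U} (hop : op.key ∈ K) :
    (w.step c op).base ∪ (w.step c op).ins ⊆ K := by
  have htick : ∀ w : Window U, w.base ∪ w.ins ⊆ K → w.cur ⊆ K →
      (w.tick c).base ∪ (w.tick c).ins ⊆ K := by
    intro w h1 h2
    unfold Window.tick
    split_ifs
    · simpa [newWindow] using h2
    · exact h1
  cases op with
  | insert u =>
    have hu : u ∈ K := hop
    rw [Finset.union_subset_iff] at hw
    refine htick _ (Finset.union_subset hw.1 ?_) ?_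
    · intro v hv
      rcases Finset.mem_union.1 hv with h1 | h1
      · exact hw.2 h1
      · rwa [Finset.mem_singleton.1 h1]
    · intro v hv
      rcases Finset.mem_union.1 hv with h1 | h1
      · exact hcur h1
      · rwa [Finset.mem_singleton.1 h1]
  | delete u => exact htick _ hw (fun v hv => hcur (Finset.mem_of_mem_erase hv))
  | query u => exact hw

/-- The bounds on the numbers of crossed block boundaries, added up over a sequence of operations. -/
noncomputable def crossTotal (c : Config) (h : U → ℝ) : Window U → List (Op U) → ℕ
  | _, [] => 0
  | w, op :: l => crossBound (w.cap c) (w.slack c) c.B w.base w.ins h op.key +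
      crossTotal c h (w.step c op) l

lemma foldl_step_spec [DecidableEq U] {c : Config} (hc : Admissible c) {h : U → ℝ} {K : Finset U}
    (hK : GoodHash h K) (ops : List (Op U)) :
    ∀ (w : Window U) (ts : Table × Mem U), WinInv c h w ts → w.Counts c 0 →
      w.base ∪ w.ins ⊆ K → (∀ op ∈ ops, op.key ∈ K) →
      (∀ l₁ l₂ u, ops = l₁ ++ Op.insert u :: l₂ → u ∉ l₁.foldl Op.keys w.cur) →
      WinInv c h (ops.foldl (Window.step c) w) (ops.foldl (step c h) ts) ∧
        ((ops.foldl (step c h) ts).2.transfers : ℝ) ≤ ts.2.transfers + rebuildShare c * w.used c +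
          (ops.length * (1 + rebuildShare c) + crossTotal c h w ops) := by
  induction ops with
  | nil =>
    intro w ts H hw _ _ _
    refine ⟨H, ?_⟩
    -- Savings that are left at the end are nonnegative and may be dropped.
    have h1 : 0 ≤ w.used c := by
      have h2 : (w.left : ℝ) ≤ (w.slack c / 4 : ℕ) := by exact_mod_cast hw.left_le
      unfold Window.used
      linarith
    have h2 := mul_nonneg (rebuildShare_nonneg hc) h1
    simp [crossTotal]
    linarith
  | cons op l ih =>
    intro w ts H hw hsub hops hwork
    have hop := hops op (List.mem_cons_self ..)
    have hcurK : w.cur ⊆ K := by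
      refine H.core.sub.trans (le_trans (le_of_eq ?_) hsub)
      ext
      simp
    obtain ⟨H', hcost⟩ := step_spec hc hK H hw (by convert hsub) hop (fun u hu => by
      have := hwork [] l u (by rw [hu]; rfl)
      simpa using this)
    obtain ⟨H₂, hcost₂⟩ := ih _ _ H' (hw.step hc op) (by
        have := Window.step_subset c (by convert hsub) hcurK hop
        convert this)
      (fun o ho => hops o (List.mem_cons_of_mem _ ho)) (fun l₁ l₂ u hl => by
        have := hwork (op :: l₁) l₂ u (by rw [hl]; rfl)
        rwa [List.foldl_cons, ← Window.step_cur c] at this)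
    refine ⟨H₂, ?_⟩
    simp only [List.foldl_cons, List.length_cons, crossTotal]
    push_cast
    linarith

lemma windowAfter_counts {c : Config} (hc : Admissible c) (ops : List (Op U)) :
    (windowAfter c ops).Counts c 0 := by
  have : ∀ (ops : List (Op U)) (w : Window U), w.Counts c 0 →
      (ops.foldl (Window.step c) w).Counts c 0 := by
    intro ops
    induction ops with
    | nil => exact fun w hw => hw
    | cons op l ih => exact fun w hw => ih _ (hw.step hc op)
  exact this ops _ (newWindow_counts hc ∅)

lemma run_spec [DecidableEq U] {c : Config} (hc : Admissible c) {h : U → ℝ} {ops : List (Op U)}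
    (hK : GoodHash h (ops.map Op.key).toFinset) (hops : IsWorkload ops) :
    WinInv c h (windowAfter c ops) (run c h ops) ∧
      (blockTransfers c h ops : ℝ) ≤
        ops.length * (1 + rebuildShare c) + crossTotal c h (newWindow c ∅) ops := by
  obtain ⟨h1, h2⟩ := foldl_step_spec hc hK ops (newWindow c ∅) (start c h) (start_winInv hc hK)
    (newWindow_counts hc ∅) (by simp [newWindow])
    (fun op hop => List.mem_toFinset.2 (List.mem_map_of_mem hop)) hops
  refine ⟨h1, h2.trans (le_of_eq ?_)⟩
  rw [newWindow_used hc]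
  simp [start]

/-! ### The load factor -/

/-- At most a quarter of the slack is consumed in a window, and the slack is at least the fraction
`1 / (2 * x)` of the slots. -/
lemma Window.Counts.load_le {c : Config} (hc : Admissible c) {w : Window U} (H : w.Counts c 0) :
    (w.cur.card : ℝ) / w.cap c ≤ 1 - 1 / (4 * c.x) := by
  have hx := hc.one_le_x
  have h1 := w.base_card_add_slack hc
  have h2 := H.cur_le
  have h3 : (w.cap c : ℝ) ≤ 2 * c.x * w.slack c := hc.newCap_le_mul _
  have h4 : 32 ≤ w.slack c := hc.le_slack _
  have h5 : ((w.slack c / 4 : ℕ) : ℝ) ≤ w.slack c / 4 := Nat.cast_div_le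
  have h6 : (w.cur.card : ℝ) ≤ w.base.card + (w.slack c / 4 : ℕ) := by
    exact_mod_cast (by omega)
  have h7 : (w.base.card : ℝ) + w.slack c = w.cap c := by exact_mod_cast h1
  have h8 : (0 : ℝ) < w.cap c := by exact_mod_cast (by omega)
  rw [div_le_iff₀ h8, sub_mul, one_mul]
  have h9 : 1 / (4 * c.x) * w.cap c ≤ w.slack c / 2 := by
    rw [div_mul_eq_mul_div, div_le_iff₀ (by linarith)]
    linarith
  have h10 : (0 : ℝ) ≤ w.slack c := by positivity
  linarith

/-- If the capacity is `L`, the keys fill the table. Otherwise the slack is at most `n / x + 1` and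
grows by at most a quarter; as it is at least `32`, rounding is absorbed in the factor `4`. -/
lemma Window.Counts.le_load {c : Config} (hc : Admissible c) {w : Window U} (H : w.Counts c 0)
    (hL : c.L ≤ w.cur.card) : 1 - 4 / c.x ≤ (w.cur.card : ℝ) / w.cap c := by
  have hx := hc.one_le_x
  have h1 := w.base_card_add_slack hc
  have h2 := H.base_le
  have h4 : 32 ≤ w.slack c := hc.le_slack _
  have h8 : (0 : ℝ) < w.cap c := by exact_mod_cast (by omega)
  rw [le_div_iff₀ h8, sub_mul, one_mul, div_mul_eq_mul_div]
  have h9 : (0 : ℝ) ≤ 4 * w.cap c / c.x := by positivity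
  rcases le_total c.L (w.base.card + ⌈(w.base.card : ℝ) / c.x⌉₊) with h | h
  · have h10 : w.slack c = ⌈(w.base.card : ℝ) / c.x⌉₊ := by
      have : w.cap c = w.base.card + ⌈(w.base.card : ℝ) / c.x⌉₊ := max_eq_right h
      omega
    have h11 := (Nat.ceil_lt_add_one (show 0 ≤ (w.base.card : ℝ) / c.x by positivity)).le
    rw [← h10] at h11
    have h5 : ((w.slack c / 4 : ℕ) : ℝ) ≤ w.slack c / 4 := Nat.cast_div_le
    have h6 : (w.base.card : ℝ) ≤ w.cur.card + (w.slack c / 4 : ℕ) := by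
      exact_mod_cast (by omega)
    have h7 : (w.base.card : ℝ) + w.slack c = w.cap c := by exact_mod_cast h1
    have h12 : (32 : ℝ) ≤ w.slack c := by exact_mod_cast h4
    have h13 : (w.base.card : ℝ) / c.x ≤ w.cap c / c.x := by
      gcongr
      linarith
    rw [mul_div_assoc] at h9 ⊢
    linarith
  · have h10 : w.cap c = c.L := max_eq_left h
    have h11 : (w.cap c : ℝ) ≤ w.cur.card := by rw [h10]; exact_mod_cast hL
    linarith

/-! ### Expectations -/

/-- The window before each operation is determined by the earlier operations alone, so every bound
refers to sets of keys fixed independently of the hashes, and linearity of expectation applies. -/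
lemma IsUniformHash.exists_crossTotal_le [DecidableEq U] {Ω : Type*} [MeasurableSpace Ω]
    {μ : Measure Ω} [IsProbabilityMeasure μ] {h : U → Ω → ℝ} (H : IsUniformHash h μ) {c : Config}
    (hc : Admissible c) (ops : List (Op U)) : ∀ w : Window U, w.Counts c 0 →
      ∃ G : Ω → ℝ≥0∞, Measurable G ∧ (∀ᵐ ω ∂μ, crossTotal c (fun v => h v ω) w ops ≤ G ω) ∧
        ∫⁻ ω, G ω ∂μ ≤ ENNReal.ofReal (ops.length * (464 * c.x / c.B)) := by
  induction ops with
  | nil => exact fun w _ => ⟨0, measurable_zero, by simp [crossTotal], by simp⟩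
  | cons op l ih =>
    intro w hw
    obtain ⟨G₁, hG₁, hle₁, hint₁⟩ := H.exists_crossBound_le hc hw op.key
    obtain ⟨G₂, hG₂, hle₂, hint₂⟩ := ih _ (hw.step hc op)
    refine ⟨G₁ + G₂, hG₁.add hG₂, ?_, ?_⟩
    · filter_upwards [hle₁, hle₂] with ω h1 h2
      simp only [crossTotal, Nat.cast_add, Pi.add_apply]
      exact add_le_add h1 h2
    · have hx := hc.one_le_x
      simp only [Pi.add_apply]
      rw [lintegral_add_left hG₁, List.length_cons, Nat.cast_add, Nat.cast_one, add_mul, one_mul,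
        add_comm, ENNReal.ofReal_add (by positivity) (by positivity)]
      exact add_le_add hint₂ hint₁

lemma IsUniformHash.lintegral_blockTransfers_le [DecidableEq U] {Ω : Type*} [MeasurableSpace Ω]
    {μ : Measure Ω} [IsProbabilityMeasure μ] {h : U → Ω → ℝ} (H : IsUniformHash h μ) {c : Config}
    (hc : Admissible c) {ops : List (Op U)} (hops : IsWorkload ops) :
    ∫⁻ ω, (blockTransfers c (fun u => h u ω) ops : ℝ≥0∞) ∂μ ≤
      ENNReal.ofReal ((1 + 944 * c.x / c.B) * ops.length) := by
  have hx := hc.one_le_x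
  have hα := rebuildShare_nonneg hc
  obtain ⟨G, -, hle, hint⟩ := H.exists_crossTotal_le hc ops _ (newWindow_counts hc ∅)
  calc ∫⁻ ω, (blockTransfers c (fun u => h u ω) ops : ℝ≥0∞) ∂μ
      ≤ ∫⁻ ω, (ENNReal.ofReal (ops.length * (1 + rebuildShare c)) + G ω) ∂μ := by
        refine lintegral_mono_ae ?_
        filter_upwards [hle, H.ae_goodHash (ops.map Op.key).toFinset] with ω h1 h2
        refine le_trans ?_ (add_le_add_right h1 _)
        rw [← ENNReal.ofReal_natCast, ← ENNReal.ofReal_natCast,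
          ← ENNReal.ofReal_add (by positivity) (by positivity)]
        exact ENNReal.ofReal_le_ofReal (run_spec hc h2 hops).2
    _ = ENNReal.ofReal (ops.length * (1 + rebuildShare c)) + ∫⁻ ω, G ω ∂μ := by
        rw [lintegral_add_left measurable_const, lintegral_const, measure_univ, mul_one]
    _ ≤ ENNReal.ofReal (ops.length * (1 + rebuildShare c)) +
          ENNReal.ofReal (ops.length * (464 * c.x / c.B)) := by gcongr
    _ = _ := by
        rw [← ENNReal.ofReal_add (by positivity) (by positivity), rebuildShare]
        congr 1
        ring

end Graveyard

theorem mainTheorem8 {ι : Type*} (l : Filter ι) (x : ι → ℝ) (B : ι → ℕ)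
    (hx : ∀ i, 1 ≤ x i) (hxB : x =o[l] (fun i => (B i : ℝ))) :
    ∃ e : ι → ℝ, Tendsto e l (𝓝 0) ∧
      ∀ᶠ i in l, ∀ M L : ℕ, 3 * B i ≤ M → B i ≤ L →
        ∀ (U : Type*) [DecidableEq U] (Ω : Type*) [MeasurableSpace Ω]
          (μ : Measure Ω) [IsProbabilityMeasure μ] (h : U → Ω → ℝ),
          Graveyard.IsUniformHash h μ →
          ∀ ops : List (Graveyard.Op U), Graveyard.IsWorkload ops →
            (∀ᵐ ω ∂μ,
              Graveyard.loadFactor ⟨B i, M, L, x i⟩ (fun u => h u ω) ops ≤ 1 - 1 / (4 * x i) ∧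
              (L ≤ (Graveyard.keysAfter ops).card →
                1 - 4 / x i ≤ Graveyard.loadFactor ⟨B i, M, L, x i⟩ (fun u => h u ω) ops)) ∧
            ∫⁻ ω, (Graveyard.blockTransfers ⟨B i, M, L, x i⟩ (fun u => h u ω) ops : ℝ≥0∞) ∂μ
              ≤ ENNReal.ofReal ((1 + e i) * ops.length) := by
  -- `944 = 480 + 464`: the share of the rebuilds and that of the crossed boundaries.
  refine ⟨fun i => 944 * x i / B i, ?_, ?_⟩
  · have h1 := hxB.tendsto_div_nhds_zero.const_mul 944
    rw [mul_zero] at h1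
    exact h1.congr fun i => by ring
  -- The constant `1 / 64` is what `Admissible` asks of the block size.
  · filter_upwards [hxB.def (show (0 : ℝ) < 1 / 64 by norm_num)] with i hi M L hM hL
    intro U _ Ω _ μ _ h H ops hops
    have hc : Graveyard.Admissible ⟨B i, M, L, x i⟩ := by
      refine ⟨hx i, hM, hL, ?_⟩
      have h1 : (0 : ℝ) ≤ B i := by positivity
      rw [Real.norm_of_nonneg (by linarith [hx i]), Real.norm_of_nonneg h1] at hi
      change 64 * x i ≤ B i
      linarith
    refine ⟨?_, H.lintegral_blockTransfers_le hc hops⟩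
    filter_upwards [H.ae_goodHash (ops.map Graveyard.Op.key).toFinset] with ω hω
    have hcap := (Graveyard.run_spec hc hω hops).1.cap
    have hcounts := Graveyard.windowAfter_counts hc ops
    rw [Graveyard.loadFactor, hcap, ← Graveyard.windowAfter_cur ⟨B i, M, L, x i⟩ ops]
    exact ⟨hcounts.load_le hc, fun hle => hcounts.le_load hc hle⟩
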